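/- **Data.** Let $R$ be a commutative Noetherian ring, let $F$ and $G$ be free $R$-modules of ranks $3$ and $2$, and let $\phi:F\to G$, $\ell:F^*\to G$ be homomorphisms, $\psi\in\bigwedge^2F^*$, $\zeta\in\bigwedge^2G$, $z_2\in R$, and $p:\bigwedge^2G\otimes\bigwedge^3F^*\to R$ an isomorphism. For a finitely generated free module $V$, each of $\bigwedge^\bullet V$, $\bigwedge^\bullet V^*$ is a module over the other: an element of degree one acts as the antiderivation that extends evaluation, and products act by composition; $\alpha(x)$ denotes the action of $\alpha$ on $x$. For a basis $e_1,e_2,e_3$ of $F$ and a basis $\beta_1,\beta_2$ of $G$ put $\chi_F=e_1\wedge e_2\wedge e_3$, $\chi_{F^*}=e_3^*\wedge e_2^*\wedge e_1^*$, $\chi_G=\beta_1\wedge\beta_2$, $\chi_{G^*}=\beta_2^*\wedge\beta_1^*$; write $\phi^*:G^*\to F^*$, $\ell^*:G^*\to F$ for the duals and $\sigma=\sum_i\phi(e_i)\wedge\ell(e_i^*)\in\bigwedge^2G$. Lower case $g_i,\gamma_i,f_i,\mathfrak f_i$ are elements of $\bigwedge^iG,\bigwedge^iG^*,\bigwedge^iF,\bigwedge^iF^*$.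 **Brown's complex** $\mathbb B: 0\to B_3\xrightarrow{b_3}B_2\xrightarrow{b_2}B_1\xrightarrow{b_1}B_0$ has $B_3=(\bigwedge^2G^*\otimes\bigwedge^3F)\oplus\bigwedge^3F$, $B_2=\bigwedge^3F\oplus G^*\oplus F$, $B_1=G\oplus F^*$, $B_0=\bigwedge^2G\otimes\bigwedge^3F^*$ and $$b_3(\gamma_2\otimes f_3,f_3')=\big(\zeta(\gamma_2)f_3-z_2f_3',\ -[\phi(\psi(f_3))](\gamma_2),\ [(\textstyle\bigwedge^2\phi^*)(\gamma_2)](f_3)+\psi(f_3')\big),$$ $$b_2(f_3,\gamma_1,f_1)=\big(\phi(\psi(f_3))+\gamma_1(\zeta)+z_2\phi(f_1),\ -\phi^*(\gamma_1)+f_1(\psi)\big),$$ $$b_1(g_1,\mathfrak f_1)=-(g_1\wedge\phi[\psi(\chi_F)])\otimes\chi_{F^*}+z_2\,\chi_G\otimes(\mathfrak f_1\wedge(\textstyle\bigwedge^2\phi^*)(\chi_{G^*}))+\zeta\otimes(\mathfrak f_1\wedge\psi).$$ **The complex** $\mathbb Q: 0\to Q_3\xrightarrow{q_3}Q_2\xrightarrow{q_2}Q_1\xrightarrow{q_1}Q_0$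 has $Q_3=G^*$, $Q_2=\bigwedge^3F^*\oplus G\oplus F^*$, $Q_1=(\bigwedge^2G\otimes\bigwedge^3F^*)\oplus\bigwedge^3F^*\oplus\bigwedge^2F$, $Q_0=\bigwedge^3F$ and $$q_3(\gamma_1)=\big(\phi^*(\gamma_1)\wedge\psi,\ \phi(\ell^*(\gamma_1))-\gamma_1(\zeta),\ [\ell^*(\gamma_1)](\psi)+z_2\phi^*(\gamma_1)\big),$$ $$q_2(\mathfrak f_3,0,0)=\big(\zeta\otimes\mathfrak f_3,\ -z_2\mathfrak f_3,\ -p(\chi_G\otimes\mathfrak f_3)(\textstyle\bigwedge^2\ell^*)(\chi_{G^*})\big),$$ $$q_2(0,g_1,0)=\big(-[g_1\wedge\phi(\psi(\chi_F))]\otimes\chi_{F^*},\ 0,\ -p(\chi_G\otimes\chi_{F^*})\,\{\ell^*(g_1(\chi_{G^*}))\wedge\psi(\chi_F)+z_2[\phi^*(g_1(\chi_{G^*}))](\chi_F)\}\big),$$ $$q_2(0,0,\mathfrak f_1)=\big(\chi_G\otimes(\mathfrak f_1\wedge(\textstyle\bigwedge^2\phi^*)(\chi_{G^*})),\ \mathfrak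 f_1\wedge\psi,\ -p(\sigma\otimes\chi_{F^*})\mathfrak f_1(\chi_F)+p(\chi_G\otimes\chi_{F^*})[\phi^*([\ell(\mathfrak f_1)](\chi_{G^*}))](\chi_F)-p(\zeta\otimes\chi_{F^*})\mathfrak f_1(\chi_F)\big),$$ $$q_1(g_2\otimes\mathfrak f_3,0,0)=-p(g_2\otimes\mathfrak f_3)\,\{p((\textstyle\bigwedge^2\ell)(\psi)\otimes\chi_{F^*})+z_2\,p(\sigma\otimes\chi_{F^*})+z_2\,p(\zeta\otimes\chi_{F^*})\}\,\chi_F,$$ $$q_1(0,\mathfrak f_3,0)=\{p(\chi_G\otimes\mathfrak f_3)\,p([\textstyle\bigwedge^2(\phi\circ\ell^*)](\chi_{G^*})\otimes\chi_{F^*})-p(\zeta\otimes\chi_{F^*})\,p(\sigma\otimes\mathfrak f_3)-p(\zeta\otimes\chi_{F^*})\,p(\zeta\otimes\mathfrak f_3)\}\,\chi_F,$$ $$q_1(0,0,f_2)=p(\chi_G\otimes\chi_{F^*})\; f_2\wedge\{\ell^*([\phi(\psi(\chi_F))](\chi_{G^*}))-z_2[(\textstyle\bigwedge^2\phi^*)(\chi_{G^*})](\chi_F)-\zeta(\chi_{G^*})\psi(\chi_F)\}.$$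 **The comparison map.** Let $c_0=p^{-1}:R\to B_0$, $c_1=(\ell,\mathrm{id}):F^*\to B_1$, $\kappa=p\circ b_1\circ c_1\in F^{**}=F$, and let $\mathbb K: 0\to\bigwedge^3F^*\to\bigwedge^2F^*\to F^*\xrightarrow{\kappa}R$ be the Koszul complex, whose maps are the action of $\kappa$. Let $c_2:\bigwedge^2F^*\to B_2$ and $c_3:\bigwedge^3F^*\to B_3$ be $$c_2(\mathfrak f_2)=p(\chi_G\otimes\chi_{F^*})\cdot\big(-[(\textstyle\bigwedge^2\ell)(\mathfrak f_2)](\chi_{G^*})\chi_F,\ [\ell([\psi(\chi_F)](\mathfrak f_2))](\chi_{G^*})+z_2[\phi(\mathfrak f_2(\chi_F))](\chi_{G^*}),\ -\sigma(\chi_{G^*})\mathfrak f_2(\chi_F)-\ell^*([\phi(\mathfrak f_2(\chi_F))](\chi_{G^*}))-\zeta(\chi_{G^*})\mathfrak f_2(\chi_F)\big),$$ $$c_3(\mathfrak f_3)=\big(-p(\chi_G\otimes\chi_{F^*})\{p((\textstyle\bigwedge^2\ell)(\psi)\otimes\mathfrak f_3)+z_2p(\sigma\otimes\mathfrak f_3)+z_2p(\zeta\otimes\mathfrak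 f_3)\}\,\chi_{G^*}\otimes\chi_F,$$ $$\qquad\{p(\chi_G\otimes\chi_{F^*})\,p([\textstyle\bigwedge^2(\phi\circ\ell^*)](\chi_{G^*})\otimes\mathfrak f_3)-p(\zeta\otimes\mathfrak f_3)\,p(\sigma\otimes\chi_{F^*})-p(\zeta\otimes\mathfrak f_3)\,p(\zeta\otimes\chi_{F^*})\}\,\chi_F\big).$$ The mapping cone of $c:\mathbb K\to\mathbb B$ has differential $(k,b)\mapsto(-\partial k,\,c(k)+\partial b)$; its dual is denoted $\operatorname{Tot}(c^*)$: $$0\to B_0^*\to R^*\oplus B_1^*\to(F^*)^*\oplus B_2^*\to(\textstyle\bigwedge^2F^*)^*\oplus B_3^*\to(\bigwedge^3F^*)^*.$$ **Terminology.** Write $\operatorname{im}b_1$ for the ideal $p(b_1(B_1))$, and identify images in $Q_0=\bigwedge^3F$ and in $(\bigwedge^3F^*)^*$ with ideals of $R$ by $\chi_F\mapsto1$ and by evaluation at $\chi_{F^*}$. The grade of an ideal is the supremum of the lengths of the regular sequences in it (the unit ideal has grade $\infty$). An ideal $I\neq R$ is perfect of grade $g$ if $\operatorname{grade}I=g=\operatorname{pd}_R(R/I)$.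 A complete intersection of grade $g$ is an ideal generated by a regular sequence of length $g$. If $I$ is perfect of grade $g$ and $K\subseteq I$ is a complete intersection of grade $g$, then $K:I$ is obtained from $I$ by one link, with respect to $K$. **Theorem.** (1) For all data, $\mathbb B$, $\mathbb Q$ and $\mathbb K$ are complexes, $c$ is a map of complexes, and $\operatorname{Tot}(c^*)$ is isomorphic, as a complex, to the direct sum of $\mathbb Q$ and the split exact complex $0\to B_0^*\to B_0^*\oplus F\to F\to0\to0$ (inclusion of the first summand, projection onto the second). (2) Put $I=\operatorname{im}b_1$, $K=\operatorname{im}(p\circ b_1\circ c_1)$, $J=\operatorname{im}q_1$. If $I\ne R$ and $K$ is a complete intersection of grade three, then the following statement $(\ast)$ holds. The complexes $\mathbb K$, $\mathbb B$, $\mathbb Q$ are resolutions of $R/K$, $R/I$, $R/J$; the ideal $I$ is perfect of grade three and $J=K:I$ is obtained from $I$ by one link with respect to $K$; conversely $I=K:J$, and $J$ is perfect of grade three if $J\neq R$; and $\operatorname{Tot}(c^*)$ is a resolution of $R/(K:I)$. (3) The hypothesis of (2) holds for a sufficiently general $\ell$. If $\operatorname{im}b_1$ is a proper ideal of grade at least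 three, then, after the data $\phi,\psi,\zeta,z_2$ have been extended to the polynomial ring over $R$ in six new variables, and with $\ell$ the map whose $2\times3$ matrix has these variables as entries (and with any isomorphism $p$), $\operatorname{im}b_1$ is proper, $\operatorname{im}(p\circ b_1\circ c_1)$ is a complete intersection of grade three, and $(\ast)$ holds. (4) In particular it holds for $\mathbb Q$ built using variables. If $R\ne0$, and over the polynomial ring over $R$ in $17$ variables the matrices of $\phi$ and $\ell$, the three coordinates of $\psi$, the coordinate of $\zeta$, and $z_2$ are these variables (with any isomorphism $p$), then $\operatorname{im}b_1$ is proper, $\operatorname{im}(p\circ b_1\circ c_1)$ is a complete intersection of grade three, $(\ast)$ holds, and $\operatorname{im}q_1$ is proper. -/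

import Mathlib

open Module
open scoped TensorProduct

universe u v w

/-! ### Grade, perfection, complete intersections, links -/

/-- The grade of an ideal: the supremum of the lengths of the regular sequences contained in it.
A weakly regular sequence contained in a proper ideal is regular; the unit ideal has grade `⊤`. -/
noncomputable def idealGrade {R : Type u} [CommRing R] (I : Ideal R) : ℕ∞ :=
  ⨆ rs : {rs : List R // RingTheory.Sequence.IsWeaklyRegular R rs ∧ ∀ r ∈ rs, r ∈ I},
    (rs.1.length : ℕ∞)

/-- `I` is a perfect ideal of grade `g`: it is proper and `grade I = g = pd (R ⧸ I)`. -/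
def IsPerfectOfGrade {R : Type u} [CommRing R] (I : Ideal R) (g : ℕ) : Prop :=
  I ≠ ⊤ ∧ idealGrade I = g ∧
    CategoryTheory.projectiveDimension (ModuleCat.of R (R ⧸ I)) = ((g : ℕ∞) : WithBot ℕ∞)

/-- `K` is a complete intersection of grade `g`: it is generated by a regular sequence of
length `g`. -/
def IsCompleteIntersection {R : Type u} [CommRing R] (K : Ideal R) (g : ℕ) : Prop :=
  ∃ rs : List R, rs.length = g ∧ RingTheory.Sequence.IsRegular R rs ∧ Ideal.ofList rs = K

/-- `J` is obtained from the perfect ideal `I` of grade `g` by one link, with respect to the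
complete intersection `K`. -/
structure IsLink {R : Type u} [CommRing R] (g : ℕ) (K I J : Ideal R) : Prop where
  perfect : IsPerfectOfGrade I g
  completeIntersection : IsCompleteIntersection K g
  le : K ≤ I
  eq_colon : J = K.colon (I : Set R)

/-! ### Exterior powers: wedge product and contraction -/

namespace ExteriorContraction

variable {R : Type*} [CommRing R] {M N : Type*} [AddCommGroup M] [Module R M]
  [AddCommGroup N] [Module R N]

/-- A vector as an element of the first exterior power. -/
noncomputable def vec : M →ₗ[R] ⋀[R]^1 M := (exteriorPower.oneEquiv R M).symm.toLinearMap

/-- An element of the first exterior power as a vector. -/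
noncomputable def unvec : (⋀[R]^1 M) →ₗ[R] M := (exteriorPower.oneEquiv R M).toLinearMap

/-- An element of the zeroth exterior power as a scalar. -/
noncomputable def scal : (⋀[R]^0 M) →ₗ[R] R := (exteriorPower.zeroEquiv R M).toLinearMap

/-- The product of the exterior algebra on homogeneous components. -/
noncomputable def wedge {i j k : ℕ} (h : i + j = k) :
    (⋀[R]^i M) →ₗ[R] (⋀[R]^j M) →ₗ[R] (⋀[R]^k M) :=
  LinearMap.mk₂ R
    (fun x y => ⟨(x : ExteriorAlgebra R M) * (y : ExteriorAlgebra R M), by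
      subst h; exact SetLike.GradedMul.mul_mem x.2 y.2⟩)
    (fun _ _ _ => Subtype.ext (by simp [add_mul]))
    (fun _ _ _ => Subtype.ext (by simp))
    (fun _ _ _ => Subtype.ext (by simp [mul_add]))
    (fun _ _ _ => Subtype.ext (by simp))

/-- For a pairing `B` of `M` and `N`, the action of the algebra `⋀ M` on `⋀ N` for which `m : M`
acts as the antiderivation of `⋀ N` extending `B m : N → R`. -/
noncomputable def act (B : M →ₗ[R] Dual R N) :
    ExteriorAlgebra R M →ₐ[R] Module.End R (ExteriorAlgebra R N) :=
  ExteriorAlgebra.lift R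
    ⟨(CliffordAlgebra.contractLeft (Q := (0 : QuadraticForm R N))) ∘ₗ B, fun m => by
      refine LinearMap.ext fun x => ?_
      exact CliffordAlgebra.contractLeft_contractLeft (Q := (0 : QuadraticForm R N)) (B m) x⟩

theorem act_ι (B : M →ₗ[R] Dual R N) (m : M) (x : ExteriorAlgebra R N) :
    act B (ExteriorAlgebra.ι R m) x =
      CliffordAlgebra.contractLeft (Q := (0 : QuadraticForm R N)) (B m) x := by
  simp [act]

theorem contractLeft_mem (d : Dual R N) (n : ℕ) :
    ∀ x ∈ ⋀[R]^(n + 1) N,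
      CliffordAlgebra.contractLeft (Q := (0 : QuadraticForm R N)) d x ∈ ⋀[R]^n N := by
  induction n with
  | zero =>
    intro x hx
    have hx' : x ∈ LinearMap.range (ExteriorAlgebra.ι R : N →ₗ[R] ExteriorAlgebra R N) := by
      simpa [ExteriorAlgebra.exteriorPower] using hx
    obtain ⟨a, rfl⟩ := hx'
    have h := CliffordAlgebra.contractLeft_ι (Q := (0 : QuadraticForm R N)) d a
    have h2 : CliffordAlgebra.contractLeft (Q := (0 : QuadraticForm R N)) d
        (ExteriorAlgebra.ι R a) = algebraMap R (ExteriorAlgebra R N) (d a) := h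
    rw [h2]
    simp only [ExteriorAlgebra.exteriorPower, pow_zero]
    exact Submodule.algebraMap_mem _
  | succ n ih =>
    intro x hx
    have hx' : x ∈ LinearMap.range (ExteriorAlgebra.ι R : N →ₗ[R] ExteriorAlgebra R N) *
        ⋀[R]^(n + 1) N := by
      rw [ExteriorAlgebra.exteriorPower, pow_succ'] at hx
      exact hx
    refine Submodule.mul_induction_on hx' ?_ ?_
    · rintro _ ⟨a, rfl⟩ b hb
      have h : CliffordAlgebra.contractLeft (Q := (0 : QuadraticForm R N)) d
          (ExteriorAlgebra.ι R a * b) =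
            d a • b - ExteriorAlgebra.ι R a *
              CliffordAlgebra.contractLeft (Q := (0 : QuadraticForm R N)) d b :=
        CliffordAlgebra.contractLeft_ι_mul (Q := (0 : QuadraticForm R N)) d a b
      rw [h]
      refine Submodule.sub_mem _ (Submodule.smul_mem _ _ hb) ?_
      rw [ExteriorAlgebra.exteriorPower, pow_succ']
      exact Submodule.mul_mem_mul ⟨a, rfl⟩ (ih b hb)
    · intro a b ha hb
      rw [map_add]
      exact Submodule.add_mem _ ha hb

theorem act_mem (B : M →ₗ[R] Dual R N) (i : ℕ) :
    ∀ (k : ℕ), ∀ x ∈ ⋀[R]^i M, ∀ y ∈ ⋀[R]^(i + k) N, act B x y ∈ ⋀[R]^k N := by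
  induction i with
  | zero =>
    intro k x hx y hy
    have hx' : x ∈ (1 : Submodule R (ExteriorAlgebra R M)) := by
      simpa [ExteriorAlgebra.exteriorPower] using hx
    obtain ⟨r, rfl⟩ := Submodule.mem_one.mp hx'
    rw [AlgHom.commutes, Module.algebraMap_end_apply]
    rw [Nat.zero_add] at hy
    exact Submodule.smul_mem _ _ hy
  | succ i ih =>
    intro k x hx y hy
    have hx' : x ∈ LinearMap.range (ExteriorAlgebra.ι R : M →ₗ[R] ExteriorAlgebra R M) *
        ⋀[R]^i M := by
      rw [ExteriorAlgebra.exteriorPower, pow_succ'] at hx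
      exact hx
    refine Submodule.mul_induction_on hx' ?_ ?_
    · rintro _ ⟨a, rfl⟩ b hb
      rw [map_mul, Module.End.mul_apply, act_ι]
      refine contractLeft_mem _ _ _ (ih (k + 1) b hb y ?_)
      rwa [show i + (k + 1) = i + 1 + k by omega]
    · intro a b ha hb
      rw [map_add, LinearMap.add_apply]
      exact Submodule.add_mem _ ha hb

/-- The contraction `⋀ⁱ M × ⋀ʲ N → ⋀ᵏ N`, `i + k = j`, induced by a pairing of `M` and `N`. -/
noncomputable def contract (B : M →ₗ[R] Dual R N) {i j k : ℕ} (h : i + k = j) :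
    (⋀[R]^i M) →ₗ[R] (⋀[R]^j N) →ₗ[R] (⋀[R]^k N) :=
  LinearMap.mk₂ R
    (fun x y => ⟨act B (x : ExteriorAlgebra R M) (y : ExteriorAlgebra R N), by
      subst h; exact act_mem B i k x x.2 y y.2⟩)
    (fun _ _ _ => Subtype.ext (by simp))
    (fun _ _ _ => Subtype.ext (by simp))
    (fun _ _ _ => Subtype.ext (by simp))
    (fun _ _ _ => Subtype.ext (by simp))

/-- The action of `⋀ N*` on `⋀ N`: the element `α(x)` of `⋀ᵏ N`. -/
noncomputable def onVec {i j k : ℕ} (h : i + k = j) :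
    (⋀[R]^i (Dual R N)) →ₗ[R] (⋀[R]^j N) →ₗ[R] (⋀[R]^k N) :=
  contract LinearMap.id h

/-- The action of `⋀ N` on `⋀ N*`: the element `x(α)` of `⋀ᵏ N*`. -/
noncomputable def onDual {i j k : ℕ} (h : i + k = j) :
    (⋀[R]^i N) →ₗ[R] (⋀[R]^j (Dual R N)) →ₗ[R] (⋀[R]^k (Dual R N)) :=
  contract (Dual.eval R N) h

end ExteriorContraction

/-! ### Dual of a mapping cone and split exact summands -/

namespace DualCone

variable {R : Type*} [CommRing R] {K₀ K₁ K₂ K₃ B₀ B₁ B₂ B₃ : Type*}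
  [AddCommMonoid K₀] [Module R K₀] [AddCommMonoid K₁] [Module R K₁]
  [AddCommMonoid K₂] [Module R K₂] [AddCommMonoid K₃] [Module R K₃]
  [AddCommMonoid B₀] [Module R B₀] [AddCommMonoid B₁] [Module R B₁]
  [AddCommMonoid B₂] [Module R B₂] [AddCommMonoid B₃] [Module R B₃]

/-! The mapping cone of `c : K → B` is `Kₙ₋₁ ⊕ Bₙ` in degree `n`, with differential
`(k, b) ↦ (-κ k, c k + b' b)`, where `b'` is the differential of `B`. For complexes of length three
its dual is
`B₀* → K₀* ⊕ B₁* → K₁* ⊕ B₂* → K₂* ⊕ B₃* → K₃*`,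
and `t₄, t₃, t₂, t₁` below are the four maps, in this order. -/

/-- `B₀* → K₀* ⊕ B₁*` -/
noncomputable def t₄ (c₀ : K₀ →ₗ[R] B₀) (b₁ : B₁ →ₗ[R] B₀) :
    Dual R B₀ →ₗ[R] Dual R K₀ × Dual R B₁ :=
  c₀.dualMap.prod b₁.dualMap

/-- `Kᵢ* ⊕ Bᵢ₊₁* → Kᵢ₊₁* ⊕ Bᵢ₊₂*`, for `i = 0, 1`, built from `κ : Kᵢ₊₁ → Kᵢ`,
`c : Kᵢ₊₁ → Bᵢ₊₁` and `b : Bᵢ₊₂ → Bᵢ₊₁`. -/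
noncomputable def tMid (κ : K₁ →ₗ[R] K₀) (c : K₁ →ₗ[R] B₁) (b : B₂ →ₗ[R] B₁) :
    Dual R K₀ × Dual R B₁ →ₗ[R] Dual R K₁ × Dual R B₂ :=
  ((-κ.dualMap).coprod c.dualMap).prod (b.dualMap ∘ₗ LinearMap.snd R _ _)

/-- `K₂* ⊕ B₃* → K₃*` -/
noncomputable def t₁ (κ₃ : K₃ →ₗ[R] K₂) (c₃ : K₃ →ₗ[R] B₃) :
    Dual R K₂ × Dual R B₃ →ₗ[R] Dual R K₃ :=
  (-κ₃.dualMap).coprod c₃.dualMap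

end DualCone

/-- The complex `T₄ → T₃ → T₂ → T₁ → T₀` is isomorphic to the direct sum of
`0 → Q₃ → Q₂ → Q₁ → Q₀` and the split exact complex `U → U × W → W → 0 → 0`. -/
def IsSumWithSplitExact {R : Type*} [CommRing R] (U W : Type*)
    [AddCommMonoid U] [Module R U] [AddCommMonoid W] [Module R W]
    {T₀ T₁ T₂ T₃ T₄ Q₀ Q₁ Q₂ Q₃ : Type*}
    [AddCommMonoid T₀] [Module R T₀] [AddCommMonoid T₁] [Module R T₁] [AddCommMonoid T₂] [Module R T₂]
    [AddCommMonoid T₃] [Module R T₃] [AddCommMonoid T₄] [Module R T₄]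
    [AddCommMonoid Q₀] [Module R Q₀] [AddCommMonoid Q₁] [Module R Q₁] [AddCommMonoid Q₂] [Module R Q₂]
    [AddCommMonoid Q₃] [Module R Q₃]
    (t₄ : T₄ →ₗ[R] T₃) (t₃ : T₃ →ₗ[R] T₂) (t₂ : T₂ →ₗ[R] T₁) (t₁ : T₁ →ₗ[R] T₀)
    (q₃ : Q₃ →ₗ[R] Q₂) (q₂ : Q₂ →ₗ[R] Q₁) (q₁ : Q₁ →ₗ[R] Q₀) : Prop :=
  ∃ (s₄ : T₄ ≃ₗ[R] U) (s₃ : T₃ ≃ₗ[R] Q₃ × (U × W)) (s₂ : T₂ ≃ₗ[R] Q₂ × W)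
    (s₁ : T₁ ≃ₗ[R] Q₁) (s₀ : T₀ ≃ₗ[R] Q₀),
    (∀ x, s₃ (t₄ x) = (0, (s₄ x, 0))) ∧
    (∀ x, s₂ (t₃ x) = (q₃ (s₃ x).1, (s₃ x).2.2)) ∧
    (∀ x, s₁ (t₂ x) = q₂ (s₂ x).1) ∧
    (∀ x, s₀ (t₁ x) = q₁ (s₁ x))

/-! ### The data, the complexes `B` and `Q`, and the comparison map -/

/-- The data `φ, ψ, ζ, z₂, p` for free modules `F` of rank three and `G` of rank two. The bases
`e` of `F` and `β` of `G` only serve to write the canonical elements of `⋀³F ⊗ ⋀³F*`,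
`⋀²G ⊗ ⋀²G*` and `F ⊗ F*`; the maps below do not depend on them. -/
structure BrownData (R : Type u) [CommRing R] (F : Type v) (G : Type w)
    [AddCommGroup F] [Module R F] [AddCommGroup G] [Module R G] where
  e : Basis (Fin 3) R F
  β : Basis (Fin 2) R G
  φ : F →ₗ[R] G
  ψ : ⋀[R]^2 (Dual R F)
  ζ : ⋀[R]^2 G
  z₂ : R
  p : (⋀[R]^2 G) ⊗[R] (⋀[R]^3 (Dual R F)) ≃ₗ[R] R

namespace BrownData

open ExteriorContraction

variable {R : Type u} [CommRing R] {F : Type v} {G : Type w}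
  [AddCommGroup F] [Module R F] [AddCommGroup G] [Module R G] (D : BrownData R F G)

/-! Canonical elements: `χF ⊗ χF'` is the canonical element of `⋀³F ⊗ ⋀³F*` and
`χG ⊗ χG'` that of `⋀²G ⊗ ⋀²G*`. -/

noncomputable def χF : ⋀[R]^3 F := exteriorPower.ιMulti R 3 D.e

noncomputable def χF' : ⋀[R]^3 (Dual R F) :=
  exteriorPower.ιMulti R 3 ![D.e.coord 2, D.e.coord 1, D.e.coord 0]

noncomputable def χG : ⋀[R]^2 G := exteriorPower.ιMulti R 2 D.β

noncomputable def χG' : ⋀[R]^2 (Dual R G) :=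
  exteriorPower.ιMulti R 2 ![D.β.coord 1, D.β.coord 0]

/-! The modules of the complex `B`. -/

abbrev B₃ (R : Type u) [CommRing R] (F : Type v) (G : Type w)
    [AddCommGroup F] [Module R F] [AddCommGroup G] [Module R G] :=
  ((⋀[R]^2 (Dual R G)) ⊗[R] (⋀[R]^3 F)) × (⋀[R]^3 F)

abbrev B₂ (R : Type u) [CommRing R] (F : Type v) (G : Type w)
    [AddCommGroup F] [Module R F] [AddCommGroup G] [Module R G] :=
  (⋀[R]^3 F) × Dual R G × F

abbrev B₁ (R : Type u) [CommRing R] (F : Type v) (G : Type w)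
    [AddCommGroup F] [Module R F] [AddCommGroup G] [Module R G] :=
  G × Dual R F

abbrev B₀ (R : Type u) [CommRing R] (F : Type v) (G : Type w)
    [AddCommGroup F] [Module R F] [AddCommGroup G] [Module R G] :=
  (⋀[R]^2 G) ⊗[R] (⋀[R]^3 (Dual R F))

/-- The vector `ψ(f₃)` of `F`, for `f₃` in `⋀³F`. -/
noncomputable def ψOn (f₃ : ⋀[R]^3 F) : F := unvec (onVec (k := 1) (by rfl) D.ψ f₃)

/-- `φ* : G* → F*` -/
noncomputable def φ' : Dual R G →ₗ[R] Dual R F := D.φ.dualMap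

/-- The first differential of `B`. -/
noncomputable def b₁ : B₁ R F G →ₗ[R] B₀ R F G where
  toFun x :=
    (-(wedge (k := 2) (by rfl) (vec x.1) (vec (D.φ (D.ψOn D.χF))))) ⊗ₜ[R] D.χF'
    + D.z₂ • (D.χG ⊗ₜ[R] (wedge (k := 3) (by rfl) (vec x.2) (exteriorPower.map 2 D.φ' D.χG')))
    + D.ζ ⊗ₜ[R] (wedge (k := 3) (by rfl) (vec x.2) D.ψ)
  map_add' x y := by
    simp only [Prod.fst_add, Prod.snd_add, map_add, LinearMap.add_apply, neg_add,
      TensorProduct.add_tmul, TensorProduct.tmul_add]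
    module
  map_smul' r x := by
    simp only [Prod.smul_fst, Prod.smul_snd, map_smul, LinearMap.smul_apply,
      ← smul_neg, ← TensorProduct.smul_tmul', TensorProduct.tmul_smul, RingHom.id_apply]
    module

/-- The second differential of `B`. -/
noncomputable def b₂ : B₂ R F G →ₗ[R] B₁ R F G where
  toFun x :=
    (D.φ (D.ψOn x.1) + unvec (onVec (k := 1) (by rfl) (vec x.2.1) D.ζ) + D.z₂ • D.φ x.2.2,
     -D.φ' x.2.1 + unvec (onDual (k := 1) (by rfl) (vec x.2.2) D.ψ))
  map_add' x y := by
    ext1 <;>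
    simp only [ψOn, Prod.fst_add, Prod.snd_add, map_add, LinearMap.add_apply] <;>
      module
  map_smul' r x := by
    ext1 <;>
    simp only [ψOn, Prod.smul_fst, Prod.smul_snd, map_smul, LinearMap.smul_apply,
        RingHom.id_apply] <;>
      module

/-- The third differential of `B` on the summand `⋀²G* ⊗ ⋀³F`; on `γ₂ ⊗ f₃` it is
`(ζ(γ₂) f₃, -[φ(ψ(f₃))](γ₂), [(⋀²φ*)(γ₂)](f₃))`. -/
noncomputable def b₃Left : (⋀[R]^2 (Dual R G)) ⊗[R] (⋀[R]^3 F) →ₗ[R] B₂ R F G :=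
  TensorProduct.lift <| LinearMap.mk₂ R
    (fun γ₂ f₃ =>
      (scal (onDual (k := 0) (by rfl) D.ζ γ₂) • f₃,
       -unvec (onDual (k := 1) (by rfl) (vec (D.φ (D.ψOn f₃))) γ₂),
       unvec (onVec (k := 1) (by rfl) (exteriorPower.map 2 D.φ' γ₂) f₃)))
    (fun x x' y => by
      ext1 <;> [skip; ext1] <;>
      simp only [Prod.fst_add, Prod.snd_add, map_add, LinearMap.add_apply] <;>
        module)
    (fun r x y => by
      ext1 <;> [skip; ext1] <;>
      simp only [Prod.smul_fst, Prod.smul_snd, map_smul, LinearMap.smul_apply] <;>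
        module)
    (fun x y y' => by
      ext1 <;> [skip; ext1] <;>
      simp only [ψOn, Prod.fst_add, Prod.snd_add, map_add, LinearMap.add_apply] <;>
        module)
    (fun r x y => by
      ext1 <;> [skip; ext1] <;>
      simp only [ψOn, Prod.smul_fst, Prod.smul_snd, map_smul, LinearMap.smul_apply] <;>
        module)

/-- The third differential of `B` on the summand `⋀³F`. -/
noncomputable def b₃Right : (⋀[R]^3 F) →ₗ[R] B₂ R F G where
  toFun f₃ := (-(D.z₂ • f₃), 0, D.ψOn f₃)
  map_add' x y := by
    ext1 <;> [skip; ext1] <;>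
    simp only [ψOn, Prod.fst_add, Prod.snd_add, map_add] <;>
      module
  map_smul' r x := by
    ext1 <;> [skip; ext1] <;>
    simp only [ψOn, Prod.smul_fst, Prod.smul_snd, map_smul, RingHom.id_apply] <;>
      module

/-- The third differential of `B`. -/
noncomputable def b₃ : B₃ R F G →ₗ[R] B₂ R F G := D.b₃Left.coprod D.b₃Right

/-! From here on, `ℓ : F* → G`. -/

variable (ℓ : Dual R F →ₗ[R] G)

/-- `ℓ* : G* → F** = F`, so that `ℓ*(γ) = ∑ γ(ℓ(eᵢ*)) eᵢ`. -/
noncomputable def ℓ' : Dual R G →ₗ[R] F :=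
  D.e.equivFun.symm.toLinearMap ∘ₗ LinearMap.pi fun i => Dual.eval R G (ℓ (D.e.coord i))

/-- `∑ φ(Eᵢ) ∧ ℓ(Eᵢ*)` in `⋀²G`, where `∑ Eᵢ ⊗ Eᵢ*` is the canonical element of `F ⊗ F*`. -/
noncomputable def σ : ⋀[R]^2 G :=
  ∑ i, wedge (k := 2) (by rfl) (vec (D.φ (D.e i))) (vec (ℓ (D.e.coord i)))

/-! The modules of the complex `Q`. -/

abbrev Q₃ (R : Type u) [CommRing R] (G : Type w) [AddCommGroup G] [Module R G] := Dual R G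

abbrev Q₂ (R : Type u) [CommRing R] (F : Type v) (G : Type w)
    [AddCommGroup F] [Module R F] [AddCommGroup G] [Module R G] :=
  (⋀[R]^3 (Dual R F)) × G × Dual R F

abbrev Q₁ (R : Type u) [CommRing R] (F : Type v) (G : Type w)
    [AddCommGroup F] [Module R F] [AddCommGroup G] [Module R G] :=
  ((⋀[R]^2 G) ⊗[R] (⋀[R]^3 (Dual R F))) × (⋀[R]^3 (Dual R F)) × (⋀[R]^2 F)

abbrev Q₀ (R : Type u) [CommRing R] (F : Type v) [AddCommGroup F] [Module R F] := ⋀[R]^3 F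

/-- The third differential of `Q`. -/
noncomputable def q₃ : Q₃ R G →ₗ[R] Q₂ R F G where
  toFun γ₁ :=
    (wedge (k := 3) (by rfl) (vec (D.φ' γ₁)) D.ψ,
     D.φ (D.ℓ' ℓ γ₁) - unvec (onVec (k := 1) (by rfl) (vec γ₁) D.ζ),
     unvec (onDual (k := 1) (by rfl) (vec (D.ℓ' ℓ γ₁)) D.ψ) + D.z₂ • D.φ' γ₁)
  map_add' x y := by
    ext1 <;> [skip; ext1] <;>
    simp only [Prod.fst_add, Prod.snd_add, map_add, LinearMap.add_apply] <;>
      module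
  map_smul' r x := by
    ext1 <;> [skip; ext1] <;>
    simp only [Prod.smul_fst, Prod.smul_snd, map_smul, LinearMap.smul_apply, RingHom.id_apply] <;>
      module

/-- The second differential of `Q` on the summand `⋀³F*`. -/
noncomputable def q₂Left : (⋀[R]^3 (Dual R F)) →ₗ[R] Q₁ R F G where
  toFun f₃ :=
    (D.ζ ⊗ₜ[R] f₃,
     -(D.z₂ • f₃),
     -(D.p (D.χG ⊗ₜ[R] f₃) • exteriorPower.map 2 (D.ℓ' ℓ) D.χG'))
  map_add' x y := by
    ext1 <;> [skip; ext1] <;>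
    simp only [Prod.fst_add, Prod.snd_add, map_add, TensorProduct.tmul_add] <;>
      module
  map_smul' r x := by
    ext1 <;> [skip; ext1] <;>
    simp only [Prod.smul_fst, Prod.smul_snd, map_smul, TensorProduct.tmul_smul,
        RingHom.id_apply, smul_eq_mul] <;>
      module

/-- The second differential of `Q` on the summand `G`. -/
noncomputable def q₂Mid : G →ₗ[R] Q₁ R F G where
  toFun g₁ :=
    ((-(wedge (k := 2) (by rfl) (vec g₁) (vec (D.φ (D.ψOn D.χF))))) ⊗ₜ[R] D.χF',
     0,
     -(D.p (D.χG ⊗ₜ[R] D.χF') • wedge (k := 2) (by rfl)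
        (vec (D.ℓ' ℓ (unvec (onDual (k := 1) (by rfl) (vec g₁) D.χG')))) (vec (D.ψOn D.χF)))
     - (D.z₂ * D.p (D.χG ⊗ₜ[R] D.χF')) • onVec (k := 2) (by rfl)
        (vec (D.φ' (unvec (onDual (k := 1) (by rfl) (vec g₁) D.χG')))) D.χF)
  map_add' x y := by
    ext1 <;> [skip; ext1] <;>
    simp only [Prod.fst_add, Prod.snd_add, map_add, LinearMap.add_apply,
        neg_add, TensorProduct.add_tmul] <;>
      module
  map_smul' r x := by
    ext1 <;> [skip; ext1] <;>
    simp only [Prod.smul_fst, Prod.smul_snd, map_smul, LinearMap.smul_apply,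
        ← smul_neg, ← TensorProduct.smul_tmul', RingHom.id_apply] <;>
      module

/-- The second differential of `Q` on the summand `F*`. -/
noncomputable def q₂Right : Dual R F →ₗ[R] Q₁ R F G where
  toFun f₁ :=
    (D.χG ⊗ₜ[R] (wedge (k := 3) (by rfl) (vec f₁) (exteriorPower.map 2 D.φ' D.χG')),
     wedge (k := 3) (by rfl) (vec f₁) D.ψ,
     -(D.p (D.σ ℓ ⊗ₜ[R] D.χF') • onVec (k := 2) (by rfl) (vec f₁) D.χF)
     + D.p (D.χG ⊗ₜ[R] D.χF') • onVec (k := 2) (by rfl)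
        (vec (D.φ' (unvec (onDual (k := 1) (by rfl) (vec (ℓ f₁)) D.χG')))) D.χF
     - D.p (D.ζ ⊗ₜ[R] D.χF') • onVec (k := 2) (by rfl) (vec f₁) D.χF)
  map_add' x y := by
    ext1 <;> [skip; ext1] <;>
    simp only [Prod.fst_add, Prod.snd_add, map_add, LinearMap.add_apply,
        TensorProduct.tmul_add] <;>
      module
  map_smul' r x := by
    ext1 <;> [skip; ext1] <;>
    simp only [Prod.smul_fst, Prod.smul_snd, map_smul, LinearMap.smul_apply,
        TensorProduct.tmul_smul, RingHom.id_apply] <;>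
      module

/-- The second differential of `Q`. -/
noncomputable def q₂ : Q₂ R F G →ₗ[R] Q₁ R F G :=
  (D.q₂Left ℓ).coprod ((D.q₂Mid ℓ).coprod (D.q₂Right ℓ))

/-- The first differential of `Q` on the summand `⋀²G ⊗ ⋀³F*`. -/
noncomputable def q₁Left : (⋀[R]^2 G) ⊗[R] (⋀[R]^3 (Dual R F)) →ₗ[R] Q₀ R F where
  toFun t :=
    -((D.p t * D.p (exteriorPower.map 2 ℓ D.ψ ⊗ₜ[R] D.χF')) • D.χF)
    - (D.z₂ * D.p t * D.p (D.σ ℓ ⊗ₜ[R] D.χF')) • D.χF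
    - (D.z₂ * D.p t * D.p (D.ζ ⊗ₜ[R] D.χF')) • D.χF
  map_add' x y := by
    simp only [map_add]
    module
  map_smul' r x := by
    simp only [map_smul, smul_eq_mul, RingHom.id_apply]
    module

/-- The first differential of `Q` on the summand `⋀³F*`. -/
noncomputable def q₁Mid : (⋀[R]^3 (Dual R F)) →ₗ[R] Q₀ R F where
  toFun f₃ :=
    (D.p (D.χG ⊗ₜ[R] f₃) *
      D.p (exteriorPower.map 2 (D.φ ∘ₗ D.ℓ' ℓ) D.χG' ⊗ₜ[R] D.χF')) • D.χF
    - (D.p (D.ζ ⊗ₜ[R] D.χF') * D.p (D.σ ℓ ⊗ₜ[R] f₃)) • D.χF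
    - (D.p (D.ζ ⊗ₜ[R] D.χF') * D.p (D.ζ ⊗ₜ[R] f₃)) • D.χF
  map_add' x y := by
    simp only [map_add, TensorProduct.tmul_add]
    module
  map_smul' r x := by
    simp only [map_smul, TensorProduct.tmul_smul, smul_eq_mul, RingHom.id_apply]
    module

/-- The first differential of `Q` on the summand `⋀²F`. -/
noncomputable def q₁Right : (⋀[R]^2 F) →ₗ[R] Q₀ R F where
  toFun f₂ :=
    D.p (D.χG ⊗ₜ[R] D.χF') • wedge (k := 3) (by rfl) f₂
      (vec (D.ℓ' ℓ (unvec (onDual (k := 1) (by rfl) (vec (D.φ (D.ψOn D.χF))) D.χG'))))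
    - (D.p (D.χG ⊗ₜ[R] D.χF') * D.z₂) • wedge (k := 3) (by rfl) f₂
      (onVec (k := 1) (by rfl) (exteriorPower.map 2 D.φ' D.χG') D.χF)
    - (D.p (D.χG ⊗ₜ[R] D.χF') * scal (onDual (k := 0) (by rfl) D.ζ D.χG')) • wedge (k := 3) (by rfl) f₂
      (vec (D.ψOn D.χF))
  map_add' x y := by
    simp only [map_add, LinearMap.add_apply]
    module
  map_smul' r x := by
    simp only [map_smul, LinearMap.smul_apply, RingHom.id_apply]
    module

/-- The first differential of `Q`. -/
noncomputable def q₁ : Q₁ R F G →ₗ[R] Q₀ R F :=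
  (D.q₁Left ℓ).coprod ((D.q₁Mid ℓ).coprod (D.q₁Right ℓ))

/-! The Koszul complex `⋀³F* → ⋀²F* → F* → R` on `p ∘ b₁ ∘ c₁`. -/

/-- `c₀ = p⁻¹` -/
noncomputable def c₀ : R →ₗ[R] B₀ R F G := D.p.symm.toLinearMap

/-- `c₁ = (ℓ, id)` -/
noncomputable def c₁ : Dual R F →ₗ[R] B₁ R F G := ℓ.prod LinearMap.id

noncomputable def κ₁ : Dual R F →ₗ[R] R := D.p.toLinearMap ∘ₗ D.b₁ ∘ₗ c₁ ℓ

noncomputable def κ₂ : (⋀[R]^2 (Dual R F)) →ₗ[R] Dual R F :=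
  unvec ∘ₗ onVec (k := 1) (by rfl) (vec (D.κ₁ ℓ))

noncomputable def κ₃ : (⋀[R]^3 (Dual R F)) →ₗ[R] (⋀[R]^2 (Dual R F)) :=
  onVec (k := 2) (by rfl) (vec (D.κ₁ ℓ))

/-- The component `c₂ : ⋀²F* → B₂` of the comparison map. -/
noncomputable def c₂ : (⋀[R]^2 (Dual R F)) →ₗ[R] B₂ R F G where
  toFun f₂ := D.p (D.χG ⊗ₜ[R] D.χF') •
    (-(scal (onDual (k := 0) (by rfl) (exteriorPower.map 2 ℓ f₂) D.χG') • D.χF),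
     unvec (onDual (k := 1) (by rfl)
        (vec (ℓ (unvec (onDual (k := 1) (by rfl) (vec (D.ψOn D.χF)) f₂)))) D.χG')
     + D.z₂ • unvec (onDual (k := 1) (by rfl)
        (vec (D.φ (unvec (onVec (k := 1) (by rfl) f₂ D.χF)))) D.χG'),
     -(scal (onDual (k := 0) (by rfl) (D.σ ℓ) D.χG') • unvec (onVec (k := 1) (by rfl) f₂ D.χF))
     - D.ℓ' ℓ (unvec (onDual (k := 1) (by rfl)
        (vec (D.φ (unvec (onVec (k := 1) (by rfl) f₂ D.χF)))) D.χG'))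
     - scal (onDual (k := 0) (by rfl) D.ζ D.χG') • unvec (onVec (k := 1) (by rfl) f₂ D.χF))
  map_add' x y := by
    ext1 <;> [skip; ext1] <;>
    simp only [Prod.fst_add, Prod.snd_add, Prod.smul_fst, Prod.smul_snd, map_add,
        LinearMap.add_apply] <;>
      module
  map_smul' r x := by
    ext1 <;> [skip; ext1] <;>
    simp only [Prod.smul_fst, Prod.smul_snd, map_smul, LinearMap.smul_apply, RingHom.id_apply,
        smul_eq_mul] <;>
      module

/-- The component `c₃ : ⋀³F* → B₃` of the comparison map. -/
noncomputable def c₃ : (⋀[R]^3 (Dual R F)) →ₗ[R] B₃ R F G where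
  toFun f₃ :=
    ((-(D.p (exteriorPower.map 2 ℓ D.ψ ⊗ₜ[R] f₃) * D.p (D.χG ⊗ₜ[R] D.χF'))
      - D.z₂ * D.p (D.σ ℓ ⊗ₜ[R] f₃) * D.p (D.χG ⊗ₜ[R] D.χF')
      - D.z₂ * D.p (D.ζ ⊗ₜ[R] f₃) * D.p (D.χG ⊗ₜ[R] D.χF')) • (D.χG' ⊗ₜ[R] D.χF),
     (D.p (D.χG ⊗ₜ[R] D.χF') *
        D.p (exteriorPower.map 2 (D.φ ∘ₗ D.ℓ' ℓ) D.χG' ⊗ₜ[R] f₃)) • D.χF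
     - (D.p (D.ζ ⊗ₜ[R] f₃) * D.p (D.σ ℓ ⊗ₜ[R] D.χF')) • D.χF
     - (D.p (D.ζ ⊗ₜ[R] f₃) * D.p (D.ζ ⊗ₜ[R] D.χF')) • D.χF)
  map_add' x y := by
    ext1 <;>
    simp only [Prod.fst_add, Prod.snd_add, map_add, TensorProduct.tmul_add] <;>
      module
  map_smul' r x := by
    ext1 <;>
    simp only [Prod.smul_fst, Prod.smul_snd, map_smul, TensorProduct.tmul_smul,
        RingHom.id_apply, smul_eq_mul] <;>
      module

/-! The maps of the dual `Tot(c*)` of the mapping cone of `c`. -/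

noncomputable def t₄ := DualCone.t₄ D.c₀ D.b₁

noncomputable def t₃ := DualCone.tMid (D.κ₁ ℓ) (c₁ ℓ) D.b₂

noncomputable def t₂ := DualCone.tMid (D.κ₂ ℓ) (D.c₂ ℓ) D.b₃

noncomputable def t₁ := DualCone.t₁ (D.κ₃ ℓ) (D.c₃ ℓ)

/-! The three ideals. -/

/-- The ideal `im b₁`, the image of `p ∘ b₁`. -/
noncomputable def idealB : Ideal R := LinearMap.range (D.p.toLinearMap ∘ₗ D.b₁)

/-- The ideal `im (p ∘ b₁ ∘ c₁)`. -/
noncomputable def idealK : Ideal R := LinearMap.range (D.κ₁ ℓ)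

/-- The ideal `im q₁`, where `⋀³F` is identified with `R` by `χF ↦ 1`. -/
noncomputable def idealQ : Ideal R :=
  LinearMap.range (scal ∘ₗ onVec (k := 0) (by rfl) D.χF' ∘ₗ D.q₁ ℓ)

/-- The ideal of the image of the last map of `Tot(c*)`, where `(⋀³F*)*` is identified with `R`
by evaluation at the basis element `χF'` of `⋀³F*`. -/
noncomputable def idealTot : Ideal R :=
  LinearMap.range (Dual.eval R _ D.χF' ∘ₗ D.t₁ ℓ)

/-- The formal part of the linkage: `B`, `Q` and the Koszul complex are complexes, `c` is a map of
complexes with invertible component in degree zero, and `Tot(c*)` is the direct sum of `Q` and the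
split exact complex `B₀* → B₀* × F → F`. -/
structure DualConeIsQ : Prop where
  b₁_b₂ : D.b₁ ∘ₗ D.b₂ = 0
  b₂_b₃ : D.b₂ ∘ₗ D.b₃ = 0
  κ₁_κ₂ : D.κ₁ ℓ ∘ₗ D.κ₂ ℓ = 0
  κ₂_κ₃ : D.κ₂ ℓ ∘ₗ D.κ₃ ℓ = 0
  q₁_q₂ : D.q₁ ℓ ∘ₗ D.q₂ ℓ = 0
  q₂_q₃ : D.q₂ ℓ ∘ₗ D.q₃ ℓ = 0
  comm₁ : D.b₁ ∘ₗ c₁ ℓ = D.c₀ ∘ₗ D.κ₁ ℓ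
  comm₂ : D.b₂ ∘ₗ D.c₂ ℓ = c₁ ℓ ∘ₗ D.κ₂ ℓ
  comm₃ : D.b₃ ∘ₗ D.c₃ ℓ = D.c₂ ℓ ∘ₗ D.κ₃ ℓ
  sum : IsSumWithSplitExact (Dual R (B₀ R F G)) F D.t₄ (D.t₃ ℓ) (D.t₂ ℓ) (D.t₁ ℓ)
    (D.q₃ ℓ) (D.q₂ ℓ) (D.q₁ ℓ)

/-- `Q` is obtained from `B` by one link with respect to `im (p ∘ b₁ ∘ c₁)`. -/
structure ObtainedByOneLink : Prop where
  /-- the Koszul complex resolves `R ⧸ im (p ∘ b₁ ∘ c₁)` -/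
  koszul : Function.Injective (D.κ₃ ℓ) ∧ Function.Exact (D.κ₃ ℓ) (D.κ₂ ℓ) ∧
    Function.Exact (D.κ₂ ℓ) (D.κ₁ ℓ)
  /-- `B` resolves `R ⧸ im b₁` -/
  resolutionB : Function.Injective D.b₃ ∧ Function.Exact D.b₃ D.b₂ ∧ Function.Exact D.b₂ D.b₁
  /-- `im q₁` is linked to `im b₁` -/
  link : IsLink 3 (D.idealK ℓ) D.idealB (D.idealQ ℓ)
  /-- and conversely -/
  colon_idealQ : D.idealB = (D.idealK ℓ).colon (D.idealQ ℓ : Set R)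
  perfectQ : D.idealQ ℓ ≠ ⊤ → IsPerfectOfGrade (D.idealQ ℓ) 3
  /-- `Tot(c*)` resolves `R ⧸ (im (p ∘ b₁ ∘ c₁) : im b₁)` -/
  resolutionTot : Function.Injective D.t₄ ∧ Function.Exact D.t₄ (D.t₃ ℓ) ∧
    Function.Exact (D.t₃ ℓ) (D.t₂ ℓ) ∧ Function.Exact (D.t₂ ℓ) (D.t₁ ℓ) ∧
    D.idealTot ℓ = (D.idealK ℓ).colon (D.idealB : Set R)
  /-- `Q` resolves `R ⧸ im q₁` -/
  resolutionQ : Function.Injective (D.q₃ ℓ) ∧ Function.Exact (D.q₃ ℓ) (D.q₂ ℓ) ∧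
    Function.Exact (D.q₂ ℓ) (D.q₁ ℓ)

/-! ### Coordinates, and data built from variables -/

/-- The coordinates of `φ, ψ, ζ, z₂` in the bases `e` and `β`: `φ` has matrix `a`,
`ψ = s₀ e₁*∧e₂* + s₁ e₁*∧e₃* + s₂ e₂*∧e₃*` and `ζ = z₁ β₁∧β₂`. -/
structure HasCoordinates (a : Matrix (Fin 2) (Fin 3) R) (s : Fin 3 → R) (z₁ z₂ : R) : Prop where
  φ_eq : LinearMap.toMatrix D.e D.β D.φ = a
  ψ_eq : D.ψ = s 0 • exteriorPower.ιMulti R 2 ![D.e.coord 0, D.e.coord 1]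
    + s 1 • exteriorPower.ιMulti R 2 ![D.e.coord 0, D.e.coord 2]
    + s 2 • exteriorPower.ιMulti R 2 ![D.e.coord 1, D.e.coord 2]
  ζ_eq : D.ζ = z₁ • exteriorPower.ιMulti R 2 ![D.β 0, D.β 1]
  z₂_eq : D.z₂ = z₂

/-- `ℓ` has matrix `L`, that is, `ℓ(eⱼ*) = ∑ Lᵢⱼ βᵢ`. -/
def HasMatrix (L : Matrix (Fin 2) (Fin 3) R) : Prop :=
  ∀ j, ℓ (D.e.coord j) = ∑ i, L i j • D.β i

end BrownData

/-- The variables `aᵢⱼ, ℓᵢⱼ, ψᵢ, z₁, z₂` from which `Q` is built. -/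
inductive QVar where
  | a (i : Fin 2) (j : Fin 3)
  | l (i : Fin 2) (j : Fin 3)
  | s (i : Fin 3)
  | z₁
  | z₂

/-! Once bases are chosen, every map is a matrix whose entries are polynomials in the eighteen
scalars of `LinkCoef`, and the formal claims become polynomial identities. In the dual of the
mapping cone two components can be cancelled: `c₀` is an isomorphism, and `c₁ = (ℓ, id)` is a split
injection, so its dual is a split surjection with kernel a copy of `G*`. What remains is `G* → B₂* →
(⋀²F*)* ⊕ B₃* → (⋀³F*)*`, and in suitable coordinates these three maps are `q₃, q₂, q₁`
(`LinkCoef.isSumWithSplitExact`).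

Exactness comes from explicit null-homotopies. Multiplication by an element of `im b₁` is
null-homotopic on `B`, and multiplication by an element of `K = im (p ∘ b₁ ∘ c₁)` is null-homotopic
on `Q` and on the Koszul complex. The homology is therefore killed by a regular sequence of length
three in `K`, and the acyclicity lemma (`acyclicity`, used through `exact_of_homotopy`) makes all
three complexes exact. A resolution of length three of `R/I`, with a regular sequence of length
three in the proper ideal `I`, yields perfection; the bound of grade by projective dimension is a
vanishing theorem for Ext.

Linkage is the usual comparison argument. The top null-homotopy gives `I J ⊆ K`. If `r I ⊆ K`,
multiplication by `r` lifts to a chain map from `B` to the Koszul complex, and composing it with `c`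
puts `r` into `J` in the top degree. If `r J ⊆ K`, then `r` times the dual of `c` is null-homotopic,
which puts `r` into `I` in degree zero.

For general `ℓ`, the generators of `K` are, up to the unit `p`, `xⱼ = lⱼ w₂ - mⱼ w₁ + hⱼ`, with `w₁,
w₂, h₁, h₂, h₃` free of the variables `lⱼ, mⱼ`. They form a regular sequence after `w₂` is inverted
(by means of the `lⱼ`) or `w₁` is inverted (by means of the `mⱼ`), while `K + (w₁, w₂)` contains `im
b₁`, which has grade at least three. `LocalGrade` turns such local information into a regular
sequence in `K`, and three generators of an ideal of grade three can be changed into a regular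
sequence by prime avoidance. The same device, with the coordinates of `ψ` as the elements to invert,
shows that `im b₁` has grade at least three for data built from variables. -/

open scoped Pointwise
open RingTheory.Sequence

/-! ### Torsion of Koszul cohomology on three elements -/

section KoszulTorsion

variable {R : Type*} [CommRing R]

/-- The Koszul cohomology in degrees `< n` (`n ≤ 3`) of `x₁, x₂, x₃` on `M` is `t`-power torsion. -/
structure KoszulTorsion (t x₁ x₂ x₃ : R) (M : Type*) [AddCommGroup M] [Module R M] (n : ℕ) :
    Prop where
  zero : 0 < n → ∀ m : M, x₁ • m = 0 → x₂ • m = 0 → x₃ • m = 0 → ∃ N : ℕ, t ^ N • m = 0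
  one : 1 < n → ∀ m₁ m₂ m₃ : M, x₁ • m₂ = x₂ • m₁ → x₁ • m₃ = x₃ • m₁ → x₂ • m₃ = x₃ • m₂ →
    ∃ (N : ℕ) (m : M), t ^ N • m₁ = x₁ • m ∧ t ^ N • m₂ = x₂ • m ∧ t ^ N • m₃ = x₃ • m
  two : 2 < n → ∀ m₁₂ m₁₃ m₂₃ : M, x₁ • m₂₃ + x₃ • m₁₂ = x₂ • m₁₃ →
    ∃ (N : ℕ) (m₁ m₂ m₃ : M), t ^ N • m₁₂ = x₁ • m₂ - x₂ • m₁ ∧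
      t ^ N • m₁₃ = x₁ • m₃ - x₃ • m₁ ∧ t ^ N • m₂₃ = x₂ • m₃ - x₃ • m₂

namespace KoszulTorsion

variable {t x₁ x₂ x₃ : R} {M : Type*} [AddCommGroup M] [Module R M] {n : ℕ}

/-- In the long exact Koszul cohomology sequence of `f : M → M`, the cohomology of `M/fM` in degree
`i` lies between that of `M` in degrees `i` and `i + 1`. Torsion in both forces torsion in between,
at the cost of one degree. -/
theorem quotSMulTop (h : KoszulTorsion t x₁ x₂ x₃ M (n + 1)) (hn : n ≤ 2) {f : R}
    (hf : IsSMulRegular M f) : KoszulTorsion t x₁ x₂ x₃ (QuotSMulTop f M) n where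
  zero h0 := by
    intro m h₁ h₂ h₃
    obtain ⟨m, rfl⟩ := Submodule.mkQ_surjective _ m
    rw [Submodule.mkQ_apply, ← Submodule.Quotient.mk_smul, Submodule.Quotient.mk_eq_zero,
      Submodule.mem_smul_pointwise_iff_exists] at h₁ h₂ h₃
    obtain ⟨m₁, -, h₁⟩ := h₁
    obtain ⟨m₂, -, h₂⟩ := h₂
    obtain ⟨m₃, -, h₃⟩ := h₃
    -- The connecting map: `xᵢ m = f mᵢ`, and cancelling `f` shows that the `mᵢ` form a 1-cocycle.
    -- If it is up to torsion the coboundary of `m'`, then `t ^ N m - f m'` is a 0-cocycle of `M`.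
    obtain ⟨N, m', e₁, e₂, e₃⟩ := h.one (by omega) m₁ m₂ m₃
      (hf (by simp only [smul_comm f, h₁, h₂, smul_comm x₁]))
      (hf (by simp only [smul_comm f, h₁, h₃, smul_comm x₁]))
      (hf (by simp only [smul_comm f, h₂, h₃, smul_comm x₂]))
    have key : ∀ x : R, ∀ m₀ : M, f • m₀ = x • m → t ^ N • m₀ = x • m' →
        x • (t ^ N • m - f • m') = 0 := by
      intro x m₀ e e'
      rw [smul_sub, smul_comm x, ← e, smul_comm x, ← e', smul_comm f, sub_self]
    obtain ⟨N', e⟩ := h.zero (by omega) (t ^ N • m - f • m') (key _ _ h₁ e₁) (key _ _ h₂ e₂)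
      (key _ _ h₃ e₃)
    refine ⟨N' + N, ?_⟩
    rw [Submodule.mkQ_apply, ← Submodule.Quotient.mk_smul, Submodule.Quotient.mk_eq_zero,
      Submodule.mem_smul_pointwise_iff_exists]
    refine ⟨t ^ N' • m', trivial, ?_⟩
    rw [smul_sub, sub_eq_zero] at e
    rw [pow_add, mul_smul, e, smul_comm f]
  one h1 := by
    intro m₁ m₂ m₃ h₁₂ h₁₃ h₂₃
    obtain ⟨m₁, rfl⟩ := Submodule.mkQ_surjective _ m₁
    obtain ⟨m₂, rfl⟩ := Submodule.mkQ_surjective _ m₂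
    obtain ⟨m₃, rfl⟩ := Submodule.mkQ_surjective _ m₃
    simp only [Submodule.mkQ_apply, ← Submodule.Quotient.mk_smul, Submodule.Quotient.eq,
      Submodule.mem_smul_pointwise_iff_exists] at h₁₂ h₁₃ h₂₃ ⊢
    obtain ⟨n₁₂, -, h₁₂⟩ := h₁₂
    obtain ⟨n₁₃, -, h₁₃⟩ := h₁₃
    obtain ⟨n₂₃, -, h₂₃⟩ := h₂₃
    -- The same one degree higher: the quotients by `f` of the cocycle conditions form a 2-cocycle,
    -- and its primitive `p` corrects `t ^ N mᵢ` to a 1-cocycle of `M`.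
    obtain ⟨N, p₁, p₂, p₃, e₁₂, e₁₃, e₂₃⟩ := h.two (by omega) n₁₂ n₁₃ n₂₃ (hf (by
      simp only [smul_add, smul_comm f, h₁₂, h₁₃, h₂₃]
      module))
    have key : ∀ (x y : R) (m m' p p' n : M), f • n = x • m' - y • m →
        t ^ N • n = x • p' - y • p →
        x • (t ^ N • m' - f • p') = y • (t ^ N • m - f • p) := by
      intro x y m m' p p' n e e'
      have e2 : t ^ N • f • n = t ^ N • (x • m' - y • m) := by rw [e]
      rw [smul_comm, e'] at e2
      rw [← sub_eq_zero] at e2 ⊢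
      rw [← neg_eq_zero, ← e2]
      module
    obtain ⟨N', m, e₁, e₂, e₃⟩ := h.one (by omega) (t ^ N • m₁ - f • p₁) (t ^ N • m₂ - f • p₂)
      (t ^ N • m₃ - f • p₃) (key _ _ _ _ _ _ _ h₁₂ e₁₂) (key _ _ _ _ _ _ _ h₁₃ e₁₃)
      (key _ _ _ _ _ _ _ h₂₃ e₂₃)
    refine ⟨N' + N, Submodule.Quotient.mk m, ?_⟩
    simp only [← Submodule.Quotient.mk_smul, Submodule.Quotient.eq,
      Submodule.mem_smul_pointwise_iff_exists]
    refine ⟨⟨t ^ N' • p₁, trivial, ?_⟩, ⟨t ^ N' • p₂, trivial, ?_⟩, ⟨t ^ N' • p₃, trivial, ?_⟩⟩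
    · rw [← e₁, pow_add]; module
    · rw [← e₂, pow_add]; module
    · rw [← e₃, pow_add]; module
  two h2 := by omega

/-- Koszul cohomology of a weakly regular sequence, multiplied by powers of `t`. -/
theorem of_regular_up_to_torsion
    (h₁ : ∀ m : M, x₁ • m = 0 → ∃ N : ℕ, t ^ N • m = 0)
    (h₂ : ∀ m m' : M, x₂ • m = x₁ • m' → ∃ (N : ℕ) (p : M), t ^ N • m = x₁ • p)
    (h₃ : ∀ m m' m'' : M, x₃ • m = x₁ • m' + x₂ • m'' →
      ∃ (N : ℕ) (p q : M), t ^ N • m = x₁ • p + x₂ • q) :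
    KoszulTorsion t x₁ x₂ x₃ M 3 where
  zero _ m e _ _ := h₁ m e
  one _ m₁ m₂ m₃ e₁₂ e₁₃ e₂₃ := by
    obtain ⟨N, m, e⟩ := h₂ m₁ m₂ e₁₂.symm
    have key : ∀ (x : R) (m' : M), x₁ • m' = x • m₁ → x₁ • (t ^ N • m' - x • m) = 0 := by
      intro x m' e'
      rw [smul_sub, smul_comm, e', smul_comm x₁, ← e, smul_comm x, sub_self]
    obtain ⟨N₂, e₂⟩ := h₁ _ (key _ _ e₁₂)
    obtain ⟨N₃, e₃⟩ := h₁ _ (key _ _ e₁₃)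
    refine ⟨N₂ + N₃ + N, t ^ (N₂ + N₃) • m, ?_, ?_, ?_⟩
    · rw [pow_add, mul_smul, e, smul_comm]
    · rw [smul_sub, sub_eq_zero] at e₂
      rw [add_comm N₂, pow_add, pow_add, mul_smul, mul_smul, e₂]; module
    · rw [smul_sub, sub_eq_zero] at e₃
      rw [pow_add, pow_add, mul_smul, mul_smul, e₃]; module
  two _ n₁₂ n₁₃ n₂₃ e := by
    obtain ⟨N, p, q, e₁₂⟩ := h₃ n₁₂ (-n₂₃) n₁₃ (by rw [smul_neg, ← e]; abel)
    have e' : x₂ • (t ^ N • n₁₃ - x₃ • q) = x₁ • (t ^ N • n₂₃ + x₃ • p) := by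
      have : t ^ N • (x₁ • n₂₃ + x₃ • n₁₂) = t ^ N • x₂ • n₁₃ := by rw [e]
      rw [smul_add, smul_comm _ x₃, e₁₂] at this
      rw [smul_sub, smul_comm x₂, ← this]
      module
    obtain ⟨N', r, e₁₃⟩ := h₂ _ _ e'
    have e'' : x₁ • (t ^ N' • (t ^ N • n₂₃ + x₃ • p) - x₂ • r) = 0 := by
      rw [smul_sub, smul_comm x₁, ← e', smul_comm x₁, ← e₁₃, smul_comm x₂, sub_self]
    obtain ⟨N'', e₂₃⟩ := h₁ _ e''
    refine ⟨N'' + N' + N, -(t ^ (N'' + N') • q), t ^ (N'' + N') • p, t ^ N'' • r, ?_, ?_, ?_⟩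
    · rw [pow_add _ _ N, mul_smul, e₁₂]; module
    · rw [smul_sub, sub_eq_iff_eq_add] at e₁₃
      rw [pow_add, pow_add, mul_smul, mul_smul, e₁₃]; module
    · rw [smul_sub, smul_add, smul_add, sub_eq_zero, ← eq_sub_iff_add_eq] at e₂₃
      rw [pow_add, pow_add, mul_smul, mul_smul, e₂₃]; module

end KoszulTorsion

end KoszulTorsion

/-! ### Weakly regular sequences of three ring elements. -/

section WeaklyRegular

variable {R : Type*} [CommRing R] {y₁ y₂ y₃ : R}

open RingTheory.Sequence

theorem isWeaklyRegular_three_iff :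
    IsWeaklyRegular R [y₁, y₂, y₃] ↔
      (∀ m : R, y₁ * m = 0 → m = 0) ∧
      (∀ m p : R, y₂ * m = y₁ * p → ∃ p', m = y₁ * p') ∧
      (∀ m p q : R, y₃ * m = y₁ * p + y₂ * q → ∃ p' q', m = y₁ * p' + y₂ * q') := by
  have e : ∀ (I : Ideal R) (y : R), IsSMulRegular (R ⧸ (I • ⊤ : Submodule R R)) y ↔
      ∀ m, y * m ∈ I → m ∈ I := by
    intro I y
    have hI : (I • ⊤ : Submodule R R) = I := by simp
    rw [isSMulRegular_iff_right_eq_zero_of_smul]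
    constructor
    · intro h m hm
      have := h (Submodule.Quotient.mk m) (by
        rw [← Submodule.Quotient.mk_smul, Submodule.Quotient.mk_eq_zero, hI]
        exact hm)
      rw [Submodule.Quotient.mk_eq_zero, hI] at this
      exact this
    · intro h m hm
      obtain ⟨m, rfl⟩ := Submodule.mkQ_surjective _ m
      rw [Submodule.mkQ_apply, ← Submodule.Quotient.mk_smul, Submodule.Quotient.mk_eq_zero, hI]
        at hm
      rw [Submodule.mkQ_apply, Submodule.Quotient.mk_eq_zero, hI]
      exact h m hm
  rw [isWeaklyRegular_iff_Fin]
  simp only [List.length_cons, List.length_nil, Fin.forall_fin_succ, IsEmpty.forall_iff, and_true,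
    e]
  simp only [Fin.val_zero, List.take_zero, Ideal.ofList_nil, Fin.val_succ, List.take_succ_cons,
    Ideal.ofList_cons, Ideal.mem_bot, bot_le, sup_of_le_left, Ideal.mem_span_singleton, ← Ideal.span_insert]
  simp [Ideal.mem_span_pair, dvd_def, mul_comm, eq_comm]

/-- For `t = 1`, being torsion means being zero, so the exponent `0` serves throughout. -/
theorem KoszulTorsion.of_isWeaklyRegular (h : IsWeaklyRegular R [y₁, y₂, y₃]) :
    KoszulTorsion 1 y₁ y₂ y₃ R 3 := by
  obtain ⟨h₁, h₂, h₃⟩ := isWeaklyRegular_three_iff.mp h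
  refine .of_regular_up_to_torsion (fun m e => ⟨0, ?_⟩) (fun m m' e => ⟨0, ?_⟩)
    (fun m m' m'' e => ⟨0, ?_⟩)
  · simpa using h₁ m e
  · simpa using h₂ m m' e
  · simpa using h₃ m m' m'' e

theorem KoszulTorsion.pi {x₁ x₂ x₃ : R} {n : ℕ} (h : KoszulTorsion 1 x₁ x₂ x₃ R n) (ι : Type*) :
    KoszulTorsion 1 x₁ x₂ x₃ (ι → R) n where
  zero h0 m e₁ e₂ e₃ := by
    refine ⟨0, funext fun i => ?_⟩
    simpa using h.zero h0 (m i) (congrFun e₁ i) (congrFun e₂ i) (congrFun e₃ i)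
  one h1 m₁ m₂ m₃ e₁ e₂ e₃ := by
    have := fun i => h.one h1 (m₁ i) (m₂ i) (m₃ i) (congrFun e₁ i) (congrFun e₂ i) (congrFun e₃ i)
    choose N m a b c using this
    refine ⟨0, m, funext fun i => ?_, funext fun i => ?_, funext fun i => ?_⟩
    · simpa using a i
    · simpa using b i
    · simpa using c i
  two h2 m₁ m₂ m₃ e := by
    have := fun i => h.two h2 (m₁ i) (m₂ i) (m₃ i) (congrFun e i)
    choose N p q r a b c using this
    refine ⟨0, p, q, r, funext fun i => ?_, funext fun i => ?_, funext fun i => ?_⟩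
    · simpa using a i
    · simpa using b i
    · simpa using c i

end WeaklyRegular

/-! ### The acyclicity lemma in length three -/

section Acyclicity

variable {R : Type*} [CommRing R] {A₀ A₁ A₂ A₃ : Type*}
  [AddCommGroup A₀] [Module R A₀] [AddCommGroup A₁] [Module R A₁]
  [AddCommGroup A₂] [Module R A₂] [AddCommGroup A₃] [Module R A₃]
  {d₁ : A₁ →ₗ[R] A₀} {d₂ : A₂ →ₗ[R] A₁} {d₃ : A₃ →ₗ[R] A₂}

/-- A complex `A₃ → A₂ → A₁ → A₀`, on whose terms Koszul cohomology of `y₁, y₂, y₃` vanishes in low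
degrees, and whose homology is annihilated by `y₁, y₂, y₃`, is exact. -/
theorem acyclicity {y₁ y₂ y₃ : R} (hA₃ : KoszulTorsion 1 y₁ y₂ y₃ A₃ 3)
    (hA₂ : KoszulTorsion 1 y₁ y₂ y₃ A₂ 2) (hA₁ : KoszulTorsion 1 y₁ y₂ y₃ A₁ 1)
    (h₁₂ : d₁ ∘ₗ d₂ = 0) (h₂₃ : d₂ ∘ₗ d₃ = 0)
    (k₃ : ∀ y ∈ ({y₁, y₂, y₃} : Set R), ∀ z, d₃ z = 0 → y • z = 0)
    (k₂ : ∀ y ∈ ({y₁, y₂, y₃} : Set R), ∀ z, d₂ z = 0 → ∃ p, d₃ p = y • z)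
    (k₁ : ∀ y ∈ ({y₁, y₂, y₃} : Set R), ∀ z, d₁ z = 0 → ∃ p, d₂ p = y • z) :
    Function.Injective d₃ ∧ Function.Exact d₃ d₂ ∧ Function.Exact d₂ d₁ := by
  have m₁ : y₁ ∈ ({y₁, y₂, y₃} : Set R) := by simp
  have m₂ : y₂ ∈ ({y₁, y₂, y₃} : Set R) := by simp
  have m₃ : y₃ ∈ ({y₁, y₂, y₃} : Set R) := by simp
  have inj : ∀ z, d₃ z = 0 → z = 0 := by
    intro z hz
    simpa using hA₃.zero (by norm_num) z (k₃ _ m₁ z hz) (k₃ _ m₂ z hz) (k₃ _ m₃ z hz)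
  -- Write `yᵢ z = d₃ pᵢ`. As `d₃` is injective, the `pᵢ` form a Koszul 1-cocycle on `A₃`, so `pᵢ =
  -- yᵢ p`. Then every `yᵢ` kills `z - d₃ p`, which vanishes by degree zero on `A₂`.
  have ex₂ : ∀ z, d₂ z = 0 → ∃ p, d₃ p = z := by
    intro z hz
    obtain ⟨p₁, e₁⟩ := k₂ _ m₁ z hz
    obtain ⟨p₂, e₂⟩ := k₂ _ m₂ z hz
    obtain ⟨p₃, e₃⟩ := k₂ _ m₃ z hz
    have key : ∀ (a b : R) (p q : A₃), d₃ p = a • z → d₃ q = b • z → a • q = b • p := by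
      intro a b p q ea eb
      rw [← sub_eq_zero]
      refine inj _ ?_
      rw [map_sub, map_smul, map_smul, ea, eb, smul_comm, sub_self]
    obtain ⟨N, p, f₁, f₂, f₃⟩ := hA₃.one (by norm_num) p₁ p₂ p₃ (key _ _ _ _ e₁ e₂)
      (key _ _ _ _ e₁ e₃) (key _ _ _ _ e₂ e₃)
    have key' : ∀ (a : R) (q : A₃), d₃ q = a • z → (1 : R) ^ N • q = a • p →
        a • (z - d₃ p) = 0 := by
      intro a q e f
      rw [one_pow, one_smul] at f
      rw [smul_sub, ← e, ← map_smul, ← f, sub_self]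
    obtain ⟨N', f⟩ := hA₂.zero (by norm_num) (z - d₃ p) (key' _ _ e₁ f₁) (key' _ _ e₂ f₂)
      (key' _ _ e₃ f₃)
    refine ⟨p, ?_⟩
    rw [one_pow, one_smul, sub_eq_zero] at f
    exact f.symm
  -- Write `yᵢ z = d₂ pᵢ`. By exactness at `A₂`, `yᵢ pⱼ - yⱼ pᵢ = d₃ qᵢⱼ`, and the `qᵢⱼ` form a
  -- 2-cocycle on `A₃`, hence the coboundary of some `rᵢ`. Then the `pᵢ - d₃ rᵢ` form a 1-cocycle on
  -- `A₂`, so they equal `yᵢ p`, and the `yᵢ` kill `z - d₂ p`.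
  have ex₁ : ∀ z, d₁ z = 0 → ∃ p, d₂ p = z := by
    intro z hz
    obtain ⟨p₁, e₁⟩ := k₁ _ m₁ z hz
    obtain ⟨p₂, e₂⟩ := k₁ _ m₂ z hz
    obtain ⟨p₃, e₃⟩ := k₁ _ m₃ z hz
    have key : ∀ (a b : R) (p q : A₂), d₂ p = a • z → d₂ q = b • z →
        ∃ r, d₃ r = a • q - b • p := by
      intro a b p q ea eb
      refine ex₂ _ ?_
      rw [map_sub, map_smul, map_smul, ea, eb, smul_comm, sub_self]
    obtain ⟨q₁₂, f₁₂⟩ := key _ _ _ _ e₁ e₂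
    obtain ⟨q₁₃, f₁₃⟩ := key _ _ _ _ e₁ e₃
    obtain ⟨q₂₃, f₂₃⟩ := key _ _ _ _ e₂ e₃
    obtain ⟨N, r₁, r₂, r₃, g₁₂, g₁₃, g₂₃⟩ := hA₃.two (by norm_num) q₁₂ q₁₃ q₂₃ (by
      rw [← sub_eq_zero]
      refine inj _ ?_
      simp only [map_sub, map_add, map_smul, f₁₂, f₁₃, f₂₃]
      module)
    simp only [one_pow, one_smul] at g₁₂ g₁₃ g₂₃
    have key' : ∀ (a b : R) (p q : A₂) (r s t : A₃), d₃ t = a • q - b • p → t = a • s - b • r →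
        a • (q - d₃ s) = b • (p - d₃ r) := by
      intro a b p q r s t e f
      rw [f, map_sub, map_smul, map_smul] at e
      rw [← sub_eq_zero] at e ⊢
      rw [← neg_eq_zero, ← e]
      module
    obtain ⟨N', p, h₁, h₂, h₃⟩ := hA₂.one (by norm_num) (p₁ - d₃ r₁) (p₂ - d₃ r₂) (p₃ - d₃ r₃)
      (key' _ _ _ _ _ _ _ f₁₂ g₁₂) (key' _ _ _ _ _ _ _ f₁₃ g₁₃) (key' _ _ _ _ _ _ _ f₂₃ g₂₃)
    simp only [one_pow, one_smul] at h₁ h₂ h₃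
    have key'' : ∀ (a : R) (q : A₂) (r : A₃), d₂ q = a • z → q - d₃ r = a • p →
        a • (z - d₂ p) = 0 := by
      intro a q r e f
      have : d₂ (d₃ r) = 0 := LinearMap.congr_fun h₂₃ r
      rw [smul_sub, ← e, ← map_smul, ← f, map_sub, this]
      simp
    obtain ⟨N'', f⟩ := hA₁.zero (by norm_num) (z - d₂ p) (key'' _ _ _ e₁ h₁) (key'' _ _ _ e₂ h₂)
      (key'' _ _ _ e₃ h₃)
    refine ⟨p, ?_⟩
    rw [one_pow, one_smul, sub_eq_zero] at f
    exact f.symm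
  refine ⟨(injective_iff_map_eq_zero d₃).mpr inj, fun z => ⟨ex₂ z, ?_⟩, fun z => ⟨ex₁ z, ?_⟩⟩
  · rintro ⟨p, rfl⟩
    exact LinearMap.congr_fun h₂₃ p
  · rintro ⟨p, rfl⟩
    exact LinearMap.congr_fun h₁₂ p

end Acyclicity

/-! ### Avoiding primes by an element of a coset -/

section Avoidance

variable {R : Type*} [CommRing R]

/-- One prime `P` is added at a time. If the element found so far falls into `P`, it is corrected by
some `k` in `J` and in all the earlier primes but not in `P`. Such a `k` exists because `P` contains
neither `J` nor, in an antichain, any of the earlier primes. -/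
theorem exists_add_notMem_of_isAntichain (x : R) (J : Ideal R) (s : Finset (Ideal R))
    (hs : ∀ P ∈ s, P.IsPrime) (ha : IsAntichain (· ≤ ·) (s : Set (Ideal R)))
    (hJ : ∀ P ∈ s, x ∈ P → ¬ J ≤ P) : ∃ j ∈ J, ∀ P ∈ s, x + j ∉ P := by
  classical
  induction s using Finset.induction_on with
  | empty => exact ⟨0, J.zero_mem, by simp⟩
  | insert P s hP ih =>
    obtain ⟨j, hj, h⟩ := ih (fun Q hQ => hs Q (Finset.mem_insert_of_mem hQ))
      (ha.subset (by simp)) (fun Q hQ => hJ Q (Finset.mem_insert_of_mem hQ))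
    by_cases hx : x + j ∈ P
    · have hPp := hs P (Finset.mem_insert_self _ _)
      have hJP : ¬ J ≤ P := fun hle =>
        hJ P (Finset.mem_insert_self _ _) ((P.add_mem_iff_left (hle hj)).mp hx) hle
      have hle : ¬ J ⊓ s.inf id ≤ P := by
        rw [hPp.inf_le, hPp.inf_le']
        rintro (h | ⟨Q, hQ, h⟩)
        · exact hJP h
        · exact ha (by simp [hQ]) (by simp) (fun e => hP (by rwa [← e])) h
      obtain ⟨k, hk, hkP⟩ := SetLike.not_le_iff_exists.mp hle
      refine ⟨j + k, J.add_mem hj hk.1, ?_⟩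
      intro Q hQ
      rw [← add_assoc]
      rcases Finset.mem_insert.mp hQ with rfl | hQ
      · exact fun e => hkP ((Q.add_mem_iff_right hx).mp e)
      · have : k ∈ Q := (Finset.inf_le hQ : s.inf id ≤ Q) hk.2
        exact fun e => h Q hQ ((Q.add_mem_iff_left this).mp e)
    · refine ⟨j, hj, ?_⟩
      intro Q hQ
      rcases Finset.mem_insert.mp hQ with rfl | hQ
      · exact hx
      · exact h Q hQ

/-- If no prime of the finite set `s` contains `x` and `J`, some element of `x + J` avoids them
all. -/
theorem exists_add_notMem (x : R) (J : Ideal R) {s : Set (Ideal R)} (hf : s.Finite)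
    (hs : ∀ P ∈ s, P.IsPrime) (hJ : ∀ P ∈ s, x ∈ P → ¬ J ≤ P) :
    ∃ j ∈ J, ∀ P ∈ s, x + j ∉ P := by
  classical
  -- It suffices to avoid the maximal members of `s`, which form an antichain.
  have hfin : {P | Maximal (· ∈ s) P}.Finite := hf.subset fun P hP => hP.prop
  obtain ⟨j, hj, h⟩ := exists_add_notMem_of_isAntichain x J hfin.toFinset
    (fun P hP => hs P (by simpa using ((hfin.mem_toFinset.mp hP).prop)))
    (by
      rw [hfin.coe_toFinset]
      exact setOfPred_maximal_antichain _)
    (fun P hP => hJ P (by simpa using ((hfin.mem_toFinset.mp hP).prop)))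
  refine ⟨j, hj, fun P hP hx => ?_⟩
  obtain ⟨Q, hPQ, hQ⟩ := hf.exists_le_maximal hP
  exact h Q (hfin.mem_toFinset.mpr hQ) (hPQ hx)

variable [IsNoetherianRing R] (M : Type*) [AddCommGroup M] [Module R M] [Module.Finite R M]

/-- The zero divisors on `M` form the union of its associated primes, of which there are finitely
many. -/
theorem exists_add_isSMulRegular (x : R) (J : Ideal R)
    (hJ : ∀ P ∈ associatedPrimes R M, x ∈ P → ¬ J ≤ P) : ∃ j ∈ J, IsSMulRegular M (x + j) := by
  obtain ⟨j, hj, h⟩ := exists_add_notMem x J (associatedPrimes.finite R M)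
    (fun P hP => IsAssociatedPrime.isPrime hP) hJ
  refine ⟨j, hj, ?_⟩
  have := biUnion_associatedPrimes_eq_compl_regular R M
  by_contra hc
  have hc' : x + j ∈ ⋃ p ∈ associatedPrimes R M, (p : Set R) := by rw [this]; exact hc
  simp only [Set.mem_iUnion] at hc'
  obtain ⟨P, hP, hx⟩ := hc'
  exact h P hP hx

end Avoidance

/-! ### Grade -/

section Grade

variable {R : Type*} [CommRing R]

theorem exists_isWeaklyRegular_three {I : Ideal R} (h : 3 ≤ idealGrade I) :
    ∃ y₁ ∈ I, ∃ y₂ ∈ I, ∃ y₃ ∈ I, IsWeaklyRegular R [y₁, y₂, y₃] := by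
  -- A strict inequality is needed to extract one actual sequence from the supremum, which may be
  -- infinite. The first three terms of that sequence are kept.
  have : (2 : ℕ∞) < idealGrade I := lt_of_lt_of_le (by norm_num) h
  rw [idealGrade, lt_iSup_iff] at this
  obtain ⟨⟨rs, hr, hI⟩, hl⟩ := this
  have hl : 2 < rs.length := by exact_mod_cast hl
  match rs, hr, hI, hl with
  | y₁ :: y₂ :: y₃ :: l, hr, hI, _ =>
    refine ⟨y₁, hI _ (by simp), y₂, hI _ (by simp), y₃, hI _ (by simp), ?_⟩
    have : y₁ :: y₂ :: y₃ :: l = [y₁, y₂, y₃] ++ l := rfl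
    rw [this, isWeaklyRegular_append_iff] at hr
    exact hr.1

theorem IsCompleteIntersection.exists_isWeaklyRegular {K : Ideal R}
    (h : IsCompleteIntersection K 3) :
    ∃ y₁ ∈ K, ∃ y₂ ∈ K, ∃ y₃ ∈ K, IsWeaklyRegular R [y₁, y₂, y₃] := by
  obtain ⟨rs, hl, hr, rfl⟩ := h
  obtain ⟨y₁, y₂, y₃, rfl⟩ := List.length_eq_three.mp hl
  exact ⟨y₁, Ideal.subset_span (by simp), y₂, Ideal.subset_span (by simp), y₃,
    Ideal.subset_span (by simp), hr.toIsWeaklyRegular⟩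

/-- Conditions that force the grade of `I` on `M` to be at least `n ≤ 3`: Koszul cohomology
vanishes for three elements of `I + (t₁, …)`, and is `tᵢ`-torsion for some three elements of `I`
for every `i`. -/
structure LocalGrade {ι : Type*} (I : Ideal R) (t : ι → R) (x : ι → Fin 3 → R) (y : Fin 3 → R)
    (M : Type*) [AddCommGroup M] [Module R M] (n : ℕ) : Prop where
  mem : ∀ i k, x i k ∈ I
  torsion : ∀ i, KoszulTorsion (t i) (x i 0) (x i 1) (x i 2) M n
  mem_sup : ∀ k, y k ∈ I ⊔ Ideal.span (Set.range t)
  vanish : KoszulTorsion 1 (y 0) (y 1) (y 2) M n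

namespace LocalGrade

variable {ι : Type*} {I : Ideal R} {t : ι → R} {x : ι → Fin 3 → R} {y : Fin 3 → R}
  {M : Type*} [AddCommGroup M] [Module R M] {n : ℕ}

theorem quotSMulTop (h : LocalGrade I t x y M (n + 1)) (hn : n ≤ 2) {f : R}
    (hf : IsSMulRegular M f) : LocalGrade I t x y (QuotSMulTop f M) n where
  mem := h.mem
  torsion i := (h.torsion i).quotSMulTop hn hf
  mem_sup := h.mem_sup
  vanish := h.vanish.quotSMulTop hn hf

/-- Suppose that `P`, the annihilator of `m`, contains `I`. Then the `x i k` kill `m`, so a power of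
each `t i` does, and `t i ∈ P`. Hence all `y k` lie in `P` and kill `m`, so `m = 0` and `P` is the
unit ideal. -/
theorem not_le [IsNoetherianRing R] (h : LocalGrade I t x y M n) (hn : 0 < n) {P : Ideal R}
    (hP : P ∈ associatedPrimes R M) : ¬ I ≤ P := by
  intro hI
  have hPp : P.IsPrime := IsAssociatedPrime.isPrime hP
  obtain ⟨-, m, hm⟩ := isAssociatedPrime_iff.mp (AssociatedPrimes.mem_iff.mp hP)
  have hmem : ∀ r, r ∈ P ↔ r • m = 0 := by
    intro r
    rw [hm]
    simp [Submodule.mem_colon_singleton]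
  have ht : ∀ i, t i ∈ P := by
    intro i
    obtain ⟨N, e⟩ := (h.torsion i).zero hn m ((hmem _).mp (hI (h.mem i 0)))
      ((hmem _).mp (hI (h.mem i 1))) ((hmem _).mp (hI (h.mem i 2)))
    exact hPp.mem_of_pow_mem N ((hmem _).mpr e)
  have hy : ∀ k, y k ∈ P := fun k => by
    have : I ⊔ Ideal.span (Set.range t) ≤ P :=
      sup_le hI (Ideal.span_le.mpr (by rintro _ ⟨i, rfl⟩; exact ht i))
    exact this (h.mem_sup k)
  obtain ⟨N, e⟩ := h.vanish.zero hn m ((hmem _).mp (hy 0)) ((hmem _).mp (hy 1))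
    ((hmem _).mp (hy 2))
  rw [one_pow, one_smul] at e
  exact hPp.ne_top ((Ideal.eq_top_iff_one _).mpr ((hmem 1).mpr (by simp [e])))

theorem exists_isSMulRegular [IsNoetherianRing R] [Module.Finite R M]
    (h : LocalGrade I t x y M n) (hn : 0 < n) : ∃ f ∈ I, IsSMulRegular M f := by
  obtain ⟨j, hj, hf⟩ := exists_add_isSMulRegular M 0 I (fun P hP _ => h.not_le hn hP)
  exact ⟨0 + j, by simpa using hj, hf⟩

/-- Each regular element found in `I` is divided out, which uses up one Koszul degree; three degrees
pay for three elements. -/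
theorem exists_isWeaklyRegular [IsNoetherianRing R] [Module.Finite R M]
    (h : LocalGrade I t x y M 3) :
    ∃ f₁ ∈ I, ∃ f₂ ∈ I, ∃ f₃ ∈ I, IsWeaklyRegular M [f₁, f₂, f₃] := by
  obtain ⟨f₁, h₁, r₁⟩ := h.exists_isSMulRegular (by norm_num)
  have h' := h.quotSMulTop (by norm_num) r₁
  obtain ⟨f₂, h₂, r₂⟩ := h'.exists_isSMulRegular (by norm_num)
  have h'' := h'.quotSMulTop (by norm_num) r₂
  obtain ⟨f₃, h₃, r₃⟩ := h''.exists_isSMulRegular (by norm_num)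
  refine ⟨f₁, h₁, f₂, h₂, f₃, h₃, ?_⟩
  simp [r₁, r₂, r₃]

/-- With no elements `t` to invert, `LocalGrade` just records that `I` contains a weakly regular
sequence of length three. -/
theorem of_isWeaklyRegular {y₁ y₂ y₃ : R} (h₁ : y₁ ∈ I) (h₂ : y₂ ∈ I) (h₃ : y₃ ∈ I)
    (h : IsWeaklyRegular R [y₁, y₂, y₃]) :
    LocalGrade I (fun i : Empty => i.elim) (fun i => i.elim) ![y₁, y₂, y₃] R 3 where
  mem i := i.elim
  torsion i := i.elim
  mem_sup k := by
    refine Ideal.mem_sup_left ?_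
    fin_cases k <;> assumption
  vanish := .of_isWeaklyRegular h

end LocalGrade

theorem notMem_associatedPrimes_quotSMulTop {M : Type*} [AddCommGroup M] [Module R M] {f : R}
    [IsNoetherianRing R] {P : Ideal R} (hP : P ∈ associatedPrimes R (QuotSMulTop f M)) : f ∈ P := by
  obtain ⟨-, m, hm⟩ := isAssociatedPrime_iff.mp (AssociatedPrimes.mem_iff.mp hP)
  rw [hm]
  obtain ⟨m, rfl⟩ := Submodule.mkQ_surjective _ m
  simp only [Submodule.mem_colon_singleton, Submodule.mkQ_apply, ← Submodule.Quotient.mk_smul]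
  rw [Submodule.mem_bot, Submodule.Quotient.mk_eq_zero, Submodule.mem_smul_pointwise_iff_exists]
  exact ⟨m, trivial, rfl⟩

/-- A proper ideal that is generated by three elements and contains a regular sequence of length
three is generated by a regular sequence. -/
theorem isCompleteIntersection_of_span [IsNoetherianRing R] {I : Ideal R} (hI : I ≠ ⊤)
    {x₁ x₂ x₃ : R} (hx : I = Ideal.span {x₁, x₂, x₃}) {y₁ y₂ y₃ : R} (h₁ : y₁ ∈ I) (h₂ : y₂ ∈ I)
    (h₃ : y₃ ∈ I) (h : IsWeaklyRegular R [y₁, y₂, y₃]) : IsCompleteIntersection I 3 := by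
  have g := LocalGrade.of_isWeaklyRegular h₁ h₂ h₃ h
  -- An associated prime containing `x₁` and `(x₂, x₃)` would contain `I`. So `x₁` can be changed
  -- modulo the other generators into a regular element, and `I` keeps three generators.
  obtain ⟨j, hj, r₁⟩ := exists_add_isSMulRegular R x₁ (Ideal.span {x₂, x₃}) (by
    intro P hP hx₁ hle
    refine g.not_le (by norm_num) hP ?_
    rw [hx, Ideal.span_insert]
    exact sup_le ((Ideal.span_singleton_le_iff_mem _).mpr hx₁) hle)
  set f₁ := x₁ + j with hf₁
  have e₁ : I = Ideal.span {f₁, x₂, x₃} := by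
    rw [hx, Ideal.span_insert, Ideal.span_insert f₁]
    apply le_antisymm
    · refine sup_le ((Ideal.span_singleton_le_iff_mem _).mpr ?_) le_sup_right
      rw [show x₁ = f₁ - j by simp [hf₁]]
      exact Ideal.sub_mem _ (Ideal.mem_sup_left (Ideal.mem_span_singleton_self _))
        (Ideal.mem_sup_right hj)
    · refine sup_le ((Ideal.span_singleton_le_iff_mem _).mpr ?_) le_sup_right
      exact Ideal.add_mem _ (Ideal.mem_sup_left (Ideal.mem_span_singleton_self _))
        (Ideal.mem_sup_right hj)
  have g' := g.quotSMulTop (by norm_num) r₁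
  obtain ⟨k, hk, r₂⟩ := exists_add_isSMulRegular (QuotSMulTop f₁ R) x₂ (Ideal.span {x₃}) (by
    intro P hP hx₂ hle
    refine g'.not_le (by norm_num) hP ?_
    rw [e₁, Ideal.span_insert, Ideal.span_insert]
    exact sup_le ((Ideal.span_singleton_le_iff_mem _).mpr (notMem_associatedPrimes_quotSMulTop hP))
      (sup_le ((Ideal.span_singleton_le_iff_mem _).mpr hx₂) hle))
  set f₂ := x₂ + k with hf₂
  have e₂ : I = Ideal.span {f₁, f₂, x₃} := by
    rw [e₁, Ideal.span_insert, Ideal.span_insert f₁]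
    congr 1
    rw [Ideal.span_insert, Ideal.span_insert]
    apply le_antisymm
    · refine sup_le ((Ideal.span_singleton_le_iff_mem _).mpr ?_) le_sup_right
      rw [show x₂ = f₂ - k by simp [hf₂]]
      exact Ideal.sub_mem _ (Ideal.mem_sup_left (Ideal.mem_span_singleton_self _))
        (Ideal.mem_sup_right hk)
    · refine sup_le ((Ideal.span_singleton_le_iff_mem _).mpr ?_) le_sup_right
      exact Ideal.add_mem _ (Ideal.mem_sup_left (Ideal.mem_span_singleton_self _))
        (Ideal.mem_sup_right hk)
  have g'' := g'.quotSMulTop (by norm_num) r₂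
  -- Both `f₁` and `f₂` kill the iterated quotient and so lie in each of its associated primes; `f₂`
  -- is covered by the general lemma, `f₁` is treated here.
  have f₁mem : ∀ P ∈ associatedPrimes R (QuotSMulTop f₂ (QuotSMulTop f₁ R)), f₁ ∈ P := by
    intro P hP
    obtain ⟨-, m, hm⟩ := isAssociatedPrime_iff.mp (AssociatedPrimes.mem_iff.mp hP)
    rw [hm]
    obtain ⟨m, rfl⟩ := Submodule.mkQ_surjective _ m
    obtain ⟨m, rfl⟩ := Submodule.mkQ_surjective _ m
    have : f₁ • (Submodule.Quotient.mk m : QuotSMulTop f₁ R) = 0 := by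
      rw [← Submodule.Quotient.mk_smul, Submodule.Quotient.mk_eq_zero,
        Submodule.mem_smul_pointwise_iff_exists]
      exact ⟨m, trivial, rfl⟩
    simp only [Submodule.mem_colon_singleton, Submodule.mkQ_apply, Submodule.mem_bot]
    rw [← Submodule.Quotient.mk_smul, this, Submodule.Quotient.mk_zero]
  -- No generator is left to add: with the zero ideal for `J` the correction `l` is zero, so `x₃`
  -- itself is regular.
  obtain ⟨l, hl, r₃⟩ := exists_add_isSMulRegular (QuotSMulTop f₂ (QuotSMulTop f₁ R)) x₃ ⊥ (by
    intro P hP hx₃ _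
    refine g''.not_le (by norm_num) hP ?_
    rw [e₂, Ideal.span_insert, Ideal.span_insert]
    exact sup_le ((Ideal.span_singleton_le_iff_mem _).mpr (f₁mem P hP))
      (sup_le ((Ideal.span_singleton_le_iff_mem _).mpr (notMem_associatedPrimes_quotSMulTop hP))
        ((Ideal.span_singleton_le_iff_mem _).mpr hx₃)))
  obtain rfl : l = 0 := hl
  rw [add_zero] at r₃
  have e₃ : Ideal.ofList [f₁, f₂, x₃] = I := by
    rw [e₂]
    simp only [Ideal.ofList_cons, Ideal.ofList_nil, Ideal.span_insert, bot_le, sup_of_le_left]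
  refine ⟨[f₁, f₂, x₃], rfl, ⟨?_, ?_⟩, e₃⟩
  · simp [r₁, r₂, r₃]
  · rw [e₃]
    simpa using hI.symm

end Grade

/-! ### Grade and projective dimension -/

section ProjectiveDimension

open CategoryTheory Abelian

variable {R : Type u} [CommRing R]

/-- Rees' argument. The sequence `0 → M → M → M/rM → 0` and the vanishing of the preceding Ext group
of `M/rM` make multiplication by `r` injective on Ext into `M`. It is also zero there, because `r`
annihilates `N`. -/
theorem subsingleton_ext_of_isWeaklyRegular (N : ModuleCat.{u} R) (rs : List R)
    (hN : ∀ r ∈ rs, r ∈ Module.annihilator R N) :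
    ∀ (M : ModuleCat.{u} R), IsWeaklyRegular M rs → ∀ i < rs.length, Subsingleton (Ext N M i) := by
  induction rs with
  | nil => intro M _ i hi; simp at hi
  | cons r rs ih =>
    intro M hM i hi
    rw [isWeaklyRegular_cons_iff] at hM
    have inj : ∀ e : Ext N M i, e.comp (Ext.mk₀ (r • 𝟙 M)) (add_zero i) = 0 → e = 0 := by
      intro e he
      cases i with
      | zero =>
        have S := hM.1.smulShortComplex_shortExact
        have : Mono (ModuleCat.smulShortComplex M r).f := S.mono_f
        have := Ext.postcomp_mk₀_injective_of_mono N (ModuleCat.smulShortComplex M r).f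
        refine this (?_ : _ = _)
        exact he.trans (map_zero ((Ext.mk₀ (r • 𝟙 M)).postcomp N (add_zero 0))).symm
      | succ i =>
        have S := hM.1.smulShortComplex_shortExact
        obtain ⟨e', he'⟩ := Ext.covariant_sequence_exact₁ N S e he rfl
        have hsub := ih (fun r hr => hN r (List.mem_cons_of_mem _ hr)) (ModuleCat.of R (QuotSMulTop r M)) hM.2 i (by
          simpa using hi)
        have : e' = 0 := @Subsingleton.elim _ hsub _ _
        rw [← he', this]
        exact Ext.zero_comp _ _ _ _ _
    refine ⟨fun a b => ?_⟩
    have z : ∀ e : Ext N M i, e = 0 := fun e => inj e (by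
      have := Ext.postcomp_smul_id_eq_zero_of_mem_annihilator (M := M) (hN r (by simp)) i
      exact congrArg (fun f => f.hom e) this)
    rw [z a, z b]

theorem RingTheory.Sequence.IsWeaklyRegular.of_flat_module {rs : List R} (h : IsWeaklyRegular R rs)
    (M : Type*) [AddCommGroup M] [Module R M] [Module.Flat R M] : IsWeaklyRegular M rs :=
  (LinearEquiv.isWeaklyRegular_congr (TensorProduct.lid R M) rs).mp
    (IsWeaklyRegular.isWeaklyRegular_rTensor (M₂ := M) h)

/-- Dimension shifting. For `k = 0` the module is zero; for `k = 1` it is projective, hence flat,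
and `rs` is weakly regular on it. Beyond that a free cover `0 → X₁ → X₂ → M → 0` puts `Ext N M i`
between `Ext N X₂ i` and `Ext N X₁ (i + 1)`, where `X₁` has smaller projective dimension. -/
theorem subsingleton_ext_of_hasProjectiveDimensionLT (N : ModuleCat.{u} R) (rs : List R)
    (hN : ∀ r ∈ rs, r ∈ Module.annihilator R N) (hrs : IsWeaklyRegular R rs) (k : ℕ) :
    ∀ (M : ModuleCat.{u} R), HasProjectiveDimensionLT M k → ∀ i, i + k ≤ rs.length →
      Subsingleton (Ext N M i) := by
  induction k with
  | zero =>
    intro M hM i _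
    have : Limits.IsZero M := isZero_of_hasProjectiveDimensionLT_zero M
    have hz : 𝟙 M = 0 := (Limits.IsZero.iff_id_eq_zero M).mp this
    have z : ∀ e : Ext N M i, e = 0 := fun e => by
      rw [← Ext.comp_mk₀_id e, hz, Ext.mk₀_zero, Ext.comp_zero]
    exact ⟨fun a b => by rw [z a, z b]⟩
  | succ k ih =>
    intro M hM i hi
    cases k with
    | zero =>
      have hp : Projective M := projective_iff_hasProjectiveDimensionLT_one.mpr hM
      have : Module.Projective R M := (IsProjective.iff_projective M).mpr hp
      exact subsingleton_ext_of_isWeaklyRegular N rs hN M (hrs.of_flat_module M) i (by omega)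
    | succ k =>
      have S := ModuleCat.shortExact_projectiveShortComplex M
      have hX₂ : Projective M.projectiveShortComplex.X₂ :=
        ModuleCat.projective_of_free (Module.Free.chooseBasis R M.projectiveShortComplex.X₂)
      have hX₁ : HasProjectiveDimensionLT M.projectiveShortComplex.X₁ (k + 1) :=
        (S.hasProjectiveDimensionLT_X₃_iff k hX₂).mp hM
      have s₁ := ih _ hX₁ (i + 1) (by omega)
      have s₂ := subsingleton_ext_of_isWeaklyRegular N rs hN M.projectiveShortComplex.X₂
        (hrs.of_flat_module _) i (by omega)
      have z : ∀ e : Ext N M i, e = 0 := fun e => by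
        obtain ⟨e', rfl⟩ := Ext.covariant_sequence_exact₃ N S e rfl (@Subsingleton.elim _ s₁ _ _)
        rw [@Subsingleton.elim _ s₂ e' 0, Ext.zero_comp]
      exact ⟨fun a b => by rw [z a, z b]⟩

/-- The grade of a proper ideal is at most the projective dimension of the residue class ring. -/
theorem length_lt_of_hasProjectiveDimensionLT {I : Ideal R} (hI : I ≠ ⊤) {rs : List R}
    (hrs : IsWeaklyRegular R rs) (hm : ∀ r ∈ rs, r ∈ I) {n : ℕ}
    (h : HasProjectiveDimensionLT (ModuleCat.of R (R ⧸ I)) n) : rs.length < n := by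
  by_contra hc
  -- Otherwise `Hom (R/I, R/I) = Ext⁰` would vanish, and with it the identity, so that `1 ∈ I`.
  have s := subsingleton_ext_of_hasProjectiveDimensionLT (ModuleCat.of R (R ⧸ I)) rs
    (fun r hr => by
      change r ∈ Module.annihilator R (R ⧸ I)
      rw [Ideal.annihilator_quotient]
      exact hm r hr) hrs n _ h 0 (by omega)
  have e : Ext.mk₀ (𝟙 (ModuleCat.of R (R ⧸ I))) = Ext.mk₀ 0 := @Subsingleton.elim _ s _ _
  have e' : 𝟙 (ModuleCat.of R (R ⧸ I)) = 0 := (Ext.mk₀_bijective _ _).injective e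
  have := congrArg (fun f => f.hom (Ideal.Quotient.mk I 1)) e'
  exact hI ((Ideal.eq_top_iff_one I).mpr (Ideal.Quotient.eq_zero_iff_mem.mp this))

theorem hasProjectiveDimensionLT_of_exact {A B C : Type u} [AddCommGroup A] [Module R A]
    [AddCommGroup B] [Module R B] [AddCommGroup C] [Module R C] [Module.Projective R B]
    {g : A →ₗ[R] B} {f : B →ₗ[R] C} (hg : Function.Injective g) (h : Function.Exact g f)
    (hf : Function.Surjective f) {n : ℕ}
    (hA : HasProjectiveDimensionLT (ModuleCat.of R A) n) :
    HasProjectiveDimensionLT (ModuleCat.of R C) (n + 1) := by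
  let S : ShortComplex (ModuleCat.{u} R) :=
    ShortComplex.mk (ModuleCat.ofHom g) (ModuleCat.ofHom f) (by
      ext x
      exact h.apply_apply_eq_zero x)
  have hS : S.ShortExact :=
    { exact := by
        exact ModuleCat.shortComplex_exact S h
      mono_f := (ModuleCat.mono_iff_injective _).mpr hg
      epi_g := (ModuleCat.epi_iff_surjective _).mpr hf }
  have hB : Projective (ModuleCat.of R B) :=
    (IsProjective.iff_projective B).mp inferInstance
  exact hS.hasProjectiveDimensionLT_X₃ n hA
    (hasProjectiveDimensionLT_of_ge (ModuleCat.of R B) 1 (n + 1) (by omega))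

/-- An ideal that contains a regular sequence of length three and whose residue class ring has a
projective resolution of length three is perfect of grade three. -/
theorem isPerfectOfGrade_three {A₁ A₂ A₃ : Type u}
    [AddCommGroup A₁] [Module R A₁] [Module.Projective R A₁]
    [AddCommGroup A₂] [Module R A₂] [Module.Projective R A₂]
    [AddCommGroup A₃] [Module R A₃] [Module.Projective R A₃]
    {d₁ : A₁ →ₗ[R] R} {d₂ : A₂ →ₗ[R] A₁} {d₃ : A₃ →ₗ[R] A₂} (h₃ : Function.Injective d₃)
    (h₂ : Function.Exact d₃ d₂) (h₁ : Function.Exact d₂ d₁) {I : Ideal R}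
    (hI : LinearMap.range d₁ = I) (hne : I ≠ ⊤) {y₁ y₂ y₃ : R} (m₁ : y₁ ∈ I) (m₂ : y₂ ∈ I)
    (m₃ : y₃ ∈ I) (hy : IsWeaklyRegular R [y₁, y₂, y₃]) : IsPerfectOfGrade I 3 := by
  have hA₃ : HasProjectiveDimensionLT (ModuleCat.of R A₃) 1 := by
    have : Projective (ModuleCat.of R A₃) := (IsProjective.iff_projective A₃).mp inferInstance
    infer_instance
  -- The resolution is cut into short exact sequences through the images of `d₂` and `d₁`; each
  -- raises the bound by one.
  have p₂ : HasProjectiveDimensionLT (ModuleCat.of R (LinearMap.range d₂)) 2 :=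
    hasProjectiveDimensionLT_of_exact (f := d₂.rangeRestrict) h₃
      (fun x => by rw [← h₂ x, ← Subtype.coe_inj]; rfl) d₂.surjective_rangeRestrict hA₃
  have p₁ : HasProjectiveDimensionLT (ModuleCat.of R (LinearMap.range d₁)) 3 :=
    hasProjectiveDimensionLT_of_exact (g := (LinearMap.range d₂).subtype) (f := d₁.rangeRestrict)
      (Submodule.subtype_injective _)
      (fun x => by
        rw [Submodule.coe_subtype, Subtype.range_coe, ← Subtype.coe_inj]
        exact h₁ x) d₁.surjective_rangeRestrict p₂
  rw [hI] at p₁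
  have p₀ : HasProjectiveDimensionLT (ModuleCat.of R (R ⧸ I)) 4 :=
    hasProjectiveDimensionLT_of_exact (g := I.subtype) (f := I.mkQ)
      (Submodule.subtype_injective _) (LinearMap.exact_subtype_mkQ I) (Submodule.mkQ_surjective I)
      p₁
  have hmem : ∀ r ∈ [y₁, y₂, y₃], r ∈ I := by simp [m₁, m₂, m₃]
  refine ⟨hne, le_antisymm ?_ ?_, le_antisymm ?_ ?_⟩
  · refine iSup_le fun rs => ?_
    have := length_lt_of_hasProjectiveDimensionLT hne rs.2.1 rs.2.2 p₀
    exact_mod_cast Nat.lt_succ_iff.mp this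
  · exact le_iSup (fun rs : {rs : List R // IsWeaklyRegular R rs ∧ ∀ r ∈ rs, r ∈ I} =>
      (rs.1.length : ℕ∞)) ⟨[y₁, y₂, y₃], hy, hmem⟩
  · exact (projectiveDimension_le_iff _ 3).mpr p₀
  · refine (projectiveDimension_ge_iff _ 3).mpr fun h => ?_
    have := length_lt_of_hasProjectiveDimensionLT hne hy hmem h
    simp at this

end ProjectiveDimension

/-! ### Koszul cohomology of generic elements -/

namespace MvPolynomial

section

variable {σ R : Type*} [CommRing R]

/-- Membership in an ideal generated by variables is tested on monomials, and a factor `X i` with `i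
∉ s` contributes no variable from `s`. -/
theorem mem_span_X_image_of_X_mul_mem {s : Set σ} {i : σ} (hi : i ∉ s) {m : MvPolynomial σ R}
    (h : X i * m ∈ Ideal.span (X '' s : Set (MvPolynomial σ R))) :
    m ∈ Ideal.span (X '' s : Set (MvPolynomial σ R)) := by
  rw [mem_ideal_span_X_image] at h ⊢
  intro d hd
  obtain ⟨j, hj, hne⟩ := h (Finsupp.single i 1 + d) (by
    rw [support_X_mul]
    exact Finset.mem_map_of_mem _ hd)
  refine ⟨j, hj, ?_⟩
  have : i ≠ j := fun e => hi (e ▸ hj)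
  simpa [Finsupp.single_apply, this] using hne

theorem isWeaklyRegular_X :
    IsWeaklyRegular (MvPolynomial (Fin 3) R) [(X 0 : MvPolynomial (Fin 3) R), X 1, X 2] := by
  refine isWeaklyRegular_three_iff.mpr ⟨fun m h => ?_, fun m p h => ?_, fun m p q h => ?_⟩
  · have := mem_span_X_image_of_X_mul_mem (R := R) (s := (∅ : Set (Fin 3))) (i := 0) (m := m)
      (by simp) (by simp [h])
    simpa using this
  · have := mem_span_X_image_of_X_mul_mem (R := R) (s := ({0} : Set (Fin 3))) (i := 1) (m := m)
      (by simp) (by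
        rw [Set.image_singleton, Ideal.mem_span_singleton, h]
        exact dvd_mul_right _ _)
    rw [Set.image_singleton, Ideal.mem_span_singleton] at this
    exact this
  · have := mem_span_X_image_of_X_mul_mem (R := R) (s := ({0, 1} : Set (Fin 3))) (i := 2) (m := m)
      (by simp) (by
        rw [Set.image_pair, Ideal.mem_span_pair, h]
        exact ⟨p, q, by ring⟩)
    rw [Set.image_pair, Ideal.mem_span_pair] at this
    obtain ⟨a, b, e⟩ := this
    exact ⟨a, b, by rw [← e]; ring⟩

/-- The substitution `X i ↦ X i + b i` is an automorphism, with inverse `X i ↦ X i - b i`; it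
carries the variables to these elements. -/
theorem isWeaklyRegular_X_add_C (b : Fin 3 → R) :
    IsWeaklyRegular (MvPolynomial (Fin 3) R)
      [(X 0 + C (b 0) : MvPolynomial (Fin 3) R), X 1 + C (b 1), X 2 + C (b 2)] := by
  let f : MvPolynomial (Fin 3) R →ₐ[R] MvPolynomial (Fin 3) R := aeval fun i => X i + C (b i)
  let g : MvPolynomial (Fin 3) R →ₐ[R] MvPolynomial (Fin 3) R := aeval fun i => X i - C (b i)
  have hf : ∀ i, f (X i) = X i + C (b i) := fun i => aeval_X _ _
  have hg : ∀ i, g (X i) = X i - C (b i) := fun i => aeval_X _ _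
  have hfg : ∀ p, f (g p) = p := fun p => by
    have : f.comp g = AlgHom.id R _ := by
      ext i : 1
      simp only [AlgHom.comp_apply, hg, map_sub, hf, AlgHom.id_apply]
      rw [show f (C (b i)) = C (b i) from f.commutes (b i)]
      ring
    exact DFunLike.congr_fun this p
  have hgf : ∀ p, g (f p) = p := fun p => by
    have : g.comp f = AlgHom.id R _ := by
      ext i : 1
      simp only [AlgHom.comp_apply, hf, map_add, hg, AlgHom.id_apply]
      rw [show g (C (b i)) = C (b i) from g.commutes (b i)]
      ring
    exact DFunLike.congr_fun this p
  have hg' : ∀ i, g (X i + C (b i)) = X i := fun i => by rw [← hf, hgf]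
  obtain ⟨h₁, h₂, h₃⟩ := isWeaklyRegular_three_iff.mp (isWeaklyRegular_X (R := R))
  refine isWeaklyRegular_three_iff.mpr ⟨fun m h => ?_, fun m p h => ?_, fun m p q h => ?_⟩
  · have h := congrArg g h
    rw [map_mul, hg', map_zero] at h
    rw [← hfg m, h₁ _ h, map_zero]
  · have h := congrArg g h
    rw [map_mul, map_mul, hg', hg'] at h
    obtain ⟨p', e⟩ := h₂ _ _ h
    exact ⟨f p', by rw [← hf, ← map_mul, ← e, hfg]⟩
  · have h := congrArg g h
    rw [map_add, map_mul, map_mul, map_mul, hg', hg', hg'] at h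
    obtain ⟨p', q', e⟩ := h₃ _ _ _ h
    exact ⟨f p', f q', by rw [← hf, ← hf, ← map_mul, ← map_mul, ← map_add, ← e, hfg]⟩

/-- After `u` is inverted, `cᵢ + u Xᵢ = u (Xᵢ + cᵢ/u)` is a unit times a translated variable, so the
three elements become a regular sequence. Relations found over the localization hold in the original
ring after multiplication by a power of `u`. -/
theorem koszulTorsion_C_add_C_mul_X (u : R) (c : Fin 3 → R) :
    KoszulTorsion (C u : MvPolynomial (Fin 3) R) (C (c 0) + C u * X 0) (C (c 1) + C u * X 1)
      (C (c 2) + C u * X 2) (MvPolynomial (Fin 3) R) 3 := by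
  let L := Localization.Away u
  let f : MvPolynomial (Fin 3) R →+* MvPolynomial (Fin 3) L := map (algebraMap R L)
  let v : L := IsLocalization.Away.invSelf u
  have huv : algebraMap R L u * v = 1 := IsLocalization.Away.mul_invSelf u
  let b : Fin 3 → L := fun i => algebraMap R L (c i) * v
  have hfx : ∀ i, f (C (c i) + C u * X i) = C (algebraMap R L u) * (X i + C (b i)) := by
    intro i
    simp only [f, map_add, map_mul, map_C, map_X, b]
    have : (C (algebraMap R L u) : MvPolynomial (Fin 3) L) * C v = 1 := by
      rw [← C_mul, huv, C_1]
    linear_combination (-C (algebraMap R L (c i))) * this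
  have hU : (C (algebraMap R L u) : MvPolynomial (Fin 3) L) * C v = 1 := by
    rw [← C_mul, huv, C_1]
  let _ : Algebra (MvPolynomial (Fin 3) R) (MvPolynomial (Fin 3) L) := algebraMvPolynomial
  have hloc : IsLocalization.Away (C u : MvPolynomial (Fin 3) R) (MvPolynomial (Fin 3) L) := by
    have := MvPolynomial.isLocalization (σ := Fin 3) (Submonoid.powers u) L
    rwa [Submonoid.map_powers] at this
  have halg : ∀ p, algebraMap (MvPolynomial (Fin 3) R) (MvPolynomial (Fin 3) L) p = f p :=
    fun p => rfl
  have hz : ∀ p, f p = 0 → ∃ N : ℕ, (C u : MvPolynomial (Fin 3) R) ^ N * p = 0 := by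
    intro p hp
    obtain ⟨⟨_, N, rfl⟩, h⟩ := (IsLocalization.map_eq_zero_iff (Submonoid.powers (C u)) _ p).mp hp
    exact ⟨N, h⟩
  have hs : ∀ q, ∃ (N : ℕ) (p : MvPolynomial (Fin 3) R),
      C (algebraMap R L u) ^ N * q = f p := by
    intro q
    obtain ⟨⟨p, _, N, rfl⟩, h⟩ := IsLocalization.surj (Submonoid.powers (C u : MvPolynomial (Fin 3) R)) q
    refine ⟨N, p, ?_⟩
    rw [← halg, ← h, mul_comm, halg]
    simp [f]
  obtain ⟨h₁, h₂, h₃⟩ := isWeaklyRegular_three_iff.mp (isWeaklyRegular_X_add_C b)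
  have hCu : f (C u) = C (algebraMap R L u) := by simp [f]
  refine .of_regular_up_to_torsion (fun m h => ?_) (fun m m' h => ?_) (fun m m' m'' h => ?_)
  · simp only [smul_eq_mul] at h ⊢
    have h := congrArg f h
    rw [map_mul, hfx, map_zero] at h
    exact hz _ (h₁ _ (by linear_combination (C v) * h - (X 0 + C (b 0)) * f m * hU))
  · simp only [smul_eq_mul] at h ⊢
    have h := congrArg f h
    rw [map_mul, map_mul, hfx, hfx] at h
    obtain ⟨p', e⟩ := h₂ (f m) (f m') (by
      linear_combination (C v) * h - ((X 1 + C (b 1)) * f m - (X 0 + C (b 0)) * f m') * hU)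
    obtain ⟨N, p, hp⟩ := hs p'
    -- The exponent `N` clears the denominator of `p'`, one further factor `u` turns `X 0 + C (b 0)`
    -- into `C (c 0) + C u * X 0`, and `N'` accounts for the kernel of the localization map.
    obtain ⟨N', h'⟩ := hz (C u ^ (N + 1) * m - (C (c 0) + C u * X 0) * p) (by
      rw [map_sub, map_mul, map_mul, map_pow, hfx, hCu, ← hp, e]
      ring)
    exact ⟨N' + (N + 1), C u ^ N' * p, by linear_combination h'⟩
  · simp only [smul_eq_mul] at h ⊢
    have h := congrArg f h
    rw [map_add, map_mul, map_mul, map_mul, hfx, hfx, hfx] at h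
    obtain ⟨p', q', e⟩ := h₃ (f m) (f m') (f m'') (by
      linear_combination (C v) * h - ((X 2 + C (b 2)) * f m - (X 0 + C (b 0)) * f m'
        - (X 1 + C (b 1)) * f m'') * hU)
    obtain ⟨N, p, hp⟩ := hs p'
    obtain ⟨N', q, hq⟩ := hs q'
    obtain ⟨N'', h'⟩ := hz (C u ^ (N + N' + 1) * m - (C (c 0) + C u * X 0) * (C u ^ N' * p)
        - (C (c 1) + C u * X 1) * (C u ^ N * q)) (by
      simp only [map_sub, map_mul, map_pow, hCu]
      rw [hfx, hfx, ← hp, ← hq, e]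
      ring)
    exact ⟨N'' + (N + N' + 1), C u ^ N'' * (C u ^ N' * p), C u ^ N'' * (C u ^ N * q), by
      linear_combination h'⟩

end

end MvPolynomial

theorem KoszulTorsion.of_ringEquiv {S T : Type*} [CommRing S] [CommRing T] (e : S ≃+* T)
    {t x₁ x₂ x₃ : S} {n : ℕ} (h : KoszulTorsion (e t) (e x₁) (e x₂) (e x₃) T n) :
    KoszulTorsion t x₁ x₂ x₃ S n where
  zero h0 m e₁ e₂ e₃ := by
    obtain ⟨N, f⟩ := h.zero h0 (e m) (by simpa using congrArg e e₁) (by simpa using congrArg e e₂)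
      (by simpa using congrArg e e₃)
    exact ⟨N, e.injective (by simpa using f)⟩
  one h1 m₁ m₂ m₃ e₁ e₂ e₃ := by
    obtain ⟨N, m, f₁, f₂, f₃⟩ := h.one h1 (e m₁) (e m₂) (e m₃) (by simpa using congrArg e e₁)
      (by simpa using congrArg e e₂) (by simpa using congrArg e e₃)
    exact ⟨N, e.symm m, e.injective (by simpa using f₁), e.injective (by simpa using f₂),
      e.injective (by simpa using f₃)⟩
  two h2 m₁ m₂ m₃ e₁ := by
    obtain ⟨N, p, q, r, f₁, f₂, f₃⟩ := h.two h2 (e m₁) (e m₂) (e m₃)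
      (by simpa using congrArg e e₁)
    exact ⟨N, e.symm p, e.symm q, e.symm r, e.injective (by simpa using f₁),
      e.injective (by simpa using f₂), e.injective (by simpa using f₃)⟩

namespace MvPolynomial

/-- Three elements `cⱼ + u Xᵢⱼ`, where `u` and `c₀, c₁, c₂` do not involve the three variables
`Xᵢⱼ`. -/
theorem koszulTorsion_add_mul_X {σ R : Type*} [CommRing R] {i : Fin 3 → σ}
    (hi : Function.Injective i) {u : MvPolynomial σ R} {c : Fin 3 → MvPolynomial σ R}
    (hu : u ∈ supported R (Set.range i)ᶜ) (hc : ∀ j, c j ∈ supported R (Set.range i)ᶜ) :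
    KoszulTorsion u (c 0 + u * X (i 0)) (c 1 + u * X (i 1)) (c 2 + u * X (i 2))
      (MvPolynomial σ R) 3 := by
  classical
  -- The polynomial ring is regarded as one in the three variables `X (i j)` over the polynomial
  -- ring in all others, where `u` and `c` become constants.
  let τ := ((Set.range i)ᶜ : Set σ)
  let ε : Fin 3 ⊕ τ ≃ σ :=
    (Equiv.sumCongr (Equiv.ofInjective i hi) (Equiv.refl _)).trans (Equiv.Set.sumCompl _)
  have hl : ∀ j, ε (Sum.inl j) = i j := fun j => by
    simp only [ε, Equiv.trans_apply, Equiv.sumCongr_apply, Sum.map_inl]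
    rfl
  have hr : ∀ j : τ, ε (Sum.inr j) = j := fun j => by
    simp only [ε, Equiv.trans_apply, Equiv.sumCongr_apply, Sum.map_inr, Equiv.refl_apply]
    rfl
  let e : MvPolynomial σ R ≃ₐ[R] MvPolynomial (Fin 3) (MvPolynomial τ R) :=
    (renameEquiv R ε.symm).trans (sumAlgEquiv R (Fin 3) τ)
  have heX : ∀ j, e (X (i j)) = X j := by
    intro j
    have : ε.symm (i j) = Sum.inl j := by rw [← hl, Equiv.symm_apply_apply]
    simp [e, this, sumAlgEquiv_X_inl]
  have heC : ∀ p ∈ supported R τ, ∃ q, e p = C q := by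
    intro p hp
    rw [supported_eq_range_rename] at hp
    obtain ⟨q, rfl⟩ := hp
    refine ⟨q, ?_⟩
    have : (e : MvPolynomial σ R →ₐ[R] _).comp (rename (Subtype.val : τ → σ)) =
        (IsScalarTower.toAlgHom R (MvPolynomial τ R) (MvPolynomial (Fin 3) (MvPolynomial τ R))) := by
      ext j : 1
      have : ε.symm j = Sum.inr j := by rw [← hr, Equiv.symm_apply_apply]
      simp [e, this, sumAlgEquiv_X_inr, MvPolynomial.algebraMap_eq]
    exact DFunLike.congr_fun this q
  obtain ⟨u', hu'⟩ := heC u hu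
  choose c' hc' using fun j => heC (c j) (hc j)
  refine KoszulTorsion.of_ringEquiv e.toRingEquiv ?_
  have := koszulTorsion_C_add_C_mul_X u' c'
  simpa [hu', hc', heX] using this

end MvPolynomial

/-! ### The complexes in coordinates -/

/-- The matrices `(a, b)` of `φ` and `(l, m)` of `ℓ`, the coordinates of `ψ` and `ζ`, the scalar
`z₂`, and the value `p` of the isomorphism at the basis element. -/
structure LinkCoef (R : Type*) where
  (a₁ a₂ a₃ b₁ b₂ b₃ l₁ l₂ l₃ m₁ m₂ m₃ s₁ s₂ s₃ z₁ z₂ p : R)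

set_option linter.unusedSimpArgs false
set_option linter.unnecessarySeqFocus false

namespace LinkCoef

variable {R : Type*} [CommRing R] (c : LinkCoef R)

/-- The vector `(w₁, w₂)` is the negative of the coordinate vector of `φ(ψ(χF))`. -/
def w₁ : R := c.a₁ * c.s₃ - c.a₂ * c.s₂ + c.a₃ * c.s₁

def w₂ : R := c.b₁ * c.s₃ - c.b₂ * c.s₂ + c.b₃ * c.s₁

def d₁ : R := c.a₂ * c.b₃ - c.a₃ * c.b₂

def d₂ : R := c.a₃ * c.b₁ - c.a₁ * c.b₃

def d₃ : R := c.a₁ * c.b₂ - c.a₂ * c.b₁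

/-- The `hᵢ` are the coordinates of `b₁(0, eᵢ*)` with respect to `χG ⊗ χF'`. They are free of `ℓ`,
so that the `xᵢ` below have degree one in the entries of `ℓ`. -/
def h₁ : R := c.z₂ * c.d₁ - c.z₁ * c.s₃

def h₂ : R := c.z₂ * c.d₂ + c.z₁ * c.s₂

def h₃ : R := c.z₂ * c.d₃ - c.z₁ * c.s₁

/-- The `xᵢ` are the values of `κ` at `eᵢ*`, hence generators of `K`. -/
def x₁ : R := c.p * (c.l₁ * c.w₂ - c.m₁ * c.w₁ + c.h₁)

def x₂ : R := c.p * (c.l₂ * c.w₂ - c.m₂ * c.w₁ + c.h₂)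

def x₃ : R := c.p * (c.l₃ * c.w₂ - c.m₃ * c.w₁ + c.h₃)

/-- The coordinate of `σ`. -/
def sg : R := c.a₁ * c.m₁ - c.b₁ * c.l₁ + (c.a₂ * c.m₂ - c.b₂ * c.l₂) + (c.a₃ * c.m₃ - c.b₃ * c.l₃)

def n₁₂ : R := c.l₁ * c.m₂ - c.l₂ * c.m₁

def n₁₃ : R := c.l₁ * c.m₃ - c.l₃ * c.m₁

def n₂₃ : R := c.l₂ * c.m₃ - c.l₃ * c.m₂

/-- The entries `j₁, j₂` of the top component of `c` are the generators that `J` has in addition to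
those of `K`. -/
def j₁ : R :=
  -(c.p ^ 2 * (c.s₁ * c.n₁₂ + c.s₂ * c.n₁₃ + c.s₃ * c.n₂₃ + c.z₂ * c.sg + c.z₂ * c.z₁))

/-- The coordinate of `⋀²(φ ∘ ℓ*)` is the negative of this one. -/
def dt : R :=
  (c.a₁ * c.l₁ + c.a₂ * c.l₂ + c.a₃ * c.l₃) * (c.b₁ * c.m₁ + c.b₂ * c.m₂ + c.b₃ * c.m₃) -
    (c.b₁ * c.l₁ + c.b₂ * c.l₂ + c.b₃ * c.l₃) * (c.a₁ * c.m₁ + c.a₂ * c.m₂ + c.a₃ * c.m₃)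

def j₂ : R := -(c.p ^ 2 * (c.dt + c.z₁ * c.sg + c.z₁ * c.z₁))

/-- The coordinate on `B₀` is normalized at `χG ⊗ χF'`, so the value `p` of the isomorphism does not
occur here; it enters with the passage to `K₁`. -/
def B₁ : Matrix (Fin 1) (Fin 5) R := !![c.w₂, -c.w₁, c.h₁, c.h₂, c.h₃]

def B₂ : Matrix (Fin 5) (Fin 6) R :=
  !![-c.w₁, 0, -c.z₁, c.z₂ * c.a₁, c.z₂ * c.a₂, c.z₂ * c.a₃;
    -c.w₂, c.z₁, 0, c.z₂ * c.b₁, c.z₂ * c.b₂, c.z₂ * c.b₃;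
    0, -c.a₁, -c.b₁, 0, -c.s₁, -c.s₂;
    0, -c.a₂, -c.b₂, c.s₁, 0, -c.s₃;
    0, -c.a₃, -c.b₃, c.s₂, c.s₃, 0]

def B₃ : Matrix (Fin 6) (Fin 2) R :=
  !![c.z₁, -c.z₂; c.w₂, 0; -c.w₁, 0; c.d₁, -c.s₃; c.d₂, c.s₂; c.d₃, -c.s₁]

def K₁ : Matrix (Fin 1) (Fin 3) R := !![c.x₁, c.x₂, c.x₃]

def K₂ : Matrix (Fin 3) (Fin 3) R := !![-c.x₂, -c.x₃, 0; c.x₁, 0, -c.x₃; 0, c.x₁, c.x₂]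

def K₃ : Matrix (Fin 3) (Fin 1) R := !![-c.x₃; c.x₂; -c.x₁]

def C₁ : Matrix (Fin 5) (Fin 3) R :=
  !![c.l₁, c.l₂, c.l₃; c.m₁, c.m₂, c.m₃; 1, 0, 0; 0, 1, 0; 0, 0, 1]

def C₂ : Matrix (Fin 6) (Fin 3) R := c.p •
  !![-c.n₁₂, -c.n₁₃, -c.n₂₃;
    -(c.z₂ * c.b₃) - c.m₁ * c.s₂ - c.m₂ * c.s₃, c.z₂ * c.b₂ + c.m₁ * c.s₁ - c.m₃ * c.s₃,
      -(c.z₂ * c.b₁) + c.m₂ * c.s₁ + c.m₃ * c.s₂;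
    c.z₂ * c.a₃ + c.l₁ * c.s₂ + c.l₂ * c.s₃, -(c.z₂ * c.a₂) - c.l₁ * c.s₁ + c.l₃ * c.s₃,
      c.z₂ * c.a₁ - c.l₂ * c.s₁ - c.l₃ * c.s₂;
    c.b₃ * c.l₁ - c.a₃ * c.m₁, c.a₂ * c.m₁ - c.b₂ * c.l₁,
      c.a₂ * c.m₂ - c.b₂ * c.l₂ + c.a₃ * c.m₃ - c.b₃ * c.l₃ + c.z₁;
    c.b₃ * c.l₂ - c.a₃ * c.m₂, c.b₁ * c.l₁ - c.a₁ * c.m₁ + c.b₃ * c.l₃ - c.a₃ * c.m₃ - c.z₁,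
      c.b₁ * c.l₂ - c.a₁ * c.m₂;
    c.a₁ * c.m₁ - c.b₁ * c.l₁ + c.a₂ * c.m₂ - c.b₂ * c.l₂ + c.z₁, c.a₂ * c.m₃ - c.b₂ * c.l₃,
      c.b₁ * c.l₃ - c.a₁ * c.m₃]

def C₃ : Matrix (Fin 2) (Fin 1) R := !![c.j₁; c.j₂]

def Q₁ : Matrix (Fin 1) (Fin 5) R := !![c.j₁, c.j₂, -c.x₃, c.x₂, -c.x₁]

/-- The last three rows of the middle map of `Q` are those of `-C₂ᵀ`. -/
def Q₂ : Matrix (Fin 5) (Fin 6) R :=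
  !![c.z₁, c.w₂, -c.w₁, c.d₁, c.d₂, c.d₃;
    -c.z₂, 0, 0, -c.s₃, c.s₂, -c.s₁;
    -c.C₂ 0 0, -c.C₂ 1 0, -c.C₂ 2 0, -c.C₂ 3 0, -c.C₂ 4 0, -c.C₂ 5 0;
    -c.C₂ 0 1, -c.C₂ 1 1, -c.C₂ 2 1, -c.C₂ 3 1, -c.C₂ 4 1, -c.C₂ 5 1;
    -c.C₂ 0 2, -c.C₂ 1 2, -c.C₂ 2 2, -c.C₂ 3 2, -c.C₂ 4 2, -c.C₂ 5 2]

def Q₃ : Matrix (Fin 6) (Fin 2) R :=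
  !![-c.w₁, -c.w₂;
    c.a₁ * c.l₁ + c.a₂ * c.l₂ + c.a₃ * c.l₃, c.a₁ * c.m₁ + c.a₂ * c.m₂ + c.a₃ * c.m₃ + c.z₁;
    c.b₁ * c.l₁ + c.b₂ * c.l₂ + c.b₃ * c.l₃ - c.z₁, c.b₁ * c.m₁ + c.b₂ * c.m₂ + c.b₃ * c.m₃;
    c.z₂ * c.a₁ - c.l₂ * c.s₁ - c.l₃ * c.s₂, c.z₂ * c.b₁ - c.m₂ * c.s₁ - c.m₃ * c.s₂;
    c.z₂ * c.a₂ + c.l₁ * c.s₁ - c.l₃ * c.s₃, c.z₂ * c.b₂ + c.m₁ * c.s₁ - c.m₃ * c.s₃;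
    c.z₂ * c.a₃ + c.l₁ * c.s₂ + c.l₂ * c.s₃, c.z₂ * c.b₃ + c.m₁ * c.s₂ + c.m₂ * c.s₃]

/-! Homotopies: the products with an element of degree one. -/

def hB₁ (g : Fin 5 → R) : Matrix (Fin 6) (Fin 5) R :=
  !![g 1, -g 0, 0, 0, 0;
    0, -(g 2 * c.s₃) + g 3 * c.s₂ - (g 4 * c.s₁), g 1 * c.s₃ + g 3 * (c.b₃ * c.z₂) - (g 4 * (c.b₂
      * c.z₂)), -(g 1 * c.s₂) - (g 2 * (c.b₃ * c.z₂)) + g 4 * (c.b₁ * c.z₂), g 1 * c.s₁ + g 2 *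
      (c.b₂ * c.z₂) - (g 3 * (c.b₁ * c.z₂));
    g 2 * c.s₃ - (g 3 * c.s₂) + g 4 * c.s₁, 0, -(g 0 * c.s₃) - (g 3 * (c.a₃ * c.z₂)) + g 4 *
      (c.a₂ * c.z₂), g 0 * c.s₂ + g 2 * (c.a₃ * c.z₂) - (g 4 * (c.a₁ * c.z₂)), -(g 0 * c.s₁) - (g
      2 * (c.a₂ * c.z₂)) + g 3 * (c.a₁ * c.z₂);
    -(g 3 * c.b₃) + g 4 * c.b₂, g 3 * c.a₃ - (g 4 * c.a₂), 0, g 0 * c.b₃ - (g 1 * c.a₃) - (g 4 *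
      c.z₁), -(g 0 * c.b₂) + g 1 * c.a₂ + g 3 * c.z₁;
    g 2 * c.b₃ - (g 4 * c.b₁), -(g 2 * c.a₃) + g 4 * c.a₁, -(g 0 * c.b₃) + g 1 * c.a₃ + g 4 *
      c.z₁, 0, g 0 * c.b₁ - (g 1 * c.a₁) - (g 2 * c.z₁);
    -(g 2 * c.b₂) + g 3 * c.b₁, g 2 * c.a₂ - (g 3 * c.a₁), g 0 * c.b₂ - (g 1 * c.a₂) - (g 3 *
      c.z₁), -(g 0 * c.b₁) + g 1 * c.a₁ + g 2 * c.z₁, 0]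

def hB₂ (g : Fin 5 → R) : Matrix (Fin 2) (Fin 6) R :=
  !![-(g 2 * c.s₃) + g 3 * c.s₂ - (g 4 * c.s₁), g 0, g 1, g 2 * c.z₂, g 3 * c.z₂, g 4 * c.z₂;
    g 2 * (-c.a₂ * c.b₃ + c.a₃ * c.b₂) + g 3 * (c.a₁ * c.b₃ - c.a₃ * c.b₁) + g 4 * (-c.a₁ * c.b₂
      + c.a₂ * c.b₁), 0, 0, -(g 0 * c.b₁) + g 1 * c.a₁ + g 2 * c.z₁, -(g 0 * c.b₂) + g 1 * c.a₂ +
      g 3 * c.z₁, -(g 0 * c.b₃) + g 1 * c.a₃ + g 4 * c.z₁]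

/-- Only products with elements of the summand `⋀²F` of the degree one module are needed: their
images under the first map already fill `K`. -/
def hQ₁ (f : Fin 3 → R) : Matrix (Fin 6) (Fin 5) R :=
  !![(c.p * f 0 * c.s₁) + (c.p * f 1 * c.s₂) + (c.p * f 2 * c.s₃), (c.p * f 0 * (c.a₁ * c.b₂ -
      c.a₂ * c.b₁)) + (c.p * f 1 * (c.a₁ * c.b₃ - c.a₃ * c.b₁)) + (c.p * f 2 * (c.a₂ * c.b₃ -
      c.a₃ * c.b₂)), 0, 0, 0;
    -(c.p * (f 0 * c.l₃)) + (c.p * f 1 * c.l₂) - (c.p * (f 2 * c.l₁)), 0, -(f 1 * c.a₁) - (f 2 *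
      c.a₂), f 0 * c.a₁ - (f 2 * c.a₃), f 0 * c.a₂ + f 1 * c.a₃;
    -(c.p * (f 0 * c.m₃)) + (c.p * f 1 * c.m₂) - (c.p * (f 2 * c.m₁)), 0, -(f 1 * c.b₁) - (f 2 *
      c.b₂), f 0 * c.b₁ - (f 2 * c.b₃), f 0 * c.b₂ + f 1 * c.b₃;
    -(c.p * (f 2 * c.z₂)), (c.p * f 0 * (-c.a₁ * c.m₃ + c.b₁ * c.l₃)) + (c.p * f 1 * (c.a₁ * c.m₂
      - c.b₁ * c.l₂)) + (c.p * f 2 * (-c.a₁ * c.m₁ + c.b₁ * c.l₁ - c.z₁)), f 2 * c.s₁, f 2 *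
      c.s₂, -(f 0 * c.s₁) - (f 1 * c.s₂);
    (c.p * f 1 * c.z₂), (c.p * f 0 * (-c.a₂ * c.m₃ + c.b₂ * c.l₃)) + (c.p * f 1 * (c.a₂ * c.m₂ -
      c.b₂ * c.l₂ + c.z₁)) + (c.p * f 2 * (-c.a₂ * c.m₁ + c.b₂ * c.l₁)), -(f 1 * c.s₁), f 0 *
      c.s₁ + f 2 * c.s₃, -(f 1 * c.s₃);
    -(c.p * (f 0 * c.z₂)), (c.p * f 0 * (-c.a₃ * c.m₃ + c.b₃ * c.l₃ - c.z₁)) + (c.p * f 1 * (c.a₃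
      * c.m₂ - c.b₃ * c.l₂)) + (c.p * f 2 * (-c.a₃ * c.m₁ + c.b₃ * c.l₁)), -(f 1 * c.s₂) - (f 2 *
      c.s₃), f 0 * c.s₂, f 0 * c.s₃]

def hQ₂ (f : Fin 3 → R) : Matrix (Fin 2) (Fin 6) R :=
  c.p • !![-(f 0 * c.m₃) + f 1 * c.m₂ - (f 2 * c.m₁), 0, -(f 0 * c.s₁) - (f 1 * c.s₂) - (f 2 *
      c.s₃), -(f 0 * c.b₂) - (f 1 * c.b₃), f 0 * c.b₁ - (f 2 * c.b₃), f 1 * c.b₁ + f 2 * c.b₂;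
    f 0 * c.l₃ - (f 1 * c.l₂) + f 2 * c.l₁, f 0 * c.s₁ + f 1 * c.s₂ + f 2 * c.s₃, 0, f 0 * c.a₂ +
      f 1 * c.a₃, -(f 0 * c.a₁) + f 2 * c.a₃, -(f 1 * c.a₁) - (f 2 * c.a₂)]

def hK₁ (f : Fin 3 → R) : Matrix (Fin 3) (Fin 3) R :=
  !![-f 1, f 0, 0; -f 2, 0, f 0; 0, -f 2, f 1]

def hK₂ (f : Fin 3 → R) : Matrix (Fin 1) (Fin 3) R := !![-f 2, f 1, -f 0]

/-! ### Polynomial identities: complexes, comparison map, null-homotopies. -/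

theorem B₁_mul_B₂ : c.B₁ * c.B₂ = 0 := by
  ext i j
  fin_cases i <;> fin_cases j <;>
    simp only [Matrix.mul_apply, Matrix.of_apply, Matrix.cons_val, Matrix.zero_apply,
      Fin.reduceFinMk, Fin.zero_eta, Fin.mk_one, Fin.isValue, Fin.sum_univ_five] <;>
    simp only [B₁, B₂, Matrix.mul_apply, Matrix.of_apply, Matrix.cons_val, Matrix.zero_apply,
      Fin.reduceFinMk, Fin.zero_eta, Fin.mk_one, Fin.isValue, w₁, w₂, d₁, d₂, d₃, h₁, h₂, h₃] <;>
    ring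

theorem B₂_mul_B₃ : c.B₂ * c.B₃ = 0 := by
  ext i j
  fin_cases i <;> fin_cases j <;>
    simp only [Matrix.mul_apply, Matrix.of_apply, Matrix.cons_val, Matrix.zero_apply,
      Fin.reduceFinMk, Fin.zero_eta, Fin.mk_one, Fin.isValue, Fin.sum_univ_six] <;>
    simp only [B₂, B₃, Matrix.mul_apply, Matrix.of_apply, Matrix.cons_val, Matrix.zero_apply,
      Fin.reduceFinMk, Fin.zero_eta, Fin.mk_one, Fin.isValue, w₁, w₂, d₁, d₂, d₃, h₁, h₂, h₃] <;>
    ring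

theorem K₁_mul_K₂ : c.K₁ * c.K₂ = 0 := by
  ext i j
  fin_cases i <;> fin_cases j <;>
    simp only [Matrix.mul_apply, Matrix.of_apply, Matrix.cons_val, Matrix.zero_apply,
      Fin.reduceFinMk, Fin.zero_eta, Fin.mk_one, Fin.isValue, Fin.sum_univ_three] <;>
    simp only [K₁, K₂, Matrix.mul_apply, Matrix.of_apply, Matrix.cons_val, Matrix.zero_apply,
      Fin.reduceFinMk, Fin.zero_eta, Fin.mk_one, Fin.isValue] <;>
    ring

theorem K₂_mul_K₃ : c.K₂ * c.K₃ = 0 := by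
  ext i j
  fin_cases i <;> fin_cases j <;>
    simp only [Matrix.mul_apply, Matrix.of_apply, Matrix.cons_val, Matrix.zero_apply,
      Fin.reduceFinMk, Fin.zero_eta, Fin.mk_one, Fin.isValue, Fin.sum_univ_three] <;>
    simp only [K₂, K₃, Matrix.mul_apply, Matrix.of_apply, Matrix.cons_val, Matrix.zero_apply,
      Fin.reduceFinMk, Fin.zero_eta, Fin.mk_one, Fin.isValue] <;>
    ring

theorem Q₁_mul_Q₂ : c.Q₁ * c.Q₂ = 0 := by
  ext i j
  fin_cases i <;> fin_cases j <;>
    simp only [Matrix.mul_apply, Matrix.of_apply, Matrix.cons_val, Matrix.smul_apply,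
      smul_eq_mul, Matrix.zero_apply, Fin.reduceFinMk, Fin.zero_eta, Fin.mk_one, Fin.isValue,
      Fin.sum_univ_five] <;>
    simp only [Q₁, Q₂, C₂, Matrix.mul_apply, Matrix.of_apply, Matrix.cons_val, Matrix.smul_apply,
      smul_eq_mul, Matrix.zero_apply, Fin.reduceFinMk, Fin.zero_eta, Fin.mk_one, Fin.isValue, w₁,
      w₂, d₁, d₂, d₃, h₁, h₂, h₃, x₁, x₂, x₃, sg, n₁₂, n₁₃, n₂₃, j₁, j₂, dt] <;>
    ring

theorem Q₂_mul_Q₃ : c.Q₂ * c.Q₃ = 0 := by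
  ext i j
  fin_cases i <;> fin_cases j <;>
    simp only [Matrix.mul_apply, Matrix.of_apply, Matrix.cons_val, Matrix.smul_apply,
      smul_eq_mul, Matrix.zero_apply, Fin.reduceFinMk, Fin.zero_eta, Fin.mk_one, Fin.isValue,
      Fin.sum_univ_six] <;>
    simp only [Q₂, Q₃, C₂, Matrix.mul_apply, Matrix.of_apply, Matrix.cons_val, Matrix.smul_apply,
      smul_eq_mul, Matrix.zero_apply, Fin.reduceFinMk, Fin.zero_eta, Fin.mk_one, Fin.isValue, w₁,
      w₂, d₁, d₂, d₃, h₁, h₂, h₃, x₁, x₂, x₃, sg, n₁₂, n₁₃, n₂₃, j₁, j₂, dt] <;>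
    ring

theorem B₁_mul_C₁ : c.p • (c.B₁ * c.C₁) = c.K₁ := by
  ext i j
  fin_cases i <;> fin_cases j <;>
    simp only [Matrix.mul_apply, Matrix.of_apply, Matrix.cons_val, Matrix.smul_apply,
      smul_eq_mul, Fin.reduceFinMk, Fin.zero_eta, Fin.mk_one, Fin.isValue, Fin.sum_univ_five] <;>
    simp only [B₁, C₁, K₁, Matrix.mul_apply, Matrix.of_apply, Matrix.cons_val, Matrix.smul_apply,
      smul_eq_mul, Fin.reduceFinMk, Fin.zero_eta, Fin.mk_one, Fin.isValue, w₁, w₂, d₁, d₂, d₃,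
      h₁, h₂, h₃, x₁, x₂, x₃, sg, n₁₂, n₁₃, n₂₃, j₁, j₂, dt] <;>
    ring

theorem B₂_mul_C₂ : c.B₂ * c.C₂ = c.C₁ * c.K₂ := by
  ext i j
  fin_cases i <;> fin_cases j <;>
    simp only [Matrix.mul_apply, Matrix.of_apply, Matrix.cons_val, Matrix.smul_apply,
      smul_eq_mul, Fin.reduceFinMk, Fin.zero_eta, Fin.mk_one, Fin.isValue, Fin.sum_univ_six,
      Fin.sum_univ_three] <;>
    simp only [B₂, C₂, C₁, K₂, Matrix.mul_apply, Matrix.of_apply, Matrix.cons_val,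
      Matrix.smul_apply, smul_eq_mul, Fin.reduceFinMk, Fin.zero_eta, Fin.mk_one, Fin.isValue, w₁,
      w₂, d₁, d₂, d₃, h₁, h₂, h₃, x₁, x₂, x₃, sg, n₁₂, n₁₃, n₂₃, j₁, j₂, dt] <;>
    ring

theorem B₃_mul_C₃ : c.B₃ * c.C₃ = c.C₂ * c.K₃ := by
  ext i j
  fin_cases i <;> fin_cases j <;>
    simp only [Matrix.mul_apply, Matrix.of_apply, Matrix.cons_val, Matrix.smul_apply,
      smul_eq_mul, Fin.reduceFinMk, Fin.zero_eta, Fin.mk_one, Fin.isValue, Fin.sum_univ_two,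
      Fin.sum_univ_three] <;>
    simp only [B₃, C₃, C₂, K₃, Matrix.mul_apply, Matrix.of_apply, Matrix.cons_val,
      Matrix.smul_apply, smul_eq_mul, Fin.reduceFinMk, Fin.zero_eta, Fin.mk_one, Fin.isValue, w₁,
      w₂, d₁, d₂, d₃, h₁, h₂, h₃, x₁, x₂, x₃, sg, n₁₂, n₁₃, n₂₃, j₁, j₂, dt] <;>
    ring

-- With the two identities that follow, this exhibits multiplication by the element `B₁ 0 ⬝ᵥ g` of
-- `im b₁` as null-homotopic on `B`, through left multiplication by `g`.
set_option maxHeartbeats 1000000 in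
theorem homotopy_B₁ (g : Fin 5 → R) : c.B₂ * c.hB₁ g + Matrix.vecMulVec g (c.B₁ 0) = (c.B₁ 0 ⬝ᵥ
      g) • 1 := by
  ext i j
  fin_cases i <;> fin_cases j <;>
    simp only [Matrix.mul_apply, Matrix.of_apply, Matrix.cons_val, Matrix.smul_apply,
      smul_eq_mul, Matrix.add_apply, Matrix.vecMulVec_apply, dotProduct, Matrix.one_apply,
      Fin.reduceEq, reduceIte, Fin.reduceFinMk, Fin.zero_eta, Fin.mk_one, Fin.isValue,
      Fin.sum_univ_six, Fin.sum_univ_five] <;>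
    simp only [B₂, hB₁, B₁, Matrix.mul_apply, Matrix.of_apply, Matrix.cons_val,
      Matrix.smul_apply, smul_eq_mul, Matrix.add_apply, Matrix.vecMulVec_apply, dotProduct,
      Matrix.one_apply, Fin.reduceEq, reduceIte, Fin.reduceFinMk, Fin.zero_eta, Fin.mk_one,
      Fin.isValue, w₁, w₂, d₁, d₂, d₃, h₁, h₂, h₃] <;>
    ring

set_option maxHeartbeats 1000000 in
theorem homotopy_B₂ (g : Fin 5 → R) : c.B₃ * c.hB₂ g + c.hB₁ g * c.B₂ = (c.B₁ 0 ⬝ᵥ g) • 1 := by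
  ext i j
  fin_cases i <;> fin_cases j <;>
    simp only [Matrix.mul_apply, Matrix.of_apply, Matrix.cons_val, Matrix.smul_apply,
      smul_eq_mul, Matrix.add_apply, dotProduct, Matrix.one_apply, Fin.reduceEq, reduceIte,
      Fin.reduceFinMk, Fin.zero_eta, Fin.mk_one, Fin.isValue, Fin.sum_univ_two,
      Fin.sum_univ_five] <;>
    simp only [B₃, hB₂, hB₁, B₂, B₁, Matrix.mul_apply, Matrix.of_apply, Matrix.cons_val,
      Matrix.smul_apply, smul_eq_mul, Matrix.add_apply, dotProduct, Matrix.one_apply,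
      Fin.reduceEq, reduceIte, Fin.reduceFinMk, Fin.zero_eta, Fin.mk_one, Fin.isValue, w₁, w₂,
      d₁, d₂, d₃, h₁, h₂, h₃] <;>
    ring

theorem homotopy_B₃ (g : Fin 5 → R) : c.hB₂ g * c.B₃ = (c.B₁ 0 ⬝ᵥ g) • 1 := by
  ext i j
  fin_cases i <;> fin_cases j <;>
    simp only [Matrix.mul_apply, Matrix.of_apply, Matrix.cons_val, Matrix.smul_apply,
      smul_eq_mul, dotProduct, Matrix.one_apply, Fin.reduceEq, reduceIte, Fin.reduceFinMk,
      Fin.zero_eta, Fin.mk_one, Fin.isValue, Fin.sum_univ_six, Fin.sum_univ_five] <;>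
    simp only [hB₂, B₃, B₁, Matrix.mul_apply, Matrix.of_apply, Matrix.cons_val,
      Matrix.smul_apply, smul_eq_mul, dotProduct, Matrix.one_apply, Fin.reduceEq, reduceIte,
      Fin.reduceFinMk, Fin.zero_eta, Fin.mk_one, Fin.isValue, w₁, w₂, d₁, d₂, d₃, h₁, h₂, h₃] <;>
    ring

theorem homotopy_K₁ (f : Fin 3 → R) : c.K₂ * hK₁ f + Matrix.vecMulVec f (c.K₁ 0) = (c.K₁ 0 ⬝ᵥ f)
      • 1 := by
  ext i j
  fin_cases i <;> fin_cases j <;>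
    simp only [Matrix.mul_apply, Matrix.of_apply, Matrix.cons_val, Matrix.smul_apply,
      smul_eq_mul, Matrix.add_apply, Matrix.vecMulVec_apply, dotProduct, Matrix.one_apply,
      Fin.reduceEq, reduceIte, Fin.reduceFinMk, Fin.zero_eta, Fin.mk_one, Fin.isValue,
      Fin.sum_univ_three] <;>
    simp only [K₂, hK₁, K₁, Matrix.mul_apply, Matrix.of_apply, Matrix.cons_val,
      Matrix.smul_apply, smul_eq_mul, Matrix.add_apply, Matrix.vecMulVec_apply, dotProduct,
      Matrix.one_apply, Fin.reduceEq, reduceIte, Fin.reduceFinMk, Fin.zero_eta, Fin.mk_one,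
      Fin.isValue] <;>
    ring

theorem homotopy_K₂ (f : Fin 3 → R) : c.K₃ * hK₂ f + hK₁ f * c.K₂ = (c.K₁ 0 ⬝ᵥ f) • 1 := by
  ext i j
  fin_cases i <;> fin_cases j <;>
    simp only [Matrix.mul_apply, Matrix.of_apply, Matrix.cons_val, Matrix.smul_apply,
      smul_eq_mul, Matrix.add_apply, dotProduct, Matrix.one_apply, Fin.reduceEq, reduceIte,
      Fin.reduceFinMk, Fin.zero_eta, Fin.mk_one, Fin.isValue, Finset.univ_unique,
      Finset.sum_singleton, Fin.default_eq_zero, Fin.sum_univ_three] <;>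
    simp only [K₃, hK₂, hK₁, K₂, K₁, Matrix.mul_apply, Matrix.of_apply, Matrix.cons_val,
      Matrix.smul_apply, smul_eq_mul, Matrix.add_apply, dotProduct, Matrix.one_apply,
      Fin.reduceEq, reduceIte, Fin.reduceFinMk, Fin.zero_eta, Fin.mk_one, Fin.isValue] <;>
    ring

theorem homotopy_K₃ (f : Fin 3 → R) : hK₂ f * c.K₃ = (c.K₁ 0 ⬝ᵥ f) • 1 := by
  ext i j
  fin_cases i <;> fin_cases j <;>
    simp only [Matrix.mul_apply, Matrix.of_apply, Matrix.cons_val, Matrix.smul_apply,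
      smul_eq_mul, dotProduct, Matrix.one_apply, Fin.reduceEq, reduceIte, Fin.reduceFinMk,
      Fin.zero_eta, Fin.mk_one, Fin.isValue, Fin.sum_univ_three] <;>
    simp only [hK₂, K₃, K₁, Matrix.mul_apply, Matrix.of_apply, Matrix.cons_val,
      Matrix.smul_apply, smul_eq_mul, dotProduct, Matrix.one_apply, Fin.reduceEq, reduceIte,
      Fin.reduceFinMk, Fin.zero_eta, Fin.mk_one, Fin.isValue] <;>
    ring

set_option maxHeartbeats 1000000 in
theorem homotopy_Q₁ (f : Fin 3 → R) :
    c.Q₂ * c.hQ₁ f + Matrix.vecMulVec ![0, 0, f 0, f 1, f 2] (c.Q₁ 0) =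
      (-c.x₃ * f 0 + c.x₂ * f 1 - c.x₁ * f 2) • 1 := by
  ext i j
  fin_cases i <;> fin_cases j <;>
    simp only [Matrix.mul_apply, Matrix.of_apply, Matrix.cons_val, Matrix.smul_apply,
      smul_eq_mul, Matrix.add_apply, Matrix.vecMulVec_apply, Matrix.one_apply, Fin.reduceEq,
      reduceIte, Fin.reduceFinMk, Fin.zero_eta, Fin.mk_one, Fin.isValue, Fin.sum_univ_six] <;>
    simp only [Q₂, hQ₁, Q₁, C₂, Matrix.mul_apply, Matrix.of_apply, Matrix.cons_val,
      Matrix.smul_apply, smul_eq_mul, Matrix.add_apply, Matrix.vecMulVec_apply, Matrix.one_apply,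
      Fin.reduceEq, reduceIte, Fin.reduceFinMk, Fin.zero_eta, Fin.mk_one, Fin.isValue, w₁, w₂,
      d₁, d₂, d₃, h₁, h₂, h₃, x₁, x₂, x₃, sg, n₁₂, n₁₃, n₂₃, j₁, j₂, dt] <;>
    ring

set_option maxHeartbeats 1000000 in
theorem homotopy_Q₂ (f : Fin 3 → R) :
    c.Q₃ * c.hQ₂ f + c.hQ₁ f * c.Q₂ = (-c.x₃ * f 0 + c.x₂ * f 1 - c.x₁ * f 2) • 1 := by
  ext i j
  fin_cases i <;> fin_cases j <;>
    simp only [Matrix.mul_apply, Matrix.of_apply, Matrix.cons_val, Matrix.smul_apply,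
      smul_eq_mul, Matrix.add_apply, Matrix.one_apply, Fin.reduceEq, reduceIte, Fin.reduceFinMk,
      Fin.zero_eta, Fin.mk_one, Fin.isValue, Fin.sum_univ_two, Fin.sum_univ_five] <;>
    simp only [Q₃, hQ₂, hQ₁, Q₂, C₂, Matrix.mul_apply, Matrix.of_apply, Matrix.cons_val,
      Matrix.smul_apply, smul_eq_mul, Matrix.add_apply, Matrix.one_apply, Fin.reduceEq,
      reduceIte, Fin.reduceFinMk, Fin.zero_eta, Fin.mk_one, Fin.isValue, w₁, w₂, d₁, d₂, d₃, h₁,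
      h₂, h₃, x₁, x₂, x₃, sg, n₁₂, n₁₃, n₂₃, j₁, j₂, dt] <;>
    ring

theorem homotopy_Q₃ (f : Fin 3 → R) :
    c.hQ₂ f * c.Q₃ = (-c.x₃ * f 0 + c.x₂ * f 1 - c.x₁ * f 2) • 1 := by
  ext i j
  fin_cases i <;> fin_cases j <;>
    simp only [Matrix.mul_apply, Matrix.of_apply, Matrix.cons_val, Matrix.smul_apply,
      smul_eq_mul, Matrix.add_apply, Matrix.one_apply, Fin.reduceEq, reduceIte, Fin.reduceFinMk,
      Fin.zero_eta, Fin.mk_one, Fin.isValue, Fin.sum_univ_six] <;>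
    simp only [hQ₂, Q₃, Matrix.mul_apply, Matrix.of_apply, Matrix.cons_val, Matrix.smul_apply,
      smul_eq_mul, Matrix.add_apply, Matrix.one_apply, Fin.reduceEq, reduceIte, Fin.reduceFinMk,
      Fin.zero_eta, Fin.mk_one, Fin.isValue, w₁, w₂, d₁, d₂, d₃, h₁, h₂, h₃, x₁, x₂, x₃, sg, n₁₂,
      n₁₃, n₂₃, j₁, j₂, dt] <;>
    ring

end LinkCoef

/-! ### Linkage in coordinates -/

theorem KoszulTorsion.mono {R M : Type*} [CommRing R] [AddCommGroup M] [Module R M]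
    {t x₁ x₂ x₃ : R} {n m : ℕ} (h : KoszulTorsion t x₁ x₂ x₃ M n) (hmn : m ≤ n) :
    KoszulTorsion t x₁ x₂ x₃ M m :=
  ⟨fun h' => h.zero (by omega), fun h' => h.one (by omega), fun h' => h.two (by omega)⟩

/-! ### Complexes given by matrices: exactness and lifting. -/

section MatrixComplex

variable {R : Type*} [CommRing R]
  {n₀ n₁ n₂ n₃ : Type*} [Fintype n₀] [Fintype n₁] [Fintype n₂] [Fintype n₃]
  [DecidableEq n₁] [DecidableEq n₂] [DecidableEq n₃]
  {D₁ : Matrix n₀ n₁ R} {D₂ : Matrix n₁ n₂ R} {D₃ : Matrix n₂ n₃ R}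

/-- Null-homotopic multiplication by each `y` means that the homology is annihilated by the `y`, and
Koszul cohomology of a regular sequence on free modules vanishes in degrees below three. The
acyclicity lemma applies. -/
theorem exact_of_homotopy {y₁ y₂ y₃ : R} (hy : IsWeaklyRegular R [y₁, y₂, y₃])
    (h₁₂ : D₁ * D₂ = 0) (h₂₃ : D₂ * D₃ = 0)
    (h : ∀ y ∈ ({y₁, y₂, y₃} : Set R), ∃ (E : Matrix n₁ n₀ R) (H₁ : Matrix n₂ n₁ R)
      (H₂ : Matrix n₃ n₂ R), D₂ * H₁ + E * D₁ = y • 1 ∧ D₃ * H₂ + H₁ * D₂ = y • 1 ∧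
        H₂ * D₃ = y • 1) :
    Function.Injective D₃.mulVecLin ∧ Function.Exact D₃.mulVecLin D₂.mulVecLin ∧
      Function.Exact D₂.mulVecLin D₁.mulVecLin := by
  have k := KoszulTorsion.of_isWeaklyRegular hy
  refine acyclicity (k.pi n₃) ((k.pi n₂).mono (by norm_num)) ((k.pi n₁).mono (by norm_num))
    ?_ ?_ ?_ ?_ ?_
  · rw [← Matrix.mulVecLin_mul, h₁₂, Matrix.mulVecLin_zero]
  · rw [← Matrix.mulVecLin_mul, h₂₃, Matrix.mulVecLin_zero]
  · intro y hy z hz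
    obtain ⟨E, H₁, H₂, e₁, e₂, e₃⟩ := h y hy
    have := congrArg (fun M => M.mulVec z) e₃
    simp only [Matrix.smul_mulVec, Matrix.one_mulVec] at this
    rw [Matrix.mulVecLin_apply] at hz
    rw [← this, ← Matrix.mulVec_mulVec, hz, Matrix.mulVec_zero]
  · intro y hy z hz
    obtain ⟨E, H₁, H₂, e₁, e₂, e₃⟩ := h y hy
    have := congrArg (fun M => M.mulVec z) e₂
    simp only [Matrix.smul_mulVec, Matrix.one_mulVec, Matrix.add_mulVec] at this
    rw [Matrix.mulVecLin_apply] at hz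
    rw [← Matrix.mulVec_mulVec, ← Matrix.mulVec_mulVec, hz, Matrix.mulVec_zero, add_zero] at this
    exact ⟨_, this⟩
  · intro y hy z hz
    obtain ⟨E, H₁, H₂, e₁, e₂, e₃⟩ := h y hy
    have := congrArg (fun M => M.mulVec z) e₁
    simp only [Matrix.smul_mulVec, Matrix.one_mulVec, Matrix.add_mulVec] at this
    rw [Matrix.mulVecLin_apply] at hz
    rw [← Matrix.mulVec_mulVec, ← Matrix.mulVec_mulVec, hz, Matrix.mulVec_zero, add_zero] at this
    exact ⟨_, this⟩

-- Projectivity of free modules, applied column by column; this is the lifting step of the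
-- comparison arguments below.
omit [DecidableEq n₁] [DecidableEq n₂] [Fintype n₀] in
theorem Matrix.exists_mul_eq_of_exact (h : Function.Exact D₂.mulVecLin D₁.mulVecLin) {m : Type*}
    (X : Matrix n₁ m R) (hX : D₁ * X = 0) : ∃ Y : Matrix n₂ m R, D₂ * Y = X := by
  have := fun j => (h (fun i => X i j)).mp (by
    ext i
    exact congrFun (congrFun hX i) j)
  choose Y hY using this
  exact ⟨Matrix.of fun i j => Y j i, by
    ext i j
    exact congrFun (hY j) i⟩

omit [Fintype n₁] [DecidableEq n₁] [DecidableEq n₂] in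
theorem Matrix.eq_zero_of_mul_eq_zero_of_injective (h : Function.Injective D₂.mulVecLin) {m : Type*}
    (X : Matrix n₂ m R) (hX : D₂ * X = 0) : X = 0 := by
  ext i j
  have : (fun i => X i j) = 0 := h (by
    rw [map_zero]
    ext i
    exact congrFun (congrFun hX i) j)
  exact congrFun this i

omit [DecidableEq n₁] in
theorem Matrix.mul_apply_mem_span_range {M : Matrix (Fin 1) n₁ R} {n : Type*} (X : Matrix n₁ n R) (i : Fin 1)
    (j : n) : (M * X) i j ∈ Ideal.span (Set.range (M 0)) := by
  rw [Subsingleton.elim i 0, Matrix.mul_apply]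
  exact Ideal.sum_mem _ fun k _ => Ideal.mul_mem_right _ _ (Ideal.subset_span ⟨k, rfl⟩)

omit [DecidableEq n₁] in
theorem Matrix.exists_dotProduct_eq_of_mem_span {v : n₁ → R} {r : R} (h : r ∈ Ideal.span (Set.range v)) :
    ∃ g : n₁ → R, v ⬝ᵥ g = r := by
  obtain ⟨g, hg⟩ := Ideal.mem_span_range_iff_exists_fun.mp h
  exact ⟨g, by rw [← hg, dotProduct]; simp [mul_comm]⟩

omit [DecidableEq n₁] in
theorem Matrix.exists_mul_eq_of_mem_span {M : Matrix (Fin 1) n₁ R} {n : Type*} (X : Matrix (Fin 1) n R)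
    (h : ∀ j, X 0 j ∈ Ideal.span (Set.range (M 0))) : ∃ Y : Matrix n₁ n R, M * Y = X := by
  choose g hg using fun j => Matrix.exists_dotProduct_eq_of_mem_span (h j)
  refine ⟨Matrix.of fun i j => g j i, ?_⟩
  ext i j
  rw [Subsingleton.elim i 0, ← hg j]
  rfl

omit [Fintype n₁] [DecidableEq n₁] in
theorem Matrix.vecMulVec_eq_replicateCol_mul (g : n₁ → R) (M : Matrix (Fin 1) n₁ R) :
    Matrix.vecMulVec g (M 0) = Matrix.replicateCol (Fin 1) g * M := by
  ext i j
  simp [Matrix.vecMulVec_apply, Matrix.mul_apply]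

end MatrixComplex

/-! ### Exactness of the coordinate complexes and the two colon ideals. -/

namespace LinkCoef

variable {R : Type*} [CommRing R] (c : LinkCoef R)

def idealI : Ideal R := Ideal.span (Set.range (c.B₁ 0))

def idealX : Ideal R := Ideal.span (Set.range (c.K₁ 0))

def idealJ : Ideal R := Ideal.span (Set.range (c.Q₁ 0))

theorem idealX_le_idealI : c.idealX ≤ c.idealI := by
  refine Ideal.span_le.mpr ?_
  rintro _ ⟨i, rfl⟩
  rw [← c.B₁_mul_C₁]
  exact Ideal.mul_mem_left _ _ (Matrix.mul_apply_mem_span_range _ _ _)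

theorem mem_idealX : c.x₁ ∈ c.idealX ∧ c.x₂ ∈ c.idealX ∧ c.x₃ ∈ c.idealX :=
  ⟨Ideal.subset_span ⟨0, rfl⟩, Ideal.subset_span ⟨1, rfl⟩, Ideal.subset_span ⟨2, rfl⟩⟩

theorem span_K₃ : Ideal.span (Set.range (c.K₃.transpose 0)) = c.idealX := by
  obtain ⟨h₁, h₂, h₃⟩ := c.mem_idealX
  apply le_antisymm
  · refine Ideal.span_le.mpr ?_
    rintro _ ⟨i, rfl⟩
    fin_cases i
    · exact neg_mem h₃
    · exact h₂
    · exact neg_mem h₁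
  · refine Ideal.span_le.mpr ?_
    rintro _ ⟨i, rfl⟩
    fin_cases i
    · exact neg_mem_iff.mp (Ideal.subset_span ⟨2, rfl⟩)
    · exact Ideal.subset_span ⟨1, rfl⟩
    · exact neg_mem_iff.mp (Ideal.subset_span ⟨0, rfl⟩)

theorem idealX_le_idealJ : c.idealX ≤ c.idealJ := by
  refine Ideal.span_le.mpr ?_
  rintro _ ⟨i, rfl⟩
  fin_cases i
  · exact neg_mem_iff.mp (Ideal.subset_span ⟨4, rfl⟩)
  · exact Ideal.subset_span ⟨3, rfl⟩
  · exact neg_mem_iff.mp (Ideal.subset_span ⟨2, rfl⟩)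

theorem idealJ_le_iff {A : Ideal R} :
    c.idealJ ≤ A ↔ (∀ k, c.C₃ k 0 ∈ A) ∧ c.idealX ≤ A := by
  constructor
  · intro h
    refine ⟨fun k => h ?_, c.idealX_le_idealJ.trans h⟩
    fin_cases k
    · exact Ideal.subset_span ⟨0, rfl⟩
    · exact Ideal.subset_span ⟨1, rfl⟩
  · rintro ⟨h, hX⟩
    obtain ⟨h₁, h₂, h₃⟩ := c.mem_idealX
    refine Ideal.span_le.mpr ?_
    rintro _ ⟨i, rfl⟩
    fin_cases i
    · exact h 0
    · exact h 1
    · exact neg_mem (hX h₃)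
    · exact hX h₂
    · exact neg_mem (hX h₁)

variable {c} {y₁ y₂ y₃ : R} (h₁ : y₁ ∈ c.idealX) (h₂ : y₂ ∈ c.idealX) (h₃ : y₃ ∈ c.idealX)
  (hy : IsWeaklyRegular R [y₁, y₂, y₃])
include h₁ h₂ h₃ hy

omit hy in
theorem mem_of_mem_triple {A : Ideal R} (hA : c.idealX ≤ A) :
    ∀ y ∈ ({y₁, y₂, y₃} : Set R), y ∈ A := by
  rintro y (rfl | rfl | rfl)
  exacts [hA h₁, hA h₂, hA h₃]

theorem exact_B : Function.Injective c.B₃.mulVecLin ∧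
    Function.Exact c.B₃.mulVecLin c.B₂.mulVecLin ∧
      Function.Exact c.B₂.mulVecLin c.B₁.mulVecLin := by
  refine exact_of_homotopy hy c.B₁_mul_B₂ c.B₂_mul_B₃ fun y hy => ?_
  obtain ⟨g, rfl⟩ := Matrix.exists_dotProduct_eq_of_mem_span (mem_of_mem_triple h₁ h₂ h₃ c.idealX_le_idealI y hy)
  exact ⟨_, _, _, by rw [← Matrix.vecMulVec_eq_replicateCol_mul, c.homotopy_B₁ g], c.homotopy_B₂ g, c.homotopy_B₃ g⟩

theorem exact_K : Function.Injective c.K₃.mulVecLin ∧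
    Function.Exact c.K₃.mulVecLin c.K₂.mulVecLin ∧
      Function.Exact c.K₂.mulVecLin c.K₁.mulVecLin := by
  refine exact_of_homotopy hy c.K₁_mul_K₂ c.K₂_mul_K₃ fun y hy => ?_
  obtain ⟨g, rfl⟩ := Matrix.exists_dotProduct_eq_of_mem_span (mem_of_mem_triple h₁ h₂ h₃ le_rfl y hy)
  exact ⟨_, _, _, by rw [← Matrix.vecMulVec_eq_replicateCol_mul, c.homotopy_K₁ g], c.homotopy_K₂ g, c.homotopy_K₃ g⟩

/-- The transposes of the Koszul null-homotopies are null-homotopies of the dual complex, with the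
order of the degrees reversed. -/
theorem exact_transpose_K : Function.Injective c.K₁.transpose.mulVecLin ∧
    Function.Exact c.K₁.transpose.mulVecLin c.K₂.transpose.mulVecLin ∧
      Function.Exact c.K₂.transpose.mulVecLin c.K₃.transpose.mulVecLin := by
  refine exact_of_homotopy hy (by rw [← Matrix.transpose_mul, c.K₂_mul_K₃, Matrix.transpose_zero])
    (by rw [← Matrix.transpose_mul, c.K₁_mul_K₂, Matrix.transpose_zero]) fun y hy => ?_
  obtain ⟨g, rfl⟩ := Matrix.exists_dotProduct_eq_of_mem_span (mem_of_mem_triple h₁ h₂ h₃ le_rfl y hy)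
  refine ⟨(hK₂ g).transpose, (hK₁ g).transpose, (Matrix.replicateCol (Fin 1) g).transpose,
    ?_, ?_, ?_⟩
  · rw [← Matrix.transpose_mul, ← Matrix.transpose_mul, ← Matrix.transpose_add, add_comm,
      c.homotopy_K₂ g, Matrix.transpose_smul, Matrix.transpose_one]
  · rw [← Matrix.transpose_mul, ← Matrix.transpose_mul, ← Matrix.transpose_add, add_comm,
      ← Matrix.vecMulVec_eq_replicateCol_mul, c.homotopy_K₁ g, Matrix.transpose_smul, Matrix.transpose_one]
  · ext i j
    fin_cases i
    fin_cases j
    simp [Matrix.mul_apply, dotProduct, mul_comm]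

theorem exact_Q : Function.Injective c.Q₃.mulVecLin ∧
    Function.Exact c.Q₃.mulVecLin c.Q₂.mulVecLin ∧
      Function.Exact c.Q₂.mulVecLin c.Q₁.mulVecLin := by
  refine exact_of_homotopy hy c.Q₁_mul_Q₂ c.Q₂_mul_Q₃ fun y hy => ?_
  obtain ⟨g, e⟩ := Matrix.exists_dotProduct_eq_of_mem_span (mem_of_mem_triple h₁ h₂ h₃ le_rfl y hy)
  -- The last three entries of `Q₁` are `-x₃, x₂, -x₁`, so the coefficients `g` of `x₁, x₂, x₃` are
  -- used in reverse order with these signs.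
  have e' : -c.x₃ * (-g 2) + c.x₂ * g 1 - c.x₁ * (-g 0) = y := by
    rw [← e]
    simp [K₁, dotProduct, Fin.sum_univ_three]
    ring
  have H₁ := c.homotopy_Q₁ ![-g 2, g 1, -g 0]
  have H₂ := c.homotopy_Q₂ ![-g 2, g 1, -g 0]
  have H₃ := c.homotopy_Q₃ ![-g 2, g 1, -g 0]
  simp only [Matrix.cons_val] at H₁ H₂ H₃
  rw [e'] at H₁ H₂ H₃
  exact ⟨_, _, _, by rw [← Matrix.vecMulVec_eq_replicateCol_mul, H₁], H₂, H₃⟩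

-- For `r = B₁ 0 ⬝ᵥ g` the top null-homotopy gives `r C₃ = hB₂ B₃ C₃ = hB₂ C₂ K₃`, whose entries are
-- combinations of those of `K₃`. The remaining generators of `J` lie in `K` already.
omit h₁ h₂ h₃ hy in
theorem mul_mem_idealX {r s : R} (hr : r ∈ c.idealI) (hs : s ∈ c.idealJ) : r * s ∈ c.idealX := by
  obtain ⟨g, rfl⟩ := Matrix.exists_dotProduct_eq_of_mem_span hr
  have key : ∀ k, (c.B₁ 0 ⬝ᵥ g) * c.C₃ k 0 ∈ c.idealX := by
    intro k
    have e : (c.B₁ 0 ⬝ᵥ g) • c.C₃ = (c.hB₂ g * c.C₂) * c.K₃ := by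
      rw [Matrix.mul_assoc, ← c.B₃_mul_C₃, ← Matrix.mul_assoc, c.homotopy_B₃, Matrix.smul_mul,
        Matrix.one_mul]
    have e' := congrFun (congrFun e k) 0
    rw [Matrix.smul_apply, smul_eq_mul] at e'
    rw [e', Matrix.mul_apply, ← c.span_K₃]
    exact Ideal.sum_mem _ fun i _ => Ideal.mul_mem_left _ _ (Ideal.subset_span ⟨i, rfl⟩)
  have : c.idealJ ≤ c.idealX.colon ({c.B₁ 0 ⬝ᵥ g} : Set R) := by
    refine c.idealJ_le_iff.mpr ⟨fun k => ?_, fun x hx => ?_⟩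
    · rw [Submodule.mem_colon_singleton, smul_eq_mul, mul_comm]
      exact key k
    · rw [Submodule.mem_colon_singleton, smul_eq_mul]
      exact Ideal.mul_mem_right _ _ hx
  have := this hs
  rwa [Submodule.mem_colon_singleton, smul_eq_mul, mul_comm] at this

theorem idealJ_eq_colon : c.idealJ = c.idealX.colon (c.idealI : Set R) := by
  apply le_antisymm
  · intro s hs
    rw [Submodule.mem_colon]
    intro r hr
    rw [smul_eq_mul, mul_comm]
    exact mul_mem_idealX hr hs
  · intro r hr
    rw [Submodule.mem_colon] at hr
    obtain ⟨i₃, e₂, e₁⟩ := exact_K h₁ h₂ h₃ hy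
    -- As `r I ⊆ K`, the row `r B₁` factors through `K₁`. This starts a chain map `R₁, R₂, R₃` from
    -- `B` to the Koszul complex.
    obtain ⟨R₁, hR₁⟩ := Matrix.exists_mul_eq_of_mem_span (M := c.K₁) (r • c.B₁) (fun j =>
      hr _ (Ideal.subset_span ⟨j, rfl⟩))
    obtain ⟨R₂, hR₂⟩ := Matrix.exists_mul_eq_of_exact e₁ (R₁ * c.B₂) (by
      rw [← Matrix.mul_assoc, hR₁, Matrix.smul_mul, c.B₁_mul_B₂, smul_zero])
    obtain ⟨R₃, hR₃⟩ := Matrix.exists_mul_eq_of_exact e₂ (R₂ * c.B₃) (by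
      rw [← Matrix.mul_assoc, hR₂, Matrix.mul_assoc, c.B₂_mul_B₃, Matrix.mul_zero])
    -- Since `K₁ = p B₁ C₁`, both `p R C` and multiplication by `r` are endomorphisms of the Koszul
    -- complex that lie over `r` in degree zero. The matrices `S₁, S₂` form a homotopy between them.
    -- In the top degree injectivity leaves `r = p R₃ C₃ - S₂ K₃`, an element of `J`.
    obtain ⟨S₁, hS₁⟩ := Matrix.exists_mul_eq_of_exact e₁ (c.p • (R₁ * c.C₁) - r • 1) (by
      rw [Matrix.mul_sub, Matrix.mul_smul, ← Matrix.mul_assoc, hR₁, Matrix.smul_mul, smul_comm,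
        c.B₁_mul_C₁, Matrix.mul_smul, Matrix.mul_one, sub_self])
    obtain ⟨S₂, hS₂⟩ := Matrix.exists_mul_eq_of_exact e₂ (c.p • (R₂ * c.C₂) - r • 1 - S₁ * c.K₂) (by
      rw [Matrix.mul_sub, Matrix.mul_sub, Matrix.mul_smul, ← Matrix.mul_assoc, hR₂,
        ← Matrix.mul_assoc, hS₁, Matrix.mul_assoc, c.B₂_mul_C₂, Matrix.mul_smul, Matrix.mul_one,
        Matrix.sub_mul, Matrix.smul_mul, Matrix.mul_assoc, Matrix.smul_mul, Matrix.one_mul,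
        sub_self])
    have hS₃ : c.p • (R₃ * c.C₃) - r • 1 - S₂ * c.K₃ = 0 := Matrix.eq_zero_of_mul_eq_zero_of_injective i₃ _ (by
      rw [Matrix.mul_sub, Matrix.mul_sub, Matrix.mul_smul, ← Matrix.mul_assoc, hR₃,
        ← Matrix.mul_assoc, hS₂, Matrix.mul_assoc, c.B₃_mul_C₃, Matrix.mul_smul, Matrix.mul_one,
        Matrix.sub_mul, Matrix.sub_mul, Matrix.smul_mul, Matrix.mul_assoc, Matrix.smul_mul,
        Matrix.one_mul, Matrix.mul_assoc S₁, c.K₂_mul_K₃, Matrix.mul_zero, sub_zero, sub_self])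
    have e := congrFun (congrFun hS₃ 0) 0
    simp only [Matrix.sub_apply, Matrix.smul_apply, Matrix.one_apply_eq, smul_eq_mul, mul_one,
      Matrix.zero_apply] at e
    have : r = c.p * (R₃ * c.C₃) 0 0 - (S₂ * c.K₃) 0 0 := by linear_combination -e
    obtain ⟨hC, hX⟩ := c.idealJ_le_iff.mp le_rfl
    rw [this]
    refine sub_mem (Ideal.mul_mem_left _ _ ?_) (hX ?_)
    · rw [Matrix.mul_apply]
      exact Ideal.sum_mem _ fun k _ => Ideal.mul_mem_left _ _ (hC k)
    · rw [Matrix.mul_apply, ← c.span_K₃]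
      exact Ideal.sum_mem _ fun k _ => Ideal.mul_mem_left _ _ (Ideal.subset_span ⟨k, rfl⟩)

theorem idealI_eq_colon : c.idealI = c.idealX.colon (c.idealJ : Set R) := by
  apply le_antisymm
  · intro r hr
    rw [Submodule.mem_colon]
    intro s hs
    rw [smul_eq_mul]
    exact mul_mem_idealX hr hs
  · intro r hr
    rw [Submodule.mem_colon] at hr
    obtain ⟨i₃, e₂, e₁⟩ := exact_transpose_K h₁ h₂ h₃ hy
    obtain ⟨hC, -⟩ := c.idealJ_le_iff.mp le_rfl
    -- As `r J ⊆ K`, the row `r C₃ᵀ` factors through `K₃ᵀ`. Exactness of the dual Koszul complex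
    -- extends this to a null-homotopy `T₁, T₂, T₃` of `r` times the dual of the comparison map.
    obtain ⟨T₁, hT₁⟩ := Matrix.exists_mul_eq_of_mem_span (M := c.K₃.transpose) (r • c.C₃.transpose) (fun j => by
      rw [c.span_K₃]
      exact hr _ (hC j))
    obtain ⟨T₂, hT₂⟩ := Matrix.exists_mul_eq_of_exact e₁
      (r • c.C₂.transpose - T₁ * c.B₃.transpose) (by
      rw [Matrix.mul_sub, ← Matrix.mul_assoc, hT₁, Matrix.mul_smul, Matrix.smul_mul,
        ← Matrix.transpose_mul, ← Matrix.transpose_mul, c.B₃_mul_C₃, sub_self])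
    obtain ⟨T₃, hT₃⟩ := Matrix.exists_mul_eq_of_exact e₂
      (r • c.C₁.transpose - T₂ * c.B₂.transpose) (by
      rw [Matrix.mul_sub, ← Matrix.mul_assoc, hT₂, Matrix.mul_smul, Matrix.sub_mul, Matrix.smul_mul,
        ← Matrix.transpose_mul, ← Matrix.transpose_mul, c.B₂_mul_C₂, Matrix.mul_assoc,
        ← Matrix.transpose_mul, c.B₂_mul_B₃, Matrix.transpose_zero, Matrix.mul_zero, sub_zero,
        sub_self])
    -- The end of the null-homotopy, where `K₁ᵀ` is injective: `r = p T₃ B₁ᵀ` is a combination of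
    -- the generators of `I`.
    have e := Matrix.eq_zero_of_mul_eq_zero_of_injective i₃ (r • (1 : Matrix (Fin 1) (Fin 1) R) -
        c.p • (T₃ * c.B₁.transpose)) (by
      rw [Matrix.mul_sub, Matrix.mul_smul, Matrix.mul_one, Matrix.mul_smul, ← Matrix.mul_assoc,
        hT₃, Matrix.sub_mul, Matrix.mul_assoc, ← Matrix.transpose_mul, c.B₁_mul_B₂,
        Matrix.transpose_zero, Matrix.mul_zero, sub_zero, Matrix.smul_mul, smul_comm c.p,
        ← Matrix.transpose_mul, ← Matrix.transpose_smul c.p, c.B₁_mul_C₁, sub_self])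
    have e := congrFun (congrFun e 0) 0
    simp only [Matrix.sub_apply, Matrix.smul_apply, Matrix.one_apply_eq, smul_eq_mul, mul_one,
      Matrix.zero_apply] at e
    have : r = c.p * (T₃ * c.B₁.transpose) 0 0 := by linear_combination e
    rw [this, Matrix.mul_apply]
    exact Ideal.mul_mem_left _ _ (Ideal.sum_mem _ fun k _ =>
      Ideal.mul_mem_left _ _ (Ideal.subset_span ⟨k, rfl⟩))

end LinkCoef

/-! ### Exterior powers in coordinates -/

namespace ExteriorContraction

section Decomposable

variable {R : Type*} [CommRing R] {M N : Type*} [AddCommGroup M] [Module R M]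
  [AddCommGroup N] [Module R N]

@[simp]
theorem coe_vec (x : M) : ((vec x : ⋀[R]^1 M) : ExteriorAlgebra R M) = ExteriorAlgebra.ι R x := by
  have : vec (R := R) x = exteriorPower.ιMulti R 1 ![x] := by
    rw [vec, LinearEquiv.coe_coe, LinearEquiv.symm_apply_eq, exteriorPower.oneEquiv_ιMulti]
    rfl
  rw [this, exteriorPower.ιMulti_apply_coe, ExteriorAlgebra.ιMulti_apply]
  simp

theorem unvec_eq_of_coe_eq {t : ⋀[R]^1 M} {x : M}
    (h : (t : ExteriorAlgebra R M) = ExteriorAlgebra.ι R x) : unvec t = x := by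
  have : t = vec x := Subtype.ext (by rw [h, coe_vec])
  rw [this, unvec, vec, LinearEquiv.coe_coe, LinearEquiv.coe_coe, LinearEquiv.apply_symm_apply]

theorem scal_eq_of_coe_eq {t : ⋀[R]^0 M} {r : R}
    (h : (t : ExteriorAlgebra R M) = algebraMap R _ r) : scal t = r := by
  have : t = r • exteriorPower.ιMulti R 0 (Fin.elim0 : Fin 0 → M) := Subtype.ext (by
    rw [h, Submodule.coe_smul, exteriorPower.ιMulti_apply_coe, ExteriorAlgebra.ιMulti_apply]
    simp [Algebra.algebraMap_eq_smul_one])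
  rw [this, map_smul, scal, LinearEquiv.coe_coe, exteriorPower.zeroEquiv_ιMulti, smul_eq_mul,
    mul_one]

theorem coe_ιMulti_two (x y : M) : (exteriorPower.ιMulti R 2 ![x, y] : ExteriorAlgebra R M) =
    ExteriorAlgebra.ι R x * ExteriorAlgebra.ι R y := by
  rw [exteriorPower.ιMulti_apply_coe, ExteriorAlgebra.ιMulti_apply]
  simp [List.ofFn_succ]

theorem coe_ιMulti_three (x y z : M) : (exteriorPower.ιMulti R 3 ![x, y, z] : ExteriorAlgebra R M) =
    ExteriorAlgebra.ι R x * (ExteriorAlgebra.ι R y * ExteriorAlgebra.ι R z) := by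
  rw [exteriorPower.ιMulti_apply_coe, ExteriorAlgebra.ιMulti_apply]
  simp [List.ofFn_succ]

theorem coe_wedge {i j k : ℕ} (h : i + j = k) (x : ⋀[R]^i M) (y : ⋀[R]^j M) :
    (wedge h x y : ExteriorAlgebra R M) = x * y :=
  rfl

theorem coe_contract (B : M →ₗ[R] Dual R N) {i j k : ℕ} (h : i + k = j) (x : ⋀[R]^i M)
    (y : ⋀[R]^j N) :
    (contract B h x y : ExteriorAlgebra R N) = act B (x : ExteriorAlgebra R M) y :=
  rfl

theorem wedge_vec_vec (h : 1 + 1 = 2) (x y : M) :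
    wedge (R := R) h (vec x) (vec y) = exteriorPower.ιMulti R 2 ![x, y] :=
  Subtype.ext (by rw [coe_wedge, coe_vec, coe_vec, coe_ιMulti_two])

theorem wedge_vec_ιMulti (h : 1 + 2 = 3) (x y z : M) :
    wedge (R := R) h (vec x) (exteriorPower.ιMulti R 2 ![y, z]) =
      exteriorPower.ιMulti R 3 ![x, y, z] :=
  Subtype.ext (by rw [coe_wedge, coe_vec, coe_ιMulti_two, coe_ιMulti_three])

theorem wedge_ιMulti_vec (h : 2 + 1 = 3) (x y z : M) :
    wedge (R := R) h (exteriorPower.ιMulti R 2 ![x, y]) (vec z) =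
      exteriorPower.ιMulti R 3 ![x, y, z] :=
  Subtype.ext (by rw [coe_wedge, coe_vec, coe_ιMulti_two, coe_ιMulti_three, mul_assoc])

variable (B : M →ₗ[R] Dual R N)

theorem act_ι_ι (m : M) (x : N) :
    act B (ExteriorAlgebra.ι R m) (ExteriorAlgebra.ι R x) = algebraMap R _ (B m x) := by
  rw [act_ι]
  exact CliffordAlgebra.contractLeft_ι (Q := (0 : QuadraticForm R N)) (B m) x

theorem act_ι_ι_mul (m : M) (x : N) (t : ExteriorAlgebra R N) :
    act B (ExteriorAlgebra.ι R m) (ExteriorAlgebra.ι R x * t) =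
      B m x • t - ExteriorAlgebra.ι R x * act B (ExteriorAlgebra.ι R m) t := by
  rw [act_ι, act_ι]
  exact CliffordAlgebra.contractLeft_ι_mul (Q := (0 : QuadraticForm R N)) (B m) x t

theorem mul_algebraMap_eq_smul (r : R) (t : ExteriorAlgebra R N) : t * algebraMap R _ r = r • t := by
  rw [← Algebra.commutes, Algebra.smul_def]

theorem contract_vec_two (h : 1 + 1 = 2) (m : M) (x y : N) :
    unvec (contract B h (vec m) (exteriorPower.ιMulti R 2 ![x, y])) = B m x • y - B m y • x :=
  unvec_eq_of_coe_eq (by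
    rw [coe_contract, coe_vec, coe_ιMulti_two, act_ι_ι_mul, act_ι_ι, mul_algebraMap_eq_smul, map_sub,
      map_smul, map_smul])

theorem contract_vec_three (h : 1 + 2 = 3) (m : M) (x y z : N) :
    contract B h (vec m) (exteriorPower.ιMulti R 3 ![x, y, z]) =
      B m x • exteriorPower.ιMulti R 2 ![y, z] - B m y • exteriorPower.ιMulti R 2 ![x, z] +
        B m z • exteriorPower.ιMulti R 2 ![x, y] :=
  Subtype.ext (by
    rw [coe_contract, coe_vec, coe_ιMulti_three, act_ι_ι_mul, act_ι_ι_mul, act_ι_ι,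
      mul_algebraMap_eq_smul, Submodule.coe_add, Submodule.coe_sub, Submodule.coe_smul,
      Submodule.coe_smul, Submodule.coe_smul, coe_ιMulti_two, coe_ιMulti_two, coe_ιMulti_two,
      mul_sub, mul_smul_comm, mul_smul_comm]
    abel)

theorem contract_two_three (h : 2 + 1 = 3) (m n : M) (t : ⋀[R]^3 N) :
    contract B h (exteriorPower.ιMulti R 2 ![m, n]) t =
      contract B (j := 2) (by rfl) (vec m) (contract B (by rfl) (vec n) t) :=
  Subtype.ext (by
    rw [coe_contract, coe_contract, coe_contract, coe_vec, coe_vec, coe_ιMulti_two, map_mul,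
      Module.End.mul_apply])

/-- The factor `n` acts before `m`, so this is the negative of the determinant of the pairing. The
reversed order of the factors in `χG'` compensates for this sign. -/
theorem contract_two_two (h : 2 + 0 = 2) (m n : M) (x y : N) :
    scal (contract B h (exteriorPower.ιMulti R 2 ![m, n]) (exteriorPower.ιMulti R 2 ![x, y])) =
      B n x * B m y - B n y * B m x :=
  scal_eq_of_coe_eq (by
    rw [coe_contract, coe_ιMulti_two, coe_ιMulti_two, map_mul (act B), Module.End.mul_apply,
      act_ι_ι_mul,
      act_ι_ι, mul_algebraMap_eq_smul, map_sub, map_smul, map_smul,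
      act_ι_ι, act_ι_ι]
    simp only [Algebra.smul_def, map_sub, map_mul])

theorem contract_three_three (h : 3 + 0 = 3) (l m n : M) (t : ⋀[R]^3 N) :
    contract B h (exteriorPower.ιMulti R 3 ![l, m, n]) t =
      contract B (j := 2) (by rfl) (exteriorPower.ιMulti R 2 ![l, m])
        (contract B (by rfl) (vec n) t) :=
  Subtype.ext (by
    rw [coe_contract, coe_contract, coe_contract, coe_vec, coe_ιMulti_two, coe_ιMulti_three,
      ← mul_assoc, map_mul, Module.End.mul_apply])

end Decomposable

section Coordinates

variable {R : Type*} [CommRing R] {M : Type*} [AddCommGroup M] [Module R M]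
  {ι : Type*} (b : Basis ι R M)

/-- The Plücker coordinate of an element of `⋀²M`. -/
noncomputable def minor (i j : ι) : (⋀[R]^2 M) →ₗ[R] R :=
  exteriorPower.alternatingMapLinearEquiv
    (Matrix.detRowAlternating.compLinearMap (LinearMap.pi ![b.coord i, b.coord j]))

@[simp]
theorem minor_ιMulti (i j : ι) (v : Fin 2 → M) : minor b i j (exteriorPower.ιMulti R 2 v) =
    b.repr (v 0) i * b.repr (v 1) j - b.repr (v 0) j * b.repr (v 1) i := by
  rw [minor, exteriorPower.alternatingMapLinearEquiv_apply_ιMulti,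
    AlternatingMap.compLinearMap_apply]
  change Matrix.det (Matrix.of fun k l => ![b.coord i, b.coord j] l (v k)) = _
  rw [Matrix.det_fin_two]
  simp

/-- The coordinate of an element of `⋀³M`. -/
noncomputable def volume (b : Basis (Fin 3) R M) : (⋀[R]^3 M) →ₗ[R] R :=
  exteriorPower.alternatingMapLinearEquiv b.det

@[simp]
theorem volume_ιMulti (b : Basis (Fin 3) R M) (v : Fin 3 → M) :
    volume b (exteriorPower.ιMulti R 3 v) =
      b.repr (v 0) 0 * (b.repr (v 1) 1 * b.repr (v 2) 2 - b.repr (v 1) 2 * b.repr (v 2) 1) -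
      b.repr (v 0) 1 * (b.repr (v 1) 0 * b.repr (v 2) 2 - b.repr (v 1) 2 * b.repr (v 2) 0) +
      b.repr (v 0) 2 * (b.repr (v 1) 0 * b.repr (v 2) 1 - b.repr (v 1) 1 * b.repr (v 2) 0) := by
  rw [volume, exteriorPower.alternatingMapLinearEquiv_apply_ιMulti, Basis.det_apply,
    Matrix.det_fin_three]
  simp only [Basis.toMatrix_apply]
  ring

theorem ιMulti_swap (x y : M) :
    exteriorPower.ιMulti R 2 ![y, x] = -exteriorPower.ιMulti R 2 ![x, y] := by
  have := (exteriorPower.ιMulti R 2).map_swap ![x, y] (show (0 : Fin 2) ≠ 1 by decide)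
  rw [← this]
  congr 1
  ext i
  fin_cases i <;> rfl

theorem eq_minor_smul (b : Basis (Fin 2) R M) (x : ⋀[R]^2 M) :
    x = minor b 0 1 x • exteriorPower.ιMulti R 2 ![b 0, b 1] := by
  suffices LinearMap.id = (minor b 0 1).smulRight (exteriorPower.ιMulti R 2 ![b 0, b 1]) from
    LinearMap.congr_fun this x
  refine exteriorPower.linearMap_ext (Basis.ext_alternating b fun v hv => ?_)
  have e : (fun i => b (v i)) = ![b (v 0), b (v 1)] := by ext i; fin_cases i <;> rfl
  simp only [LinearMap.compAlternatingMap_apply, LinearMap.id_apply, LinearMap.smulRight_apply, e]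
  have h01 : v 0 ≠ v 1 := fun h => absurd (hv h) (by decide)
  generalize v 0 = i at *
  generalize v 1 = j at *
  fin_cases i <;> fin_cases j <;> simp at h01 <;> simp [ιMulti_swap (b 0) (b 1)]

theorem eq_minor_smul_add (b : Basis (Fin 3) R M) (x : ⋀[R]^2 M) :
    x = minor b 0 1 x • exteriorPower.ιMulti R 2 ![b 0, b 1] +
      minor b 0 2 x • exteriorPower.ιMulti R 2 ![b 0, b 2] +
      minor b 1 2 x • exteriorPower.ιMulti R 2 ![b 1, b 2] := by
  suffices LinearMap.id = (minor b 0 1).smulRight (exteriorPower.ιMulti R 2 ![b 0, b 1]) +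
      (minor b 0 2).smulRight (exteriorPower.ιMulti R 2 ![b 0, b 2]) +
      (minor b 1 2).smulRight (exteriorPower.ιMulti R 2 ![b 1, b 2]) from
    LinearMap.congr_fun this x
  refine exteriorPower.linearMap_ext (Basis.ext_alternating b fun v hv => ?_)
  have e : (fun i => b (v i)) = ![b (v 0), b (v 1)] := by ext i; fin_cases i <;> rfl
  simp only [LinearMap.compAlternatingMap_apply, LinearMap.id_apply, LinearMap.smulRight_apply, e,
    LinearMap.add_apply]
  have h01 : v 0 ≠ v 1 := fun h => absurd (hv h) (by decide)
  generalize v 0 = i at *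
  generalize v 1 = j at *
  fin_cases i <;> fin_cases j <;> simp at h01 <;>
    simp [ιMulti_swap (b 0) (b 1), ιMulti_swap (b 0) (b 2), ιMulti_swap (b 1) (b 2)]

theorem eq_volume_smul (b : Basis (Fin 3) R M) (x : ⋀[R]^3 M) :
    x = volume b x • exteriorPower.ιMulti R 3 ![b 0, b 1, b 2] := by
  suffices LinearMap.id = (volume b).smulRight (exteriorPower.ιMulti R 3 ![b 0, b 1, b 2]) from
    LinearMap.congr_fun this x
  refine exteriorPower.linearMap_ext (Basis.ext_alternating b fun v hv => ?_)
  have e : ![b 0, b 1, b 2] = b := by ext i; fin_cases i <;> rfl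
  let σ : Equiv.Perm (Fin 3) := Equiv.ofBijective v (Finite.injective_iff_bijective.1 hv)
  change exteriorPower.ιMulti R 3 (b ∘ σ) = volume b (exteriorPower.ιMulti R 3 (b ∘ σ)) •
    exteriorPower.ιMulti R 3 ![b 0, b 1, b 2]
  -- An injective index map on `Fin 3` is a permutation, and both sides change by its sign.
  rw [volume, exteriorPower.alternatingMapLinearEquiv_apply_ιMulti, AlternatingMap.map_perm,
    AlternatingMap.map_perm, Basis.det_self, e]
  rcases Int.units_eq_one_or (Equiv.Perm.sign σ) with h | h
  · simp [h]
  · rw [h, Units.smul_def, Units.smul_def, Units.val_neg, Units.val_one]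
    simp only [Int.reduceNeg, neg_smul, one_smul]
    first | exact (neg_one_smul ℤ _).symm | exact (neg_one_smul R _).symm

end Coordinates

/-! ### Products, contractions and induced maps in Plücker coordinates. -/

section Formulas

variable {R : Type*} [CommRing R] {M N : Type*} [AddCommGroup M] [Module R M]
  [AddCommGroup N] [Module R N]

theorem minor_wedge {ι : Type*} (b : Basis ι R N) (i j : ι) (h : 1 + 1 = 2) (x y : N) :
    minor b i j (wedge h (vec x) (vec y)) =
      b.repr x i * b.repr y j - b.repr x j * b.repr y i := by
  rw [wedge_vec_vec, minor_ιMulti]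
  rfl

theorem volume_wedge_vec (b : Basis (Fin 3) R N) (h : 1 + 2 = 3) (x : N) (t : ⋀[R]^2 N) :
    volume b (wedge h (vec x) t) = b.repr x 0 * minor b 1 2 t - b.repr x 1 * minor b 0 2 t +
      b.repr x 2 * minor b 0 1 t := by
  rw [eq_minor_smul_add b t]
  simp [wedge_vec_ιMulti]
  ring

theorem volume_wedge_vec_right (b : Basis (Fin 3) R N) (h : 2 + 1 = 3) (x : N) (t : ⋀[R]^2 N) :
    volume b (wedge h t (vec x)) = b.repr x 0 * minor b 1 2 t - b.repr x 1 * minor b 0 2 t +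
      b.repr x 2 * minor b 0 1 t := by
  rw [eq_minor_smul_add b t]
  simp [wedge_ιMulti_vec]
  ring

theorem vec_unvec (t : ⋀[R]^1 N) : vec (unvec t) = t := by
  rw [unvec, vec, LinearEquiv.coe_coe, LinearEquiv.coe_coe, LinearEquiv.symm_apply_apply]

variable {B : M →ₗ[R] Dual R N}

section Two

variable {a : Basis (Fin 2) R M} {b : Basis (Fin 2) R N}
  (hB : ∀ m n, B m n = ∑ i, a.repr m i * b.repr n i)
include hB

/-- Formulated for any pairing that is standard in the bases `a` and `b`, so that it serves both for
`⋀N*` acting on `⋀N` and for `⋀N` acting on `⋀N*`. -/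
theorem repr_contract_vec_zero (h : 1 + 1 = 2) (m : M) (t : ⋀[R]^2 N) :
    b.repr (unvec (contract B h (vec m) t)) 0 = -(a.repr m 1 * minor b 0 1 t) := by
  rw [eq_minor_smul b t]
  simp [contract_vec_two, hB, Fin.sum_univ_two]
  ring

theorem repr_contract_vec_one (h : 1 + 1 = 2) (m : M) (t : ⋀[R]^2 N) :
    b.repr (unvec (contract B h (vec m) t)) 1 = a.repr m 0 * minor b 0 1 t := by
  rw [eq_minor_smul b t]
  simp [contract_vec_two, hB, Fin.sum_univ_two]
  ring

theorem scal_contract_two (h : 2 + 0 = 2) (x : ⋀[R]^2 M) (t : ⋀[R]^2 N) :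
    scal (contract B h x t) = -(minor a 0 1 x * minor b 0 1 t) := by
  rw [eq_minor_smul b t, eq_minor_smul a x]
  simp [contract_two_two, hB, Fin.sum_univ_two]
  ring

end Two

section Three

variable {a : Basis (Fin 3) R M} {b : Basis (Fin 3) R N}
  (hB : ∀ m n, B m n = ∑ i, a.repr m i * b.repr n i)
include hB

theorem repr_contract_vec_three_zero (h : 1 + 1 = 2) (m : M) (t : ⋀[R]^2 N) :
    b.repr (unvec (contract B h (vec m) t)) 0 =
      -(a.repr m 1 * minor b 0 1 t) - a.repr m 2 * minor b 0 2 t := by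
  rw [eq_minor_smul_add b t]
  simp [contract_vec_two, hB, Fin.sum_univ_three]
  ring

theorem repr_contract_vec_three_one (h : 1 + 1 = 2) (m : M) (t : ⋀[R]^2 N) :
    b.repr (unvec (contract B h (vec m) t)) 1 =
      a.repr m 0 * minor b 0 1 t - a.repr m 2 * minor b 1 2 t := by
  rw [eq_minor_smul_add b t]
  simp [contract_vec_two, hB, Fin.sum_univ_three]
  ring

theorem repr_contract_vec_three_two (h : 1 + 1 = 2) (m : M) (t : ⋀[R]^2 N) :
    b.repr (unvec (contract B h (vec m) t)) 2 =
      a.repr m 0 * minor b 0 2 t + a.repr m 1 * minor b 1 2 t := by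
  rw [eq_minor_smul_add b t]
  simp [contract_vec_two, hB, Fin.sum_univ_three]
  ring

theorem minor_contract_vec (h : 1 + 2 = 3) (m : M) (t : ⋀[R]^3 N) :
    minor b 0 1 (contract B h (vec m) t) = a.repr m 2 * volume b t ∧
      minor b 0 2 (contract B h (vec m) t) = -(a.repr m 1 * volume b t) ∧
      minor b 1 2 (contract B h (vec m) t) = a.repr m 0 * volume b t := by
  rw [eq_volume_smul b t]
  refine ⟨?_, ?_, ?_⟩ <;> simp [contract_vec_three, hB, Fin.sum_univ_three, mul_comm]

theorem repr_contract_two (h : 2 + 1 = 3) (x : ⋀[R]^2 M) (t : ⋀[R]^3 N) :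
    b.repr (unvec (contract B h x t)) 0 = -(minor a 1 2 x * volume b t) ∧
      b.repr (unvec (contract B h x t)) 1 = minor a 0 2 x * volume b t ∧
      b.repr (unvec (contract B h x t)) 2 = -(minor a 0 1 x * volume b t) := by
  rw [eq_minor_smul_add a x]
  simp only [map_add, map_smul, LinearMap.add_apply, LinearMap.smul_apply, contract_two_three,
    Finsupp.add_apply, Finsupp.smul_apply, repr_contract_vec_three_zero hB,
    repr_contract_vec_three_one hB, repr_contract_vec_three_two hB, minor_contract_vec hB]
  refine ⟨?_, ?_, ?_⟩ <;> simp

theorem scal_contract_three (h : 3 + 0 = 3) (x : ⋀[R]^3 M) (t : ⋀[R]^3 N) :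
    scal (contract B h x t) = -(volume a x * volume b t) := by
  rw [eq_volume_smul b t, eq_volume_smul a x]
  simp [contract_three_three, contract_vec_three, contract_two_two, hB, Fin.sum_univ_three]
  ring

end Three

theorem minor_map_two {ι : Type*} (b : Basis ι R N) (a : Basis (Fin 2) R M) (f : M →ₗ[R] N)
    (i j : ι) (t : ⋀[R]^2 M) : minor b i j (exteriorPower.map 2 f t) = minor a 0 1 t *
      (b.repr (f (a 0)) i * b.repr (f (a 1)) j - b.repr (f (a 0)) j * b.repr (f (a 1)) i) := by
  rw [eq_minor_smul a t]
  simp [exteriorPower.map_apply_ιMulti]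

theorem minor_map_three {ι : Type*} (b : Basis ι R N) (a : Basis (Fin 3) R M) (f : M →ₗ[R] N)
    (i j : ι) (t : ⋀[R]^2 M) : minor b i j (exteriorPower.map 2 f t) =
      minor a 0 1 t *
        (b.repr (f (a 0)) i * b.repr (f (a 1)) j - b.repr (f (a 0)) j * b.repr (f (a 1)) i) +
      minor a 0 2 t *
        (b.repr (f (a 0)) i * b.repr (f (a 2)) j - b.repr (f (a 0)) j * b.repr (f (a 2)) i) +
      minor a 1 2 t *
        (b.repr (f (a 1)) i * b.repr (f (a 2)) j - b.repr (f (a 1)) j * b.repr (f (a 2)) i) := by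
  rw [eq_minor_smul_add a t]
  simp [exteriorPower.map_apply_ιMulti]

end Formulas

end ExteriorContraction

/-! ### The two contractions in a basis and its dual basis. -/

namespace ExteriorContraction

section DualBasis

variable {R : Type*} [CommRing R] {M : Type*} [AddCommGroup M] [Module R M]
  {ι : Type*} [Fintype ι] [DecidableEq ι] (b : Basis ι R M)

theorem apply_eq_sum_dualBasis_repr (α : Dual R M) (x : M) :
    (LinearMap.id : Dual R M →ₗ[R] Dual R M) α x = ∑ i, b.dualBasis.repr α i * b.repr x i := by
  conv_lhs => rw [← b.sum_repr x]
  simp [mul_comm, -Basis.sum_repr]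

theorem eval_eq_sum_dualBasis_repr (x : M) (α : Dual R M) :
    Dual.eval R M x α = ∑ i, b.repr x i * b.dualBasis.repr α i := by
  rw [Dual.eval_apply]
  exact (apply_eq_sum_dualBasis_repr b α x).trans (Finset.sum_congr rfl fun i _ => mul_comm _ _)

end DualBasis

variable {R : Type*} [CommRing R] {M : Type*} [AddCommGroup M] [Module R M]

section Two

variable (b : Basis (Fin 2) R M)

theorem repr_onVec_vec_zero (h : 1 + 1 = 2) (α : Dual R M) (t : ⋀[R]^2 M) :
    b.repr (unvec (onVec h (vec α) t)) 0 = -(α (b 1) * minor b 0 1 t) := by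
  rw [onVec, repr_contract_vec_zero (apply_eq_sum_dualBasis_repr b), Basis.dualBasis_repr]

theorem repr_onVec_vec_one (h : 1 + 1 = 2) (α : Dual R M) (t : ⋀[R]^2 M) :
    b.repr (unvec (onVec h (vec α) t)) 1 = α (b 0) * minor b 0 1 t := by
  rw [onVec, repr_contract_vec_one (apply_eq_sum_dualBasis_repr b), Basis.dualBasis_repr]

theorem onDual_vec_apply_zero (h : 1 + 1 = 2) (x : M) (t : ⋀[R]^2 (Dual R M)) :
    unvec (onDual h (vec x) t) (b 0) = -(b.repr x 1 * minor b.dualBasis 0 1 t) := by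
  rw [onDual, ← repr_contract_vec_zero (eval_eq_sum_dualBasis_repr b) h, Basis.dualBasis_repr]

theorem onDual_vec_apply_one (h : 1 + 1 = 2) (x : M) (t : ⋀[R]^2 (Dual R M)) :
    unvec (onDual h (vec x) t) (b 1) = b.repr x 0 * minor b.dualBasis 0 1 t := by
  rw [onDual, ← repr_contract_vec_one (eval_eq_sum_dualBasis_repr b) h, Basis.dualBasis_repr]

theorem scal_onDual_two (h : 2 + 0 = 2) (x : ⋀[R]^2 M) (t : ⋀[R]^2 (Dual R M)) :
    scal (onDual h x t) = -(minor b 0 1 x * minor b.dualBasis 0 1 t) :=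
  scal_contract_two (eval_eq_sum_dualBasis_repr b) h x t

/-- The second exterior power of a module of rank two. -/
noncomputable def minorEquiv : (⋀[R]^2 M) ≃ₗ[R] R :=
  { minor b 0 1 with
    invFun := fun r => r • exteriorPower.ιMulti R 2 ![b 0, b 1]
    left_inv := fun x => (eq_minor_smul b x).symm
    right_inv := fun r => by simp }

@[simp]
theorem minorEquiv_apply (x : ⋀[R]^2 M) : minorEquiv b x = minor b 0 1 x :=
  rfl

end Two

section Three

variable (b : Basis (Fin 3) R M)

theorem repr_onVec_two (h : 2 + 1 = 3) (x : ⋀[R]^2 (Dual R M)) (t : ⋀[R]^3 M) :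
    b.repr (unvec (onVec h x t)) 0 = -(minor b.dualBasis 1 2 x * volume b t) ∧
      b.repr (unvec (onVec h x t)) 1 = minor b.dualBasis 0 2 x * volume b t ∧
      b.repr (unvec (onVec h x t)) 2 = -(minor b.dualBasis 0 1 x * volume b t) :=
  repr_contract_two (apply_eq_sum_dualBasis_repr b) h x t

theorem minor_onVec_vec (h : 1 + 2 = 3) (α : Dual R M) (t : ⋀[R]^3 M) :
    minor b 0 1 (onVec h (vec α) t) = α (b 2) * volume b t ∧
      minor b 0 2 (onVec h (vec α) t) = -(α (b 1) * volume b t) ∧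
      minor b 1 2 (onVec h (vec α) t) = α (b 0) * volume b t := by
  have := minor_contract_vec (apply_eq_sum_dualBasis_repr b) h α t
  simp only [Basis.dualBasis_repr] at this
  exact this

theorem repr_onVec_vec (h : 1 + 1 = 2) (α : Dual R M) (t : ⋀[R]^2 M) :
    b.repr (unvec (onVec h (vec α) t)) 0 = -(α (b 1) * minor b 0 1 t) - α (b 2) * minor b 0 2 t ∧
      b.repr (unvec (onVec h (vec α) t)) 1 = α (b 0) * minor b 0 1 t - α (b 2) * minor b 1 2 t ∧
      b.repr (unvec (onVec h (vec α) t)) 2 = α (b 0) * minor b 0 2 t + α (b 1) * minor b 1 2 t := by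
  have h₀ := repr_contract_vec_three_zero (apply_eq_sum_dualBasis_repr b) h α t
  have h₁ := repr_contract_vec_three_one (apply_eq_sum_dualBasis_repr b) h α t
  have h₂ := repr_contract_vec_three_two (apply_eq_sum_dualBasis_repr b) h α t
  simp only [Basis.dualBasis_repr] at h₀ h₁ h₂
  exact ⟨h₀, h₁, h₂⟩

theorem onDual_vec_apply (h : 1 + 1 = 2) (x : M) (t : ⋀[R]^2 (Dual R M)) :
    unvec (onDual h (vec x) t) (b 0) =
        -(b.repr x 1 * minor b.dualBasis 0 1 t) - b.repr x 2 * minor b.dualBasis 0 2 t ∧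
      unvec (onDual h (vec x) t) (b 1) =
        b.repr x 0 * minor b.dualBasis 0 1 t - b.repr x 2 * minor b.dualBasis 1 2 t ∧
      unvec (onDual h (vec x) t) (b 2) =
        b.repr x 0 * minor b.dualBasis 0 2 t + b.repr x 1 * minor b.dualBasis 1 2 t := by
  have h₀ := repr_contract_vec_three_zero (eval_eq_sum_dualBasis_repr b) h x t
  have h₁ := repr_contract_vec_three_one (eval_eq_sum_dualBasis_repr b) h x t
  have h₂ := repr_contract_vec_three_two (eval_eq_sum_dualBasis_repr b) h x t
  simp only [Basis.dualBasis_repr] at h₀ h₁ h₂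
  exact ⟨h₀, h₁, h₂⟩

theorem volume_wedge_onVec (h : 2 + 1 = 3) (y : ⋀[R]^2 M) (x : ⋀[R]^2 (Dual R M)) (t : ⋀[R]^3 M) :
    volume b (wedge h y (onVec (k := 1) h x t)) =
      -((minor b.dualBasis 1 2 x * minor b 1 2 y + minor b.dualBasis 0 2 x * minor b 0 2 y +
        minor b.dualBasis 0 1 x * minor b 0 1 y) * volume b t) := by
  rw [← vec_unvec (onVec h x t), volume_wedge_vec_right, (repr_onVec_two b h x t).1,
    (repr_onVec_two b h x t).2.1, (repr_onVec_two b h x t).2.2]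
  ring

theorem scal_onVec_three (h : 3 + 0 = 3) (x : ⋀[R]^3 (Dual R M)) (t : ⋀[R]^3 M) :
    scal (onVec h x t) = -(volume b.dualBasis x * volume b t) :=
  scal_contract_three (apply_eq_sum_dualBasis_repr b) h x t

/-- The third exterior power of a module of rank three. -/
noncomputable def volumeEquiv : (⋀[R]^3 M) ≃ₗ[R] R :=
  { volume b with
    invFun := fun r => r • exteriorPower.ιMulti R 3 ![b 0, b 1, b 2]
    left_inv := fun x => (eq_volume_smul b x).symm
    right_inv := fun r => by simp }

@[simp]
theorem volumeEquiv_apply (x : ⋀[R]^3 M) : volumeEquiv b x = volume b x :=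
  rfl

/-- The second exterior power of a module of rank three. -/
noncomputable def minorsEquiv : (⋀[R]^2 M) ≃ₗ[R] (Fin 3 → R) :=
  { LinearMap.pi ![minor b 0 1, minor b 0 2, minor b 1 2] with
    invFun := fun r => r 0 • exteriorPower.ιMulti R 2 ![b 0, b 1] +
      r 1 • exteriorPower.ιMulti R 2 ![b 0, b 2] + r 2 • exteriorPower.ιMulti R 2 ![b 1, b 2]
    left_inv := fun x => (eq_minor_smul_add b x).symm
    right_inv := fun r => by
      ext i
      fin_cases i <;> simp }

@[simp]
theorem minorsEquiv_apply (x : ⋀[R]^2 M) :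
    minorsEquiv b x = ![minor b 0 1 x, minor b 0 2 x, minor b 1 2 x] := by
  ext i
  fin_cases i <;> rfl

end Three

end ExteriorContraction

/-! Coordinates on a product of free modules. -/

section Glue

variable (R : Type*) [CommRing R]

def glueOneOne : (R × R) ≃ₗ[R] (Fin 2 → R) where
  toFun x := ![x.1, x.2]
  map_add' x y := by ext i; fin_cases i <;> rfl
  map_smul' r x := by ext i; fin_cases i <;> rfl
  invFun v := (v 0, v 1)
  left_inv x := rfl
  right_inv v := by ext i; fin_cases i <;> rfl

def glueTwoThree : ((Fin 2 → R) × (Fin 3 → R)) ≃ₗ[R] (Fin 5 → R) where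
  toFun x := ![x.1 0, x.1 1, x.2 0, x.2 1, x.2 2]
  map_add' x y := by ext i; fin_cases i <;> rfl
  map_smul' r x := by ext i; fin_cases i <;> rfl
  invFun v := (![v 0, v 1], ![v 2, v 3, v 4])
  left_inv x := by ext i <;> fin_cases i <;> rfl
  right_inv v := by ext i; fin_cases i <;> rfl

def glueOneTwoThree : (R × (Fin 2 → R) × (Fin 3 → R)) ≃ₗ[R] (Fin 6 → R) where
  toFun x := ![x.1, x.2.1 0, x.2.1 1, x.2.2 0, x.2.2 1, x.2.2 2]
  map_add' x y := by ext i; fin_cases i <;> rfl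
  map_smul' r x := by ext i; fin_cases i <;> rfl
  invFun v := (v 0, ![v 1, v 2], ![v 3, v 4, v 5])
  left_inv x := by
    refine Prod.ext rfl (Prod.ext ?_ ?_) <;> ext i <;> fin_cases i <;> rfl
  right_inv v := by ext i; fin_cases i <;> rfl

def glueOneOneThree : (R × R × (Fin 3 → R)) ≃ₗ[R] (Fin 5 → R) where
  toFun x := ![x.1, x.2.1, x.2.2 0, x.2.2 1, x.2.2 2]
  map_add' x y := by ext i; fin_cases i <;> rfl
  map_smul' r x := by ext i; fin_cases i <;> rfl
  invFun v := (v 0, v 1, ![v 2, v 3, v 4])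
  left_inv x := by
    refine Prod.ext rfl (Prod.ext rfl ?_); ext i; fin_cases i <;> rfl
  right_inv v := by ext i; fin_cases i <;> rfl

end Glue

/-! ### Coordinates of the data and of the terms of the complexes. -/

namespace BrownData

open ExteriorContraction

variable {R : Type u} [CommRing R] {F : Type v} {G : Type w}
  [AddCommGroup F] [Module R F] [AddCommGroup G] [Module R G] (D : BrownData R F G)

/-- The coordinate of an element of `⋀²G ⊗ ⋀³F*`. -/
noncomputable def tensorEquiv : ((⋀[R]^2 G) ⊗[R] (⋀[R]^3 (Dual R F))) ≃ₗ[R] R :=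
  TensorProduct.congr (minorEquiv D.β) (volumeEquiv D.e.dualBasis) ≪≫ₗ TensorProduct.lid R R ≪≫ₗ
    LinearEquiv.neg R

@[simp]
theorem tensorEquiv_tmul (x : ⋀[R]^2 G) (y : ⋀[R]^3 (Dual R F)) :
    D.tensorEquiv (x ⊗ₜ y) = -(minor D.β 0 1 x * volume D.e.dualBasis y) :=
  rfl

/-- The coordinate of an element of `⋀²G* ⊗ ⋀³F`. -/
noncomputable def tensorEquiv' : ((⋀[R]^2 (Dual R G)) ⊗[R] (⋀[R]^3 F)) ≃ₗ[R] R :=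
  TensorProduct.congr (minorEquiv D.β.dualBasis) (volumeEquiv D.e) ≪≫ₗ TensorProduct.lid R R ≪≫ₗ
    LinearEquiv.neg R

@[simp]
theorem tensorEquiv'_tmul (x : ⋀[R]^2 (Dual R G)) (y : ⋀[R]^3 F) :
    D.tensorEquiv' (x ⊗ₜ y) = -(minor D.β.dualBasis 0 1 x * volume D.e y) :=
  rfl

theorem volume_χF : volume D.e D.χF = 1 := by
  simp [χF]

theorem volume_χF' : volume D.e.dualBasis D.χF' = -1 := by
  simp [χF']

theorem minor_χG : minor D.β 0 1 D.χG = 1 := by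
  simp [χG]

theorem minor_χG' : minor D.β.dualBasis 0 1 D.χG' = -1 := by
  simp [χG']

theorem tensorEquiv_χ : D.tensorEquiv (D.χG ⊗ₜ D.χF') = 1 := by
  rw [tensorEquiv_tmul, minor_χG, volume_χF', mul_neg, mul_one, neg_neg]

variable (ℓ : Dual R F →ₗ[R] G)

/-- The coordinates of the data in the bases `e` and `β`. -/
noncomputable def coef : LinkCoef R where
  a₁ := D.β.repr (D.φ (D.e 0)) 0
  a₂ := D.β.repr (D.φ (D.e 1)) 0
  a₃ := D.β.repr (D.φ (D.e 2)) 0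
  b₁ := D.β.repr (D.φ (D.e 0)) 1
  b₂ := D.β.repr (D.φ (D.e 1)) 1
  b₃ := D.β.repr (D.φ (D.e 2)) 1
  l₁ := D.β.repr (ℓ (D.e.coord 0)) 0
  l₂ := D.β.repr (ℓ (D.e.coord 1)) 0
  l₃ := D.β.repr (ℓ (D.e.coord 2)) 0
  m₁ := D.β.repr (ℓ (D.e.coord 0)) 1
  m₂ := D.β.repr (ℓ (D.e.coord 1)) 1
  m₃ := D.β.repr (ℓ (D.e.coord 2)) 1
  s₁ := minor D.e.dualBasis 0 1 D.ψ
  s₂ := minor D.e.dualBasis 0 2 D.ψ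
  s₃ := minor D.e.dualBasis 1 2 D.ψ
  z₁ := minor D.β 0 1 D.ζ
  z₂ := D.z₂
  p := D.p (D.χG ⊗ₜ D.χF')

/-- The source of `p` is free on `χG ⊗ χF'`, so `p` is determined by its value there. -/
theorem p_apply (t : (⋀[R]^2 G) ⊗[R] (⋀[R]^3 (Dual R F))) :
    D.p t = (D.coef ℓ).p * D.tensorEquiv t := by
  have : t = D.tensorEquiv t • (D.χG ⊗ₜ D.χF') := D.tensorEquiv.injective (by
    rw [map_smul, tensorEquiv_χ, smul_eq_mul, mul_one])
  conv_lhs => rw [this, map_smul, smul_eq_mul, mul_comm]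
  rfl

theorem repr_φ (f : F) :
    D.β.repr (D.φ f) 0 = D.e.repr f 0 * (D.coef ℓ).a₁ + D.e.repr f 1 * (D.coef ℓ).a₂ +
      D.e.repr f 2 * (D.coef ℓ).a₃ ∧
    D.β.repr (D.φ f) 1 = D.e.repr f 0 * (D.coef ℓ).b₁ + D.e.repr f 1 * (D.coef ℓ).b₂ +
      D.e.repr f 2 * (D.coef ℓ).b₃ := by
  constructor <;>
  · conv_lhs => rw [← D.e.sum_repr f, Fin.sum_univ_three]
    simp only [map_add, map_smul, Finsupp.add_apply, Finsupp.smul_apply, smul_eq_mul, coef]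

theorem repr_ℓ (α : Dual R F) :
    D.β.repr (ℓ α) 0 = α (D.e 0) * (D.coef ℓ).l₁ + α (D.e 1) * (D.coef ℓ).l₂ +
      α (D.e 2) * (D.coef ℓ).l₃ ∧
    D.β.repr (ℓ α) 1 = α (D.e 0) * (D.coef ℓ).m₁ + α (D.e 1) * (D.coef ℓ).m₂ +
      α (D.e 2) * (D.coef ℓ).m₃ := by
  constructor <;>
  · conv_lhs => rw [← D.e.dualBasis.sum_repr α, Fin.sum_univ_three]
    simp only [map_add, map_smul, Finsupp.add_apply, Finsupp.smul_apply, smul_eq_mul, coef,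
      Basis.dualBasis_repr, Basis.coe_dualBasis]

theorem dual_apply (γ : Dual R G) (x : G) :
    γ x = D.β.repr x 0 * γ (D.β 0) + D.β.repr x 1 * γ (D.β 1) := by
  conv_lhs => rw [← D.β.sum_repr x, Fin.sum_univ_two]
  simp only [map_add, map_smul, smul_eq_mul]

theorem φ'_apply (γ : Dual R G) :
    D.φ' γ (D.e 0) = (D.coef ℓ).a₁ * γ (D.β 0) + (D.coef ℓ).b₁ * γ (D.β 1) ∧
    D.φ' γ (D.e 1) = (D.coef ℓ).a₂ * γ (D.β 0) + (D.coef ℓ).b₂ * γ (D.β 1) ∧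
    D.φ' γ (D.e 2) = (D.coef ℓ).a₃ * γ (D.β 0) + (D.coef ℓ).b₃ * γ (D.β 1) :=
  ⟨D.dual_apply _ _, D.dual_apply _ _, D.dual_apply _ _⟩

theorem repr_ℓ' (γ : Dual R G) :
    D.e.repr (D.ℓ' ℓ γ) 0 = (D.coef ℓ).l₁ * γ (D.β 0) + (D.coef ℓ).m₁ * γ (D.β 1) ∧
    D.e.repr (D.ℓ' ℓ γ) 1 = (D.coef ℓ).l₂ * γ (D.β 0) + (D.coef ℓ).m₂ * γ (D.β 1) ∧
    D.e.repr (D.ℓ' ℓ γ) 2 = (D.coef ℓ).l₃ * γ (D.β 0) + (D.coef ℓ).m₃ * γ (D.β 1) := by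
  have h : ∀ i, D.e.repr (D.ℓ' ℓ γ) i = γ (ℓ (D.e.coord i)) := fun i => by
    rw [ℓ', LinearMap.comp_apply, ← Basis.equivFun_apply, LinearEquiv.coe_coe,
      LinearEquiv.apply_symm_apply]
    rfl
  rw [h, h, h]
  exact ⟨D.dual_apply _ _, D.dual_apply _ _, D.dual_apply _ _⟩

theorem repr_ψOn (t : ⋀[R]^3 F) : D.e.repr (D.ψOn t) 0 = -((D.coef ℓ).s₃ * volume D.e t) ∧
    D.e.repr (D.ψOn t) 1 = (D.coef ℓ).s₂ * volume D.e t ∧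
    D.e.repr (D.ψOn t) 2 = -((D.coef ℓ).s₁ * volume D.e t) :=
  repr_onVec_two D.e _ D.ψ t

theorem minor_ψ : minor D.e.dualBasis 0 1 D.ψ = (D.coef ℓ).s₁ ∧
    minor D.e.dualBasis 0 2 D.ψ = (D.coef ℓ).s₂ ∧ minor D.e.dualBasis 1 2 D.ψ = (D.coef ℓ).s₃ :=
  ⟨rfl, rfl, rfl⟩

theorem minor_ζ : minor D.β 0 1 D.ζ = (D.coef ℓ).z₁ :=
  rfl

theorem z₂_eq_coef : D.z₂ = (D.coef ℓ).z₂ :=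
  rfl

theorem minor_σ : minor D.β 0 1 (D.σ ℓ) = (D.coef ℓ).sg := by
  simp only [σ, Fin.sum_univ_three, map_add, minor_wedge, LinkCoef.sg, coef]

theorem minor_map_φ' (t : ⋀[R]^2 (Dual R G)) :
    minor D.e.dualBasis 0 1 (exteriorPower.map 2 D.φ' t) =
      minor D.β.dualBasis 0 1 t * (D.coef ℓ).d₃ ∧
    minor D.e.dualBasis 0 2 (exteriorPower.map 2 D.φ' t) =
      -(minor D.β.dualBasis 0 1 t * (D.coef ℓ).d₂) ∧
    minor D.e.dualBasis 1 2 (exteriorPower.map 2 D.φ' t) =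
      minor D.β.dualBasis 0 1 t * (D.coef ℓ).d₁ := by
  refine ⟨?_, ?_, ?_⟩ <;>
  · rw [minor_map_two _ D.β.dualBasis]
    simp only [Basis.dualBasis_repr, D.φ'_apply ℓ, LinkCoef.d₁, LinkCoef.d₂, LinkCoef.d₃]
    simp
    try ring

theorem minor_map_ℓ (t : ⋀[R]^2 (Dual R F)) : minor D.β 0 1 (exteriorPower.map 2 ℓ t) =
    minor D.e.dualBasis 0 1 t * (D.coef ℓ).n₁₂ + minor D.e.dualBasis 0 2 t * (D.coef ℓ).n₁₃ +
      minor D.e.dualBasis 1 2 t * (D.coef ℓ).n₂₃ := by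
  rw [minor_map_three _ D.e.dualBasis]
  simp only [D.repr_ℓ ℓ, LinkCoef.n₁₂, LinkCoef.n₁₃, LinkCoef.n₂₃]
  simp
  ring

theorem minor_map_ℓ' (t : ⋀[R]^2 (Dual R G)) :
    minor D.e 0 1 (exteriorPower.map 2 (D.ℓ' ℓ) t) = minor D.β.dualBasis 0 1 t * (D.coef ℓ).n₁₂ ∧
    minor D.e 0 2 (exteriorPower.map 2 (D.ℓ' ℓ) t) = minor D.β.dualBasis 0 1 t * (D.coef ℓ).n₁₃ ∧
    minor D.e 1 2 (exteriorPower.map 2 (D.ℓ' ℓ) t) =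
      minor D.β.dualBasis 0 1 t * (D.coef ℓ).n₂₃ := by
  refine ⟨?_, ?_, ?_⟩ <;>
  · rw [minor_map_two _ D.β.dualBasis]
    simp only [D.repr_ℓ' ℓ, LinkCoef.n₁₂, LinkCoef.n₁₃, LinkCoef.n₂₃]
    simp

theorem minor_map_φ (t : ⋀[R]^2 F) : minor D.β 0 1 (exteriorPower.map 2 D.φ t) =
    minor D.e 0 1 t * (D.coef ℓ).d₃ - minor D.e 0 2 t * (D.coef ℓ).d₂ +
      minor D.e 1 2 t * (D.coef ℓ).d₁ := by
  rw [minor_map_three _ D.e]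
  simp only [D.repr_φ ℓ, LinkCoef.d₁, LinkCoef.d₂, LinkCoef.d₃]
  simp
  ring

noncomputable def equivB₃ : B₃ R F G ≃ₗ[R] (Fin 2 → R) :=
  D.tensorEquiv'.prodCongr (volumeEquiv D.e) ≪≫ₗ glueOneOne R

noncomputable def equivB₂ : B₂ R F G ≃ₗ[R] (Fin 6 → R) :=
  (volumeEquiv D.e).prodCongr (D.β.dualBasis.equivFun.prodCongr D.e.equivFun) ≪≫ₗ glueOneTwoThree R

noncomputable def equivB₁ : B₁ R F G ≃ₗ[R] (Fin 5 → R) :=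
  D.β.equivFun.prodCongr D.e.dualBasis.equivFun ≪≫ₗ glueTwoThree R

noncomputable def equivB₀ : B₀ R F G ≃ₗ[R] (Fin 1 → R) :=
  D.tensorEquiv ≪≫ₗ (LinearEquiv.funUnique (Fin 1) R R).symm

/-- The sign makes `χF'` the basis element with coordinate `1`, since its volume in the dual basis
is `-1`. The coordinates on the summands `⋀³F*` of `Q` carry the same sign. -/
noncomputable def equivK₃ : (⋀[R]^3 (Dual R F)) ≃ₗ[R] (Fin 1 → R) :=
  volumeEquiv D.e.dualBasis ≪≫ₗ LinearEquiv.neg R ≪≫ₗ (LinearEquiv.funUnique (Fin 1) R R).symm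

noncomputable def equivQ₂ : Q₂ R F G ≃ₗ[R] (Fin 6 → R) :=
  (volumeEquiv D.e.dualBasis ≪≫ₗ LinearEquiv.neg R).prodCongr
    (D.β.equivFun.prodCongr D.e.dualBasis.equivFun) ≪≫ₗ glueOneTwoThree R

noncomputable def equivQ₁ : Q₁ R F G ≃ₗ[R] (Fin 5 → R) :=
  D.tensorEquiv.prodCongr ((volumeEquiv D.e.dualBasis ≪≫ₗ LinearEquiv.neg R).prodCongr
    (minorsEquiv D.e)) ≪≫ₗ glueOneOneThree R

noncomputable def equivQ₀ : Q₀ R F ≃ₗ[R] (Fin 1 → R) :=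
  volumeEquiv D.e ≪≫ₗ (LinearEquiv.funUnique (Fin 1) R R).symm

theorem equivB₃_apply (x : B₃ R F G) :
    D.equivB₃ x = ![D.tensorEquiv' x.1, volume D.e x.2] :=
  rfl

theorem equivB₂_apply (x : B₂ R F G) :
    D.equivB₂ x = ![volume D.e x.1, x.2.1 (D.β 0), x.2.1 (D.β 1), D.e.repr x.2.2 0,
      D.e.repr x.2.2 1, D.e.repr x.2.2 2] := by
  ext i
  fin_cases i <;> simp [equivB₂, glueOneTwoThree]

theorem equivB₁_apply (x : B₁ R F G) :
    D.equivB₁ x = ![D.β.repr x.1 0, D.β.repr x.1 1, x.2 (D.e 0), x.2 (D.e 1), x.2 (D.e 2)] := by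
  ext i
  fin_cases i <;> simp [equivB₁, glueTwoThree]

theorem equivB₀_apply (t : B₀ R F G) : D.equivB₀ t = ![D.tensorEquiv t] := by
  ext i
  fin_cases i
  rfl

theorem equivK₃_apply (t : ⋀[R]^3 (Dual R F)) : D.equivK₃ t = ![-volume D.e.dualBasis t] := by
  ext i
  fin_cases i
  rfl

theorem equivQ₂_apply (x : Q₂ R F G) :
    D.equivQ₂ x = ![-volume D.e.dualBasis x.1, D.β.repr x.2.1 0, D.β.repr x.2.1 1,
      x.2.2 (D.e 0), x.2.2 (D.e 1), x.2.2 (D.e 2)] := by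
  ext i
  fin_cases i <;> simp [equivQ₂, glueOneTwoThree]

theorem equivQ₁_apply (x : Q₁ R F G) :
    D.equivQ₁ x = ![D.tensorEquiv x.1, -volume D.e.dualBasis x.2.1, minor D.e 0 1 x.2.2,
      minor D.e 0 2 x.2.2, minor D.e 1 2 x.2.2] := by
  ext i
  fin_cases i <;> simp [equivQ₁, glueOneOneThree]

theorem equivQ₀_apply (t : Q₀ R F) : D.equivQ₀ t = ![volume D.e t] := by
  ext i
  fin_cases i
  rfl

end BrownData

/-! ### Matrices of the intrinsically defined maps. -/

namespace BrownData

open ExteriorContraction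

variable {R : Type u} [CommRing R] {F : Type v} {G : Type w}
  [AddCommGroup F] [Module R F] [AddCommGroup G] [Module R G] (D : BrownData R F G)
  (ℓ : Dual R F →ₗ[R] G)

theorem equivB₁_b₂ (x : B₂ R F G) : D.equivB₁ (D.b₂ x) = (D.coef ℓ).B₂.mulVec (D.equivB₂ x) := by
  rw [equivB₁_apply, equivB₂_apply]
  ext i
  fin_cases i
  all_goals
    simp [b₂, LinkCoef.B₂, Matrix.mulVec, dotProduct, Fin.sum_univ_succ, D.repr_φ ℓ,
      repr_onVec_vec_zero, repr_onVec_vec_one, D.repr_ψOn ℓ, D.minor_ζ ℓ, D.minor_ψ ℓ,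
      D.z₂_eq_coef ℓ, D.φ'_apply ℓ, onDual_vec_apply, LinkCoef.w₁, LinkCoef.w₂]
    ring

theorem tensorEquiv_b₁ (x : B₁ R F G) :
    D.tensorEquiv (D.b₁ x) = (D.coef ℓ).B₁.mulVec (D.equivB₁ x) 0 := by
  rw [equivB₁_apply]
  simp [b₁, LinkCoef.B₁, Matrix.mulVec, dotProduct, Fin.sum_univ_succ, D.repr_φ ℓ, minor_wedge,
    volume_wedge_vec, D.minor_map_φ' ℓ, D.repr_ψOn ℓ, D.minor_ζ ℓ, D.minor_ψ ℓ, D.z₂_eq_coef ℓ,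
    volume_χF, volume_χF', minor_χG, minor_χG', LinkCoef.w₁, LinkCoef.w₂, LinkCoef.h₁,
    LinkCoef.h₂, LinkCoef.h₃]
  ring

theorem equivB₀_b₁ (x : B₁ R F G) : D.equivB₀ (D.b₁ x) = (D.coef ℓ).B₁.mulVec (D.equivB₁ x) := by
  rw [equivB₀_apply, D.tensorEquiv_b₁ ℓ]
  ext i
  fin_cases i
  rfl

theorem eq_tensorEquiv'_smul (t : (⋀[R]^2 (Dual R G)) ⊗[R] (⋀[R]^3 F)) :
    t = D.tensorEquiv' t • (D.χG' ⊗ₜ D.χF) :=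
  D.tensorEquiv'.injective (by
    rw [map_smul, tensorEquiv'_tmul, minor_χG', volume_χF, mul_one, neg_neg, smul_eq_mul, mul_one])

theorem equivB₂_b₃ (x : B₃ R F G) : D.equivB₂ (D.b₃ x) = (D.coef ℓ).B₃.mulVec (D.equivB₃ x) := by
  -- The tensor summand is free on `χG' ⊗ χF`, so `b₃Left` need only be evaluated at that one pure
  -- tensor.
  have key : D.b₃ x = D.tensorEquiv' x.1 • D.b₃Left (D.χG' ⊗ₜ D.χF) + D.b₃Right x.2 := by
    rw [← map_smul, ← eq_tensorEquiv'_smul]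
    rfl
  rw [key, map_add, map_smul, equivB₂_apply, equivB₂_apply, equivB₃_apply]
  ext i
  fin_cases i
  all_goals
    simp [b₃Left, b₃Right, LinkCoef.B₃, Matrix.mulVec, dotProduct, Fin.sum_univ_succ,
      scal_onDual_two D.β, D.minor_ζ ℓ, minor_χG', volume_χF, D.z₂_eq_coef ℓ, D.repr_φ ℓ,
      D.repr_ψOn ℓ, onDual_vec_apply_zero, onDual_vec_apply_one, repr_onVec_two, D.minor_map_φ' ℓ,
      LinkCoef.w₁, LinkCoef.w₂]
    try ring

theorem equivB₁_c₁ (α : Dual R F) :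
    D.equivB₁ (c₁ ℓ α) = (D.coef ℓ).C₁.mulVec (D.e.dualBasis.equivFun α) := by
  rw [equivB₁_apply]
  ext i
  fin_cases i
  all_goals
    simp [c₁, LinkCoef.C₁, Matrix.mulVec, dotProduct, Fin.sum_univ_succ, D.repr_ℓ ℓ]
    try ring

theorem κ₁_eq_mulVec (α : Dual R F) :
    D.κ₁ ℓ α = (D.coef ℓ).K₁.mulVec (D.e.dualBasis.equivFun α) 0 := by
  rw [κ₁, LinearMap.comp_apply, LinearMap.comp_apply, LinearEquiv.coe_coe, D.p_apply ℓ,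
    D.tensorEquiv_b₁ ℓ, equivB₁_c₁, Matrix.mulVec_mulVec, ← LinkCoef.B₁_mul_C₁, Matrix.smul_mulVec]
  rfl

theorem κ₁_apply (α : Dual R F) : D.κ₁ ℓ α = (D.coef ℓ).x₁ * α (D.e 0) + (D.coef ℓ).x₂ * α (D.e 1) +
    (D.coef ℓ).x₃ * α (D.e 2) := by
  rw [κ₁_eq_mulVec]
  simp [LinkCoef.K₁, Matrix.mulVec, dotProduct, Fin.sum_univ_succ]
  ring

theorem equivFun_κ₂ (t : ⋀[R]^2 (Dual R F)) : D.e.dualBasis.equivFun (D.κ₂ ℓ t) =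
    (D.coef ℓ).K₂.mulVec (minorsEquiv D.e.dualBasis t) := by
  have h := repr_onVec_vec D.e.dualBasis (by rfl) (D.κ₁ ℓ) t
  ext i
  rw [Basis.equivFun_apply]
  change D.e.dualBasis.repr (unvec (onVec _ (vec (D.κ₁ ℓ)) t)) i = _
  fin_cases i
  · refine h.1.trans ?_
    simp [LinkCoef.K₂, Matrix.mulVec, dotProduct, Fin.sum_univ_succ, κ₁_apply]
    ring
  · refine h.2.1.trans ?_
    simp [LinkCoef.K₂, Matrix.mulVec, dotProduct, Fin.sum_univ_succ, κ₁_apply]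
    ring
  · refine h.2.2.trans ?_
    simp [LinkCoef.K₂, Matrix.mulVec, dotProduct, Fin.sum_univ_succ, κ₁_apply]

theorem minorsEquiv_κ₃ (t : ⋀[R]^3 (Dual R F)) : minorsEquiv D.e.dualBasis (D.κ₃ ℓ t) =
    (D.coef ℓ).K₃.mulVec (D.equivK₃ t) := by
  rw [minorsEquiv_apply, equivK₃_apply, κ₃]
  ext i
  fin_cases i
  all_goals
    simp [minor_onVec_vec, LinkCoef.K₃, Matrix.mulVec, dotProduct, κ₁_apply]

theorem equivB₂_c₂ (t : ⋀[R]^2 (Dual R F)) : D.equivB₂ (D.c₂ ℓ t) =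
    (D.coef ℓ).C₂.mulVec (minorsEquiv D.e.dualBasis t) := by
  rw [equivB₂_apply, minorsEquiv_apply]
  ext i
  fin_cases i
  all_goals
    simp [c₂, LinkCoef.C₂, Matrix.mulVec, dotProduct, Fin.sum_univ_succ, D.p_apply ℓ,
      scal_onDual_two D.β, minor_χG', volume_χF, minor_χG, volume_χF', D.minor_map_ℓ ℓ,
      onDual_vec_apply_zero, onDual_vec_apply_one, onDual_vec_apply, D.repr_ℓ ℓ, D.repr_φ ℓ,
      D.repr_ψOn ℓ, repr_onVec_two, D.repr_ℓ' ℓ, D.minor_σ ℓ, D.minor_ζ ℓ, D.z₂_eq_coef ℓ,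
      LinkCoef.sg]
    ring

theorem equivB₃_c₃ (t : ⋀[R]^3 (Dual R F)) : D.equivB₃ (D.c₃ ℓ t) =
    (D.coef ℓ).C₃.mulVec (D.equivK₃ t) := by
  rw [equivB₃_apply, equivK₃_apply]
  ext i
  fin_cases i
  all_goals
    simp [c₃, LinkCoef.C₃, Matrix.mulVec, dotProduct, D.p_apply ℓ,
      minor_χG', volume_χF, minor_χG, volume_χF', D.minor_map_ℓ ℓ, D.minor_map_φ ℓ,
      D.minor_map_ℓ' ℓ, LinkCoef.dt, LinkCoef.d₁, LinkCoef.d₂, LinkCoef.d₃, LinkCoef.n₁₂,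
      LinkCoef.n₁₃, LinkCoef.n₂₃,
      D.minor_σ ℓ, D.minor_ζ ℓ, D.minor_ψ ℓ, D.z₂_eq_coef ℓ, LinkCoef.j₁, LinkCoef.j₂]
    ring

theorem equivQ₂_q₃ (γ : Q₃ R G) : D.equivQ₂ (D.q₃ ℓ γ) =
    (D.coef ℓ).Q₃.mulVec (D.β.dualBasis.equivFun γ) := by
  rw [equivQ₂_apply]
  ext i
  fin_cases i
  all_goals
    simp [q₃, LinkCoef.Q₃, Matrix.mulVec, dotProduct, Fin.sum_univ_succ, volume_wedge_vec,
      D.φ'_apply ℓ, D.minor_ψ ℓ, D.repr_φ ℓ, D.repr_ℓ' ℓ, repr_onVec_vec_zero, repr_onVec_vec_one,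
      onDual_vec_apply, D.minor_ζ ℓ, D.z₂_eq_coef ℓ, LinkCoef.w₁, LinkCoef.w₂]
    ring

set_option maxHeartbeats 1600000 in
theorem equivQ₁_q₂ (x : Q₂ R F G) : D.equivQ₁ (D.q₂ ℓ x) =
    (D.coef ℓ).Q₂.mulVec (D.equivQ₂ x) := by
  have key : D.q₂ ℓ x = D.q₂Left ℓ x.1 + (D.q₂Mid ℓ x.2.1 + D.q₂Right ℓ x.2.2) := rfl
  rw [key, map_add, map_add, equivQ₁_apply, equivQ₁_apply, equivQ₁_apply, equivQ₂_apply]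
  ext i
  fin_cases i
  all_goals
    simp [q₂Left, q₂Mid, q₂Right, LinkCoef.Q₂, LinkCoef.C₂, Matrix.mulVec, dotProduct,
      Fin.sum_univ_succ, D.p_apply ℓ, minor_wedge, volume_wedge_vec,
      minor_χG', volume_χF, minor_χG, volume_χF', D.minor_map_ℓ' ℓ, D.minor_map_φ' ℓ,
      onDual_vec_apply_zero, onDual_vec_apply_one, D.repr_ℓ ℓ, D.repr_φ ℓ, D.φ'_apply ℓ,
      D.repr_ψOn ℓ, minor_onVec_vec, D.repr_ℓ' ℓ, D.minor_σ ℓ, D.minor_ζ ℓ, D.minor_ψ ℓ,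
      D.z₂_eq_coef ℓ, LinkCoef.sg, LinkCoef.w₁, LinkCoef.w₂]
    ring

set_option maxHeartbeats 800000 in
theorem equivQ₀_q₁ (x : Q₁ R F G) : D.equivQ₀ (D.q₁ ℓ x) =
    (D.coef ℓ).Q₁.mulVec (D.equivQ₁ x) := by
  have key : D.q₁ ℓ x = D.q₁Left ℓ x.1 + (D.q₁Mid ℓ x.2.1 + D.q₁Right ℓ x.2.2) := rfl
  rw [key, map_add, map_add, equivQ₀_apply, equivQ₀_apply, equivQ₀_apply, equivQ₁_apply]
  ext i
  fin_cases i
  simp [q₁Left, q₁Mid, q₁Right, LinkCoef.Q₁, Matrix.mulVec, dotProduct, Fin.sum_univ_succ,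
    D.p_apply ℓ, volume_wedge_vec_right, scal_onDual_two D.β,
    minor_χG', volume_χF, minor_χG, volume_χF', D.minor_map_ℓ ℓ, D.minor_map_φ ℓ,
      D.minor_map_ℓ' ℓ, LinkCoef.dt, LinkCoef.d₁, LinkCoef.d₂, LinkCoef.d₃, LinkCoef.n₁₂,
      LinkCoef.n₁₃, LinkCoef.n₂₃,
    onDual_vec_apply_zero, onDual_vec_apply_one, D.repr_φ ℓ, volume_wedge_onVec,
    D.minor_map_φ' ℓ, D.repr_ψOn ℓ, D.repr_ℓ' ℓ, D.minor_σ ℓ, D.minor_ζ ℓ, D.minor_ψ ℓ,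
    D.z₂_eq_coef ℓ, LinkCoef.w₁, LinkCoef.w₂, LinkCoef.j₁, LinkCoef.j₂, LinkCoef.x₁, LinkCoef.x₂,
    LinkCoef.x₃, LinkCoef.h₁, LinkCoef.h₂, LinkCoef.h₃]
  ring

end BrownData

/-! ### The dual of the mapping cone -/

namespace LinkCoef

variable {R : Type*} [CommRing R] (c : LinkCoef R)

/-- The projection of `G* × F` to `G*`. -/
def projG (R : Type*) [CommRing R] : Matrix (Fin 2) (Fin 5) R := !![1, 0, 0, 0, 0; 0, 1, 0, 0, 0]

/-- The inclusion of `F` in `G* × F`. -/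
def inclF (R : Type*) [CommRing R] : Matrix (Fin 5) (Fin 3) R := !![0, 0, 0; 0, 0, 0; 1, 0, 0; 0, 1, 0; 0, 0, 1]

/-- The kernel of the dual of `c₁`. -/
def kerC : Matrix (Fin 5) (Fin 2) R :=
  !![1, 0; 0, 1; -c.l₁, -c.m₁; -c.l₂, -c.m₂; -c.l₃, -c.m₃]

theorem projG_mul_kerC : projG R * c.kerC = 1 := by
  ext i j
  fin_cases i <;> fin_cases j <;> simp [projG, kerC, Matrix.mul_apply, Fin.sum_univ_succ]

theorem projG_mul_inclF : projG R * inclF R = 0 := by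
  ext i j
  fin_cases i <;> fin_cases j <;> simp [projG, inclF, Matrix.mul_apply, Fin.sum_univ_succ]

theorem transpose_C₁_mul_kerC : c.C₁.transpose * c.kerC = 0 := by
  ext i j
  fin_cases i <;> fin_cases j <;> simp [C₁, kerC, Matrix.mul_apply, Fin.sum_univ_succ]

theorem transpose_C₁_mul_inclF : c.C₁.transpose * inclF R = 1 := by
  ext i j
  fin_cases i <;> fin_cases j <;> simp [C₁, inclF, Matrix.mul_apply, Fin.sum_univ_succ]

/-- The decomposition of `B₁*` belonging to the split surjection `C₁ᵀ` with section `inclF`: a copy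
of `G*`, its kernel, and a copy of `F`. -/
theorem kerC_mul_projG_add : c.kerC * projG R + inclF R * c.C₁.transpose = 1 := by
  ext i j
  rw [Matrix.add_apply, Matrix.mul_apply, Matrix.mul_apply]
  fin_cases i <;> fin_cases j <;> simp [C₁, inclF, kerC, projG, Fin.sum_univ_succ]

/-- This identifies `q₃` with the restriction of the dual of `b₂` to the kernel of the dual of `c₁`.
-/
theorem Q₃_eq_mul : c.Q₃ = c.B₂.transpose * c.kerC := by
  ext i j
  fin_cases i <;> fin_cases j <;>
    simp [Q₃, B₂, kerC, Matrix.mul_apply, Fin.sum_univ_succ] <;> ring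

/-- The dual of `K₂ ⊕ B₃`, in coordinates, is the middle module of `Q`. -/
def coneEquivOne : ((Fin 3 → R) × (Fin 2 → R)) ≃ₗ[R] (Fin 5 → R) where
  toFun x := ![x.2 0, x.2 1, -x.1 0, -x.1 1, -x.1 2]
  map_add' x y := by ext i; fin_cases i <;> simp <;> ring
  map_smul' r x := by ext i; fin_cases i <;> simp
  invFun v := (![-v 2, -v 3, -v 4], ![v 0, v 1])
  left_inv x := by ext i <;> fin_cases i <;> simp
  right_inv v := by ext i; fin_cases i <;> simp

theorem Q₁_mulVec (u : Fin 3 → R) (b : Fin 2 → R) :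
    c.Q₁.mulVec (coneEquivOne (u, b)) = -c.K₃.transpose.mulVec u + c.C₃.transpose.mulVec b := by
  ext i
  fin_cases i
  simp [coneEquivOne, Q₁, K₃, C₃, Matrix.mulVec, dotProduct, Fin.sum_univ_succ]
  ring

theorem Q₂_mulVec (v : Fin 6 → R) : c.Q₂.mulVec v =
    coneEquivOne (c.C₂.transpose.mulVec v, c.B₃.transpose.mulVec v) := by
  ext i
  fin_cases i <;>
    simp [coneEquivOne, Q₂, B₃, Matrix.mulVec, dotProduct, Fin.sum_univ_succ] <;> ring

/-- The dual of `K₁ ⊕ B₂`, in coordinates. -/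
def coneEquivTwo : ((Fin 3 → R) × (Fin 6 → R)) ≃ₗ[R] (Fin 6 → R) × (Fin 3 → R) where
  -- Since `C₁ᵀ inclF = 1`, `t₃` sends `(0, inclF f)` to `(f, B₂ᵀ inclF f)`. The shear moves this
  -- image onto the summand `F`.
  toFun x := (x.2 - c.B₂.transpose.mulVec ((inclF R).mulVec x.1), x.1)
  map_add' x y := by
    ext1
    · simp only [Prod.fst_add, Prod.snd_add, Matrix.mulVec_add]
      abel
    · rfl
  map_smul' r x := by
    ext1
    · simp only [Prod.smul_fst, Prod.smul_snd, Matrix.mulVec_smul, smul_sub, RingHom.id_apply]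
    · rfl
  invFun y := (y.2, y.1 + c.B₂.transpose.mulVec ((inclF R).mulVec y.2))
  left_inv x := by simp
  right_inv y := by simp

/-- The dual of `K₀ ⊕ B₁`, in coordinates. -/
def coneEquivThree {q : R} (hq : c.p * q = 1) :
    ((Fin 1 → R) × (Fin 5 → R)) ≃ₗ[R] (Fin 2 → R) × ((Fin 1 → R) × (Fin 3 → R)) where
  -- The image of `t₄` consists of the pairs `(q z, B₁ᵀ z)`. Subtracting `p B₁ᵀ x.1` kills it in the
  -- first component, `p x.1` recovers `z`, and the last component is that of `t₃`, which vanishes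
  -- on this image.
  toFun x := ((projG R).mulVec (x.2 - c.p • c.B₁.transpose.mulVec x.1), c.p • x.1,
    -c.K₁.transpose.mulVec x.1 + c.C₁.transpose.mulVec x.2)
  map_add' x y := by
    refine Prod.ext ?_ (Prod.ext ?_ ?_)
    · simp only [Prod.fst_add, Prod.snd_add, Matrix.mulVec_add, Matrix.mulVec_sub, smul_add]
      abel
    · exact smul_add _ _ _
    · simp only [Prod.fst_add, Prod.snd_add, Matrix.mulVec_add]
      abel
  map_smul' r x := by
    refine Prod.ext ?_ (Prod.ext ?_ ?_)
    · simp only [Prod.smul_fst, Prod.smul_snd, Matrix.mulVec_smul, Matrix.mulVec_sub, smul_sub,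
        RingHom.id_apply, smul_comm r]
    · exact smul_comm _ _ _
    · simp only [Prod.smul_fst, Prod.smul_snd, Matrix.mulVec_smul, RingHom.id_apply, smul_add,
        smul_neg]
  invFun y := (q • y.2.1, c.B₁.transpose.mulVec y.2.1 + c.kerC.mulVec y.1 + (inclF R).mulVec y.2.2)
  left_inv x := by
    have h := congrArg (fun M : Matrix (Fin 5) (Fin 5) R => M.mulVec (x.2 - c.p • c.B₁.transpose.mulVec x.1))
      c.kerC_mul_projG_add
    have hK : c.K₁.transpose.mulVec x.1 =
        c.C₁.transpose.mulVec (c.p • c.B₁.transpose.mulVec x.1) := by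
      rw [← c.B₁_mul_C₁, Matrix.transpose_smul, Matrix.transpose_mul, Matrix.smul_mulVec,
        Matrix.mulVec_smul, Matrix.mulVec_mulVec]
    simp only [Matrix.add_mulVec, Matrix.one_mulVec, ← Matrix.mulVec_mulVec] at h
    refine Prod.ext ?_ ?_
    · simp only [smul_smul, mul_comm q, hq, one_smul]
    · simp only [hK]
      rw [neg_add_eq_sub, ← Matrix.mulVec_sub, add_assoc, h, Matrix.mulVec_smul]
      abel
  right_inv y := by
    have e : c.B₁.transpose.mulVec y.2.1 + c.kerC.mulVec y.1 + (inclF R).mulVec y.2.2 -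
        c.p • c.B₁.transpose.mulVec (q • y.2.1) = c.kerC.mulVec y.1 + (inclF R).mulVec y.2.2 := by
      rw [Matrix.mulVec_smul, smul_smul, hq, one_smul]
      abel
    have hK : c.K₁.transpose.mulVec (q • y.2.1) =
        c.C₁.transpose.mulVec (c.B₁.transpose.mulVec y.2.1) := by
      rw [← c.B₁_mul_C₁, Matrix.transpose_smul, Matrix.transpose_mul, Matrix.smul_mulVec,
        Matrix.mulVec_smul, smul_smul, hq, one_smul, Matrix.mulVec_mulVec]
    refine Prod.ext ?_ (Prod.ext ?_ ?_)
    · simp only [e, Matrix.mulVec_add, Matrix.mulVec_mulVec, projG_mul_kerC, projG_mul_inclF,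
        Matrix.one_mulVec, Matrix.zero_mulVec, add_zero]
    · simp only [smul_smul, hq, one_smul]
    · simp only [hK, Matrix.mulVec_add, Matrix.mulVec_mulVec, transpose_C₁_mul_kerC,
        transpose_C₁_mul_inclF, Matrix.one_mulVec, Matrix.zero_mulVec, add_zero]
      abel

/-- Gaussian elimination at the invertible entry `q` of the dual of `c₀` and at the identity block
of the dual of `c₁`; the changes of coordinates were chosen so that the remaining maps are those of
`Q`. -/
theorem isSumWithSplitExact {q : R} (hq : c.p * q = 1) :
    IsSumWithSplitExact (Fin 1 → R) (Fin 3 → R)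
      ((q • LinearMap.id).prod c.B₁.transpose.mulVecLin)
      (((-c.K₁.transpose.mulVecLin).coprod c.C₁.transpose.mulVecLin).prod
        (c.B₂.transpose.mulVecLin ∘ₗ LinearMap.snd R _ _))
      (((-c.K₂.transpose.mulVecLin).coprod c.C₂.transpose.mulVecLin).prod
        (c.B₃.transpose.mulVecLin ∘ₗ LinearMap.snd R _ _))
      ((-c.K₃.transpose.mulVecLin).coprod c.C₃.transpose.mulVecLin)
      c.Q₃.mulVecLin c.Q₂.mulVecLin c.Q₁.mulVecLin := by
  have hK : ∀ x, c.K₁.transpose.mulVec x =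
      c.C₁.transpose.mulVec (c.p • c.B₁.transpose.mulVec x) := fun x => by
    rw [← c.B₁_mul_C₁, Matrix.transpose_smul, Matrix.transpose_mul, Matrix.smul_mulVec,
      Matrix.mulVec_smul, Matrix.mulVec_mulVec]
  refine ⟨LinearEquiv.refl R _, c.coneEquivThree hq, c.coneEquivTwo, coneEquivOne,
    LinearEquiv.refl R _, fun x => ?_, fun x => ?_, fun x => ?_, fun x => ?_⟩
  · change ((projG R).mulVec (c.B₁.transpose.mulVec x - c.p • c.B₁.transpose.mulVec (q • x)),
      c.p • q • x, -c.K₁.transpose.mulVec (q • x) +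
        c.C₁.transpose.mulVec (c.B₁.transpose.mulVec x)) = (0, x, 0)
    rw [hK, Matrix.mulVec_smul, smul_smul, smul_smul, hq, one_smul, one_smul, sub_self,
      Matrix.mulVec_zero, neg_add_cancel]
  · change (c.B₂.transpose.mulVec x.2 - c.B₂.transpose.mulVec ((inclF R).mulVec
        (-c.K₁.transpose.mulVec x.1 + c.C₁.transpose.mulVec x.2)),
        -c.K₁.transpose.mulVec x.1 + c.C₁.transpose.mulVec x.2) =
      (c.Q₃.mulVec ((projG R).mulVec (x.2 - c.p • c.B₁.transpose.mulVec x.1)),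
        -c.K₁.transpose.mulVec x.1 + c.C₁.transpose.mulVec x.2)
    have h := congrArg (fun M : Matrix (Fin 5) (Fin 5) R => M.mulVec (x.2 - c.p • c.B₁.transpose.mulVec x.1))
      c.kerC_mul_projG_add
    simp only [Matrix.add_mulVec, Matrix.one_mulVec, ← Matrix.mulVec_mulVec] at h
    have hB : c.B₂.transpose.mulVec (c.p • c.B₁.transpose.mulVec x.1) = 0 := by
      rw [Matrix.mulVec_smul, Matrix.mulVec_mulVec, ← Matrix.transpose_mul, c.B₁_mul_B₂,
        Matrix.transpose_zero, Matrix.zero_mulVec, smul_zero]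
    refine Prod.ext ?_ rfl
    dsimp only
    rw [Q₃_eq_mul, ← Matrix.mulVec_mulVec, eq_sub_of_add_eq h, hK, neg_add_eq_sub]
    simp only [Matrix.mulVec_sub, hB, sub_zero]
  · change coneEquivOne (-c.K₂.transpose.mulVec x.1 + c.C₂.transpose.mulVec x.2,
      c.B₃.transpose.mulVec x.2) = c.Q₂.mulVec
        (x.2 - c.B₂.transpose.mulVec ((inclF R).mulVec x.1))
    rw [Q₂_mulVec, Matrix.mulVec_sub, Matrix.mulVec_sub,
      Matrix.mulVec_mulVec _ c.B₃.transpose c.B₂.transpose, ← Matrix.transpose_mul, c.B₂_mul_B₃,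
      Matrix.transpose_zero, Matrix.zero_mulVec, sub_zero,
      Matrix.mulVec_mulVec _ c.C₂.transpose c.B₂.transpose, ← Matrix.transpose_mul, c.B₂_mul_C₂,
      Matrix.transpose_mul, ← Matrix.mulVec_mulVec, Matrix.mulVec_mulVec _ _ (inclF R),
      transpose_C₁_mul_inclF, Matrix.one_mulVec, neg_add_eq_sub]
  · exact (c.Q₁_mulVec x.1 x.2).symm

end LinkCoef

/-! ### Transport of the splitting along isomorphisms. -/

section Transfer

variable {R : Type*} [CommRing R] {U W T₀ T₁ T₂ T₃ T₄ Q₀ Q₁ Q₂ Q₃ : Type*}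
  {U' W' T₀' T₁' T₂' T₃' T₄' Q₀' Q₁' Q₂' Q₃' : Type*}
  [AddCommMonoid U] [Module R U] [AddCommMonoid W] [Module R W]
  [AddCommMonoid T₀] [Module R T₀] [AddCommMonoid T₁] [Module R T₁] [AddCommMonoid T₂]
  [Module R T₂] [AddCommMonoid T₃] [Module R T₃] [AddCommMonoid T₄] [Module R T₄]
  [AddCommMonoid Q₀] [Module R Q₀] [AddCommMonoid Q₁] [Module R Q₁] [AddCommMonoid Q₂]
  [Module R Q₂] [AddCommMonoid Q₃] [Module R Q₃]
  [AddCommMonoid U'] [Module R U'] [AddCommMonoid W'] [Module R W']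
  [AddCommMonoid T₀'] [Module R T₀'] [AddCommMonoid T₁'] [Module R T₁'] [AddCommMonoid T₂']
  [Module R T₂'] [AddCommMonoid T₃'] [Module R T₃'] [AddCommMonoid T₄'] [Module R T₄']
  [AddCommMonoid Q₀'] [Module R Q₀'] [AddCommMonoid Q₁'] [Module R Q₁'] [AddCommMonoid Q₂']
  [Module R Q₂'] [AddCommMonoid Q₃'] [Module R Q₃']
  {t₄ : T₄ →ₗ[R] T₃} {t₃ : T₃ →ₗ[R] T₂} {t₂ : T₂ →ₗ[R] T₁} {t₁ : T₁ →ₗ[R] T₀}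
  {q₃ : Q₃ →ₗ[R] Q₂} {q₂ : Q₂ →ₗ[R] Q₁} {q₁ : Q₁ →ₗ[R] Q₀}
  {t₄' : T₄' →ₗ[R] T₃'} {t₃' : T₃' →ₗ[R] T₂'} {t₂' : T₂' →ₗ[R] T₁'} {t₁' : T₁' →ₗ[R] T₀'}
  {q₃' : Q₃' →ₗ[R] Q₂'} {q₂' : Q₂' →ₗ[R] Q₁'} {q₁' : Q₁' →ₗ[R] Q₀'}

theorem IsSumWithSplitExact.of_linearEquiv (h : IsSumWithSplitExact U' W' t₄' t₃' t₂' t₁' q₃' q₂' q₁')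
    (υ : U ≃ₗ[R] U') (ω : W ≃ₗ[R] W') (τ₀ : T₀ ≃ₗ[R] T₀') (τ₁ : T₁ ≃ₗ[R] T₁') (τ₂ : T₂ ≃ₗ[R] T₂')
    (τ₃ : T₃ ≃ₗ[R] T₃') (τ₄ : T₄ ≃ₗ[R] T₄') (θ₀ : Q₀ ≃ₗ[R] Q₀') (θ₁ : Q₁ ≃ₗ[R] Q₁')
    (θ₂ : Q₂ ≃ₗ[R] Q₂') (θ₃ : Q₃ ≃ₗ[R] Q₃')
    (ht₄ : ∀ x, τ₃ (t₄ x) = t₄' (τ₄ x)) (ht₃ : ∀ x, τ₂ (t₃ x) = t₃' (τ₃ x))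
    (ht₂ : ∀ x, τ₁ (t₂ x) = t₂' (τ₂ x)) (ht₁ : ∀ x, τ₀ (t₁ x) = t₁' (τ₁ x))
    (hq₃ : ∀ x, θ₂ (q₃ x) = q₃' (θ₃ x)) (hq₂ : ∀ x, θ₁ (q₂ x) = q₂' (θ₂ x))
    (hq₁ : ∀ x, θ₀ (q₁ x) = q₁' (θ₁ x)) :
    IsSumWithSplitExact U W t₄ t₃ t₂ t₁ q₃ q₂ q₁ := by
  obtain ⟨s₄, s₃, s₂, s₁, s₀, h₄, h₃, h₂, h₁⟩ := h
  refine ⟨τ₄ ≪≫ₗ s₄ ≪≫ₗ υ.symm, τ₃ ≪≫ₗ s₃ ≪≫ₗ (θ₃.prodCongr (υ.prodCongr ω)).symm,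
    τ₂ ≪≫ₗ s₂ ≪≫ₗ (θ₂.prodCongr ω).symm, τ₁ ≪≫ₗ s₁ ≪≫ₗ θ₁.symm, τ₀ ≪≫ₗ s₀ ≪≫ₗ θ₀.symm,
    fun x => ?_, fun x => ?_, fun x => ?_, fun x => ?_⟩
  · simp [ht₄, h₄]
  · simp only [LinearEquiv.trans_apply, ht₃, h₃, LinearEquiv.symm_apply_eq]
    simp [hq₃]
  · simp only [LinearEquiv.trans_apply, ht₂, h₂, LinearEquiv.symm_apply_eq]
    simp [hq₂]
  · simp only [LinearEquiv.trans_apply, ht₁, h₁, LinearEquiv.symm_apply_eq]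
    simp [hq₁]

end Transfer

/-! ### Dual coordinates and transposed matrices. -/

section DualCoordinates

variable {R : Type*} [CommRing R] {A A' : Type*} [AddCommMonoid A] [Module R A] [AddCommMonoid A']
  [Module R A'] {n n' : Type*} [Fintype n] [DecidableEq n] [Fintype n'] [DecidableEq n']

/-- Coordinates on the dual of a module with coordinates. -/
noncomputable def dualCoordinates (E : A ≃ₗ[R] (n → R)) : Dual R A ≃ₗ[R] (n → R) :=
  E.symm.dualMap ≪≫ₗ (Pi.basisFun R n).dualBasis.equivFun

theorem dualCoordinates_apply (E : A ≃ₗ[R] (n → R)) (α : Dual R A) (i : n) :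
    dualCoordinates E α i = α (E.symm (Pi.single i 1)) := by
  simp [dualCoordinates]

theorem dualCoordinates_dualMap {E : A ≃ₗ[R] (n → R)} {E' : A' ≃ₗ[R] (n' → R)} {f : A →ₗ[R] A'}
    {M : Matrix n' n R} (h : ∀ x, E' (f x) = M.mulVec (E x)) (α : Dual R A') :
    dualCoordinates E (f.dualMap α) = M.transpose.mulVec (dualCoordinates E' α) := by
  ext j
  have e : f (E.symm (Pi.single j 1)) = E'.symm (∑ i, M i j • Pi.single i 1) := by
    rw [LinearEquiv.eq_symm_apply, h, LinearEquiv.apply_symm_apply, Matrix.mulVec_single_one]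
    ext i
    simp [Finset.sum_apply, Pi.single_apply]
  rw [dualCoordinates_apply, LinearMap.dualMap_apply, e]
  simp [Matrix.mulVec, dotProduct, dualCoordinates_apply]

end DualCoordinates

/-! ### The formal part, for arbitrary data. -/

namespace BrownData

open ExteriorContraction

variable {R : Type u} [CommRing R] {F : Type v} {G : Type w}
  [AddCommGroup F] [Module R F] [AddCommGroup G] [Module R G] (D : BrownData R F G)
  (ℓ : Dual R F →ₗ[R] G)

theorem coef_p_mul : (D.coef ℓ).p * D.tensorEquiv (D.p.symm 1) = 1 := by
  rw [← p_apply, LinearEquiv.apply_symm_apply]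

theorem equivB₀_c₀ (r : R) : D.equivB₀ (D.c₀ r) =
    (Matrix.diagonal fun _ : Fin 1 => D.tensorEquiv (D.p.symm 1)).mulVec
      ((LinearEquiv.funUnique (Fin 1) R R).symm r) := by
  have : D.p.symm r = r • D.p.symm 1 := by rw [← map_smul, smul_eq_mul, mul_one]
  rw [equivB₀_apply, c₀, LinearEquiv.coe_coe, this]
  ext i
  fin_cases i
  simp [Matrix.mulVec_diagonal, mul_comm]

theorem funUnique_κ₁ (α : Dual R F) : (LinearEquiv.funUnique (Fin 1) R R).symm (D.κ₁ ℓ α) =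
    (D.coef ℓ).K₁.mulVec (D.e.dualBasis.equivFun α) := by
  ext i
  fin_cases i
  exact D.κ₁_eq_mulVec ℓ α

theorem dualConeIsQ : D.DualConeIsQ ℓ where
  b₁_b₂ := LinearMap.ext fun x => D.equivB₀.injective (by
    rw [LinearMap.comp_apply, D.equivB₀_b₁ ℓ, D.equivB₁_b₂ ℓ, Matrix.mulVec_mulVec,
      LinkCoef.B₁_mul_B₂, Matrix.zero_mulVec, LinearMap.zero_apply, map_zero])
  b₂_b₃ := LinearMap.ext fun x => D.equivB₁.injective (by
    rw [LinearMap.comp_apply, D.equivB₁_b₂ ℓ, D.equivB₂_b₃ ℓ, Matrix.mulVec_mulVec,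
      LinkCoef.B₂_mul_B₃, Matrix.zero_mulVec, LinearMap.zero_apply, map_zero])
  κ₁_κ₂ := LinearMap.ext fun x => (LinearEquiv.funUnique (Fin 1) R R).symm.injective (by
    rw [LinearMap.comp_apply, funUnique_κ₁, equivFun_κ₂, Matrix.mulVec_mulVec,
      LinkCoef.K₁_mul_K₂, Matrix.zero_mulVec, LinearMap.zero_apply, map_zero])
  κ₂_κ₃ := LinearMap.ext fun x => D.e.dualBasis.equivFun.injective (by
    rw [LinearMap.comp_apply, equivFun_κ₂, minorsEquiv_κ₃, Matrix.mulVec_mulVec,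
      LinkCoef.K₂_mul_K₃, Matrix.zero_mulVec, LinearMap.zero_apply, map_zero])
  q₁_q₂ := LinearMap.ext fun x => D.equivQ₀.injective (by
    rw [LinearMap.comp_apply, equivQ₀_q₁, equivQ₁_q₂, Matrix.mulVec_mulVec,
      LinkCoef.Q₁_mul_Q₂, Matrix.zero_mulVec, LinearMap.zero_apply, map_zero])
  q₂_q₃ := LinearMap.ext fun x => D.equivQ₁.injective (by
    rw [LinearMap.comp_apply, equivQ₁_q₂, equivQ₂_q₃, Matrix.mulVec_mulVec,
      LinkCoef.Q₂_mul_Q₃, Matrix.zero_mulVec, LinearMap.zero_apply, map_zero])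
  comm₁ := LinearMap.ext fun x => by
    simp [c₀, κ₁]
  comm₂ := LinearMap.ext fun x => D.equivB₁.injective (by
    rw [LinearMap.comp_apply, LinearMap.comp_apply, D.equivB₁_b₂ ℓ, equivB₂_c₂, equivB₁_c₁,
      equivFun_κ₂, Matrix.mulVec_mulVec, Matrix.mulVec_mulVec, LinkCoef.B₂_mul_C₂])
  comm₃ := LinearMap.ext fun x => D.equivB₂.injective (by
    rw [LinearMap.comp_apply, LinearMap.comp_apply, D.equivB₂_b₃ ℓ, equivB₃_c₃, equivB₂_c₂,
      minorsEquiv_κ₃, Matrix.mulVec_mulVec, Matrix.mulVec_mulVec, LinkCoef.B₃_mul_C₃])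
  sum := by
    refine ((D.coef ℓ).isSumWithSplitExact (D.coef_p_mul ℓ)).of_linearEquiv
      (dualCoordinates D.equivB₀) D.e.equivFun (dualCoordinates D.equivK₃)
      ((dualCoordinates (minorsEquiv D.e.dualBasis)).prodCongr (dualCoordinates D.equivB₃))
      ((dualCoordinates D.e.dualBasis.equivFun).prodCongr (dualCoordinates D.equivB₂))
      ((dualCoordinates (LinearEquiv.funUnique (Fin 1) R R).symm).prodCongr
        (dualCoordinates D.equivB₁))
      (dualCoordinates D.equivB₀) D.equivQ₀ D.equivQ₁ D.equivQ₂ D.β.dualBasis.equivFun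
      (fun x => Prod.ext ?_ ?_) (fun x => Prod.ext ?_ ?_) (fun x => Prod.ext ?_ ?_) (fun x => ?_)
      (D.equivQ₂_q₃ ℓ) (D.equivQ₁_q₂ ℓ) (D.equivQ₀_q₁ ℓ)
    · change dualCoordinates _ (D.c₀.dualMap x) = _
      rw [dualCoordinates_dualMap D.equivB₀_c₀, Matrix.diagonal_transpose]
      ext i
      rw [Matrix.mulVec_diagonal]
      rfl
    · exact dualCoordinates_dualMap (D.equivB₀_b₁ ℓ) x
    · change dualCoordinates _ (-(D.κ₁ ℓ).dualMap x.1 + (c₁ ℓ).dualMap x.2) = _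
      rw [map_add, map_neg, dualCoordinates_dualMap (D.funUnique_κ₁ ℓ),
        dualCoordinates_dualMap (D.equivB₁_c₁ ℓ)]
      rfl
    · exact dualCoordinates_dualMap (D.equivB₁_b₂ ℓ) x.2
    · change dualCoordinates _ (-(D.κ₂ ℓ).dualMap x.1 + (D.c₂ ℓ).dualMap x.2) = _
      rw [map_add, map_neg, dualCoordinates_dualMap (D.equivFun_κ₂ ℓ),
        dualCoordinates_dualMap (D.equivB₂_c₂ ℓ)]
      rfl
    · exact dualCoordinates_dualMap (D.equivB₂_b₃ ℓ) x.2
    · have hK := dualCoordinates_dualMap (E := D.equivK₃) (E' := minorsEquiv D.e.dualBasis)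
        (f := D.κ₃ ℓ) (M := (D.coef ℓ).K₃) (D.minorsEquiv_κ₃ ℓ) x.1
      have hC := dualCoordinates_dualMap (E := D.equivK₃) (E' := D.equivB₃)
        (f := D.c₃ ℓ) (M := (D.coef ℓ).C₃) (D.equivB₃_c₃ ℓ) x.2
      exact (map_add (dualCoordinates D.equivK₃) (-(D.κ₃ ℓ).dualMap x.1) _).trans
        (congrArg₂ (· + ·) ((map_neg (dualCoordinates D.equivK₃) _).trans (congrArg Neg.neg hK)) hC)

end BrownData

/-! ### Linkage -/

section Transfer

variable {R : Type*} [CommRing R] {A₁ A₂ A₃ A₁' A₂' A₃' : Type*}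
  [AddCommMonoid A₁] [Module R A₁] [AddCommMonoid A₂] [Module R A₂] [AddCommMonoid A₃] [Module R A₃]
  [AddCommMonoid A₁'] [Module R A₁'] [AddCommMonoid A₂'] [Module R A₂']
  [AddCommMonoid A₃'] [Module R A₃']
  {f : A₁ →ₗ[R] A₂} {g : A₂ →ₗ[R] A₃} {f' : A₁' →ₗ[R] A₂'} {g' : A₂' →ₗ[R] A₃'}

theorem Function.Exact.of_squares (h : Function.Exact f' g') (E₁ : A₁ ≃ₗ[R] A₁') (E₂ : A₂ ≃ₗ[R] A₂')
    (E₃ : A₃ ≃ₗ[R] A₃') (hf : ∀ x, E₂ (f x) = f' (E₁ x)) (hg : ∀ x, E₃ (g x) = g' (E₂ x)) :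
    Function.Exact f g := by
  intro y
  rw [← E₃.map_eq_zero_iff, hg, h (E₂ y)]
  constructor
  · rintro ⟨x, hx⟩
    exact ⟨E₁.symm x, E₂.injective (by rw [hf, LinearEquiv.apply_symm_apply, hx])⟩
  · rintro ⟨x, rfl⟩
    exact ⟨E₁ x, (hf x).symm⟩

theorem Function.Injective.of_square (h : Function.Injective f') (E₁ : A₁ ≃ₗ[R] A₁')
    (E₂ : A₂ ≃ₗ[R] A₂') (hf : ∀ x, E₂ (f x) = f' (E₁ x)) : Function.Injective f := fun x y hxy =>
  E₁.injective (h (by rw [← hf, ← hf, hxy]))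

theorem range_eq_span {n : Type*} [Fintype n] (φ : A₁ →ₗ[R] R) (E : A₁ ≃ₗ[R] (n → R)) (v : n → R)
    (h : ∀ x, φ x = v ⬝ᵥ E x) : LinearMap.range φ = Ideal.span (Set.range v) := by
  classical
  ext r
  constructor
  · rintro ⟨x, rfl⟩
    rw [h, dotProduct]
    exact Ideal.sum_mem _ fun i _ => Ideal.mul_mem_right _ _ (Ideal.subset_span ⟨i, rfl⟩)
  · intro hr
    obtain ⟨g, hg⟩ := Matrix.exists_dotProduct_eq_of_mem_span hr
    exact ⟨E.symm g, by rw [h, LinearEquiv.apply_symm_apply, hg]⟩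

end Transfer

section SumWithSplitExact

variable {R : Type*} [CommRing R] {U W T₀ T₁ T₂ T₃ T₄ Q₀ Q₁ Q₂ Q₃ : Type*}
  [AddCommMonoid U] [Module R U] [AddCommMonoid W] [Module R W]
  [AddCommMonoid T₀] [Module R T₀] [AddCommMonoid T₁] [Module R T₁] [AddCommMonoid T₂]
  [Module R T₂] [AddCommMonoid T₃] [Module R T₃] [AddCommMonoid T₄] [Module R T₄]
  [AddCommMonoid Q₀] [Module R Q₀] [AddCommMonoid Q₁] [Module R Q₁] [AddCommMonoid Q₂]
  [Module R Q₂] [AddCommMonoid Q₃] [Module R Q₃]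
  {t₄ : T₄ →ₗ[R] T₃} {t₃ : T₃ →ₗ[R] T₂} {t₂ : T₂ →ₗ[R] T₁} {t₁ : T₁ →ₗ[R] T₀}
  {q₃ : Q₃ →ₗ[R] Q₂} {q₂ : Q₂ →ₗ[R] Q₁} {q₁ : Q₁ →ₗ[R] Q₀}

/-- The added summand is exact, so exactness of `Q` is inherited; preimages are written down in the
split coordinates. -/
theorem IsSumWithSplitExact.exact (h : IsSumWithSplitExact U W t₄ t₃ t₂ t₁ q₃ q₂ q₁)
    (i₃ : Function.Injective q₃) (e₂ : Function.Exact q₃ q₂) (e₁ : Function.Exact q₂ q₁) :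
    Function.Injective t₄ ∧ Function.Exact t₄ t₃ ∧ Function.Exact t₃ t₂ ∧
      Function.Exact t₂ t₁ := by
  obtain ⟨s₄, s₃, s₂, s₁, s₀, h₄, h₃, h₂, h₁⟩ := h
  refine ⟨fun x y hxy => ?_, fun y => ?_, fun y => ?_, fun y => ?_⟩
  · have := congrArg s₃ hxy
    rw [h₄, h₄, Prod.mk.injEq, Prod.mk.injEq] at this
    exact s₄.injective this.2.1
  · rw [← s₂.map_eq_zero_iff, h₃, Prod.mk_eq_zero, map_eq_zero_iff _ i₃]
    constructor
    · rintro ⟨ha, hb⟩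
      refine ⟨s₄.symm (s₃ y).2.1, s₃.injective ?_⟩
      rw [h₄, LinearEquiv.apply_symm_apply, ← ha, ← hb]
    · rintro ⟨x, rfl⟩
      rw [h₄]
      exact ⟨rfl, rfl⟩
  · rw [← s₁.map_eq_zero_iff, h₂, e₂]
    constructor
    · rintro ⟨g, hg⟩
      refine ⟨s₃.symm (g, (0, (s₂ y).2)), s₂.injective ?_⟩
      rw [h₃, LinearEquiv.apply_symm_apply, hg]
    · rintro ⟨x, rfl⟩
      rw [h₃]
      exact ⟨_, rfl⟩
  · rw [← s₀.map_eq_zero_iff, h₁, e₁]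
    constructor
    · rintro ⟨x, hx⟩
      refine ⟨s₂.symm (x, 0), s₁.injective ?_⟩
      rw [h₂, LinearEquiv.apply_symm_apply, hx]
    · rintro ⟨x, rfl⟩
      rw [h₂]
      exact ⟨_, rfl⟩

end SumWithSplitExact

namespace BrownData

open ExteriorContraction

variable {R : Type u} [CommRing R] {F : Type v} {G : Type w}
  [AddCommGroup F] [Module R F] [AddCommGroup G] [Module R G] (D : BrownData R F G)
  (ℓ : Dual R F →ₗ[R] G)

theorem idealB_eq : D.idealB = (D.coef ℓ).idealI := by
  -- The unit `p` by which `p ∘ b₁` differs from the row `B₁` is absorbed into the coordinates of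
  -- the source.
  refine range_eq_span _ (D.equivB₁ ≪≫ₗ LinearEquiv.smulOfUnit
    (Units.mkOfMulEqOne _ _ (D.coef_p_mul ℓ))) _ fun x => ?_
  rw [LinearMap.comp_apply, LinearEquiv.coe_coe, D.p_apply ℓ, D.tensorEquiv_b₁ ℓ]
  change _ = _ ⬝ᵥ ((D.coef ℓ).p • D.equivB₁ x)
  rw [dotProduct_smul]
  rfl

theorem idealK_eq : D.idealK ℓ = (D.coef ℓ).idealX :=
  range_eq_span _ D.e.dualBasis.equivFun _ (D.κ₁_eq_mulVec ℓ)

theorem idealQ_eq : D.idealQ ℓ = (D.coef ℓ).idealJ := by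
  refine range_eq_span _ D.equivQ₁ _ fun x => ?_
  have h := congrFun (D.equivQ₀_q₁ ℓ x) 0
  rw [equivQ₀_apply] at h
  rw [LinearMap.comp_apply, LinearMap.comp_apply, scal_onVec_three, volume_χF', neg_mul, one_mul,
    neg_neg]
  exact h

theorem equivK₃_symm_single : D.equivK₃.symm (Pi.single 0 1) = D.χF' := by
  rw [LinearEquiv.symm_apply_eq, equivK₃_apply, volume_χF', neg_neg]
  ext i
  fin_cases i
  rfl

theorem idealTot_eq : D.idealTot ℓ = (D.coef ℓ).idealJ := by
  refine range_eq_span _ ((dualCoordinates (minorsEquiv D.e.dualBasis)).prodCongr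
    (dualCoordinates D.equivB₃) ≪≫ₗ LinkCoef.coneEquivOne) _ fun x => ?_
  have hK := dualCoordinates_dualMap (E := D.equivK₃) (E' := minorsEquiv D.e.dualBasis)
    (f := D.κ₃ ℓ) (M := (D.coef ℓ).K₃) (D.minorsEquiv_κ₃ ℓ) x.1
  have hC := dualCoordinates_dualMap (E := D.equivK₃) (E' := D.equivB₃)
    (f := D.c₃ ℓ) (M := (D.coef ℓ).C₃) (D.equivB₃_c₃ ℓ) x.2
  have hK₀ := congrFun hK 0
  have hC₀ := congrFun hC 0
  rw [dualCoordinates_apply, equivK₃_symm_single] at hK₀ hC₀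
  change -((D.κ₃ ℓ).dualMap x.1 D.χF') + (D.c₃ ℓ).dualMap x.2 D.χF' =
    (D.coef ℓ).Q₁.mulVec (LinkCoef.coneEquivOne (_, _)) 0
  rw [hK₀, hC₀, LinkCoef.Q₁_mulVec]
  rfl

variable {D ℓ}

theorem obtainedByOneLink (hI : D.idealB ≠ ⊤) (hK : IsCompleteIntersection (D.idealK ℓ) 3) :
    D.ObtainedByOneLink ℓ := by
  obtain ⟨y₁, h₁, y₂, h₂, y₃, h₃, hy⟩ := hK.exists_isWeaklyRegular
  rw [idealK_eq] at h₁ h₂ h₃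
  obtain ⟨bi, be₂, be₁⟩ := LinkCoef.exact_B h₁ h₂ h₃ hy
  obtain ⟨ki, ke₂, ke₁⟩ := LinkCoef.exact_K h₁ h₂ h₃ hy
  obtain ⟨qi, qe₂, qe₁⟩ := LinkCoef.exact_Q h₁ h₂ h₃ hy
  have hQ₃ := qi.of_square D.β.dualBasis.equivFun D.equivQ₂ (D.equivQ₂_q₃ ℓ)
  have hQ₂ := qe₂.of_squares D.β.dualBasis.equivFun D.equivQ₂ D.equivQ₁ (D.equivQ₂_q₃ ℓ)
    (D.equivQ₁_q₂ ℓ)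
  have hQ₁ := qe₁.of_squares D.equivQ₂ D.equivQ₁ D.equivQ₀ (D.equivQ₁_q₂ ℓ) (D.equivQ₀_q₁ ℓ)
  have IX := (D.coef ℓ).idealX_le_idealI
  have JX := (D.coef ℓ).idealX_le_idealJ
  -- The criterion for perfection expects a last map to `R`, while a matrix with one row maps to
  -- `Fin 1 → R`.
  have e₀ : ∀ {n : ℕ} (M : Matrix (Fin 1) (Fin n) R) {A : Type u} [AddCommGroup A] [Module R A]
      {f : A →ₗ[R] (Fin n → R)}, Function.Exact f M.mulVecLin →
      Function.Exact f (LinearMap.proj 0 ∘ₗ M.mulVecLin) := fun M _ _ _ _ h y => by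
    rw [← h y, LinearMap.comp_apply, LinearMap.proj_apply]
    constructor
    · intro h
      ext i
      fin_cases i
      exact h
    · intro h
      rw [h, Pi.zero_apply]
  refine ⟨⟨?_, ?_, ?_⟩, ⟨?_, ?_, ?_⟩, ⟨?_, hK, ?_, ?_⟩, ?_, fun hQ => ?_, ?_, hQ₃, hQ₂, hQ₁⟩
  · exact ki.of_square D.equivK₃ (minorsEquiv D.e.dualBasis) (D.minorsEquiv_κ₃ ℓ)
  · exact ke₂.of_squares D.equivK₃ (minorsEquiv D.e.dualBasis) D.e.dualBasis.equivFun
      (D.minorsEquiv_κ₃ ℓ) (D.equivFun_κ₂ ℓ)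
  · exact ke₁.of_squares (minorsEquiv D.e.dualBasis) D.e.dualBasis.equivFun
      (LinearEquiv.funUnique (Fin 1) R R).symm (D.equivFun_κ₂ ℓ) (D.funUnique_κ₁ ℓ)
  · exact bi.of_square D.equivB₃ D.equivB₂ (D.equivB₂_b₃ ℓ)
  · exact be₂.of_squares D.equivB₃ D.equivB₂ D.equivB₁ (D.equivB₂_b₃ ℓ) (D.equivB₁_b₂ ℓ)
  · exact be₁.of_squares D.equivB₂ D.equivB₁ D.equivB₀ (D.equivB₁_b₂ ℓ) (D.equivB₀_b₁ ℓ)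
  -- Perfection is read off from the coordinate complex, whose terms lie in the universe of `R`; `F`
  -- and `G` may lie elsewhere.
  · rw [D.idealB_eq ℓ] at hI ⊢
    exact isPerfectOfGrade_three bi be₂ (e₀ _ be₁)
      (range_eq_span _ (LinearEquiv.refl R _) _ fun _ => rfl) hI (IX h₁) (IX h₂) (IX h₃) hy
  · rw [D.idealB_eq ℓ, idealK_eq]
    exact IX
  · rw [D.idealB_eq ℓ, idealK_eq, idealQ_eq]
    exact LinkCoef.idealJ_eq_colon h₁ h₂ h₃ hy
  · rw [D.idealB_eq ℓ, idealK_eq, idealQ_eq]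
    exact LinkCoef.idealI_eq_colon h₁ h₂ h₃ hy
  · rw [idealQ_eq] at hQ ⊢
    exact isPerfectOfGrade_three qi qe₂ (e₀ _ qe₁)
      (range_eq_span _ (LinearEquiv.refl R _) _ fun _ => rfl) hQ (JX h₁) (JX h₂) (JX h₃) hy
  · obtain ⟨a, b, c, d⟩ := (D.dualConeIsQ ℓ).sum.exact hQ₃ hQ₂ hQ₁
    refine ⟨a, b, c, d, ?_⟩
    rw [D.idealB_eq ℓ, idealK_eq, idealTot_eq]
    exact LinkCoef.idealJ_eq_colon h₁ h₂ h₃ hy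

end BrownData

/-! ### Generic data -/

namespace LinkCoef

section

variable {R : Type*} [CommRing R] (c : LinkCoef R)

theorem idealI_le_iff {A : Ideal R} :
    c.idealI ≤ A ↔ c.w₁ ∈ A ∧ c.w₂ ∈ A ∧ c.h₁ ∈ A ∧ c.h₂ ∈ A ∧ c.h₃ ∈ A := by
  constructor
  · intro h
    have h' : ∀ i, c.B₁ 0 i ∈ A := fun i => h (Ideal.subset_span ⟨i, rfl⟩)
    exact ⟨neg_mem_iff.mp (h' 1), h' 0, h' 2, h' 3, h' 4⟩
  · rintro ⟨h₁, h₂, h₃, h₄, h₅⟩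
    refine Ideal.span_le.mpr ?_
    rintro _ ⟨i, rfl⟩
    fin_cases i
    exacts [h₂, neg_mem h₁, h₃, h₄, h₅]

theorem idealX_eq_span : c.idealX = Ideal.span {c.x₁, c.x₂, c.x₃} := by
  rw [idealX]
  congr 1
  ext r
  simp [K₁, Fin.exists_fin_succ, eq_comm]

theorem mem_subring {A : Subring R} (ha₁ : c.a₁ ∈ A) (ha₂ : c.a₂ ∈ A) (ha₃ : c.a₃ ∈ A)
    (hb₁ : c.b₁ ∈ A) (hb₂ : c.b₂ ∈ A) (hb₃ : c.b₃ ∈ A) (hs₁ : c.s₁ ∈ A) (hs₂ : c.s₂ ∈ A)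
    (hs₃ : c.s₃ ∈ A) (hz₁ : c.z₁ ∈ A) (hz₂ : c.z₂ ∈ A) :
    c.w₁ ∈ A ∧ c.w₂ ∈ A ∧ c.h₁ ∈ A ∧ c.h₂ ∈ A ∧ c.h₃ ∈ A :=
  have d : ∀ {x y z t : R}, x ∈ A → y ∈ A → z ∈ A → t ∈ A → x * y - z * t ∈ A :=
    fun hx hy hz ht => A.sub_mem (A.mul_mem hx hy) (A.mul_mem hz ht)
  ⟨A.add_mem (d ha₁ hs₃ ha₂ hs₂) (A.mul_mem ha₃ hs₁),
    A.add_mem (d hb₁ hs₃ hb₂ hs₂) (A.mul_mem hb₃ hs₁),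
    d hz₂ (d ha₂ hb₃ ha₃ hb₂) hz₁ hs₃,
    A.add_mem (A.mul_mem hz₂ (d ha₃ hb₁ ha₁ hb₃)) (A.mul_mem hz₁ hs₂),
    d hz₂ (d ha₁ hb₂ ha₂ hb₁) hz₁ hs₁⟩

end

section Generic

open MvPolynomial

variable {R : Type*} [CommRing R] {σ : Type*} [Finite σ] [IsNoetherianRing R]
  {c : LinkCoef (MvPolynomial σ R)}

/-- If the entries of `ℓ` are variables that do not occur elsewhere, then the ideal `(x₁, x₂, x₃)`
is a complete intersection as soon as the larger ideal has grade at least three. -/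
theorem isCompleteIntersection_idealX {q : MvPolynomial σ R} (hq : c.p * q = 1) {l m : Fin 3 → σ}
    (hl : Function.Injective l) (hm : Function.Injective m) (hlm : ∀ i j, l i ≠ m j)
    (hl₁ : c.l₁ = X (l 0)) (hl₂ : c.l₂ = X (l 1)) (hl₃ : c.l₃ = X (l 2))
    (hm₁ : c.m₁ = X (m 0)) (hm₂ : c.m₂ = X (m 1)) (hm₃ : c.m₃ = X (m 2))
    (hw₁ : c.w₁ ∈ supported R (Set.range l ∪ Set.range m)ᶜ)
    (hw₂ : c.w₂ ∈ supported R (Set.range l ∪ Set.range m)ᶜ)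
    (hh₁ : c.h₁ ∈ supported R (Set.range l ∪ Set.range m)ᶜ)
    (hh₂ : c.h₂ ∈ supported R (Set.range l ∪ Set.range m)ᶜ)
    (hh₃ : c.h₃ ∈ supported R (Set.range l ∪ Set.range m)ᶜ)
    (hI : c.idealI ≠ ⊤) {y₁ y₂ y₃ : MvPolynomial σ R} (h₁ : y₁ ∈ c.idealI) (h₂ : y₂ ∈ c.idealI)
    (h₃ : y₃ ∈ c.idealI) (hy : IsWeaklyRegular (MvPolynomial σ R) [y₁, y₂, y₃]) :
    IsCompleteIntersection c.idealX 3 := by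
  have hL : supported R (Set.range l ∪ Set.range m)ᶜ ≤ supported R (Set.range l)ᶜ :=
    supported_mono (Set.compl_subset_compl.mpr Set.subset_union_left)
  have hM : supported R (Set.range l ∪ Set.range m)ᶜ ≤ supported R (Set.range m)ᶜ :=
    supported_mono (Set.compl_subset_compl.mpr Set.subset_union_right)
  have hXl : ∀ i, (X (l i) : MvPolynomial σ R) ∈ supported R (Set.range m)ᶜ := fun i =>
    Algebra.subset_adjoin ⟨l i, by rintro ⟨j, hj⟩; exact hlm i j hj.symm, rfl⟩
  have hXm : ∀ i, (X (m i) : MvPolynomial σ R) ∈ supported R (Set.range l)ᶜ := fun i =>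
    Algebra.subset_adjoin ⟨m i, by rintro ⟨j, hj⟩; exact hlm j i hj, rfl⟩
  -- As polynomials in the variables `l j`, the generators `xⱼ/p` have leading coefficient `w₂`.
  have kl := koszulTorsion_add_mul_X hl (u := c.w₂)
    (c := ![c.h₁ - X (m 0) * c.w₁, c.h₂ - X (m 1) * c.w₁, c.h₃ - X (m 2) * c.w₁]) (hL hw₂) (by
      intro j
      fin_cases j
      exacts [sub_mem (hL hh₁) (mul_mem (hXm 0) (hL hw₁)),
        sub_mem (hL hh₂) (mul_mem (hXm 1) (hL hw₁)), sub_mem (hL hh₃) (mul_mem (hXm 2) (hL hw₁))])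
  -- As polynomials in the variables `m j`, they have leading coefficient `-w₁`.
  have km := koszulTorsion_add_mul_X hm (u := -c.w₁)
    (c := ![c.h₁ + X (l 0) * c.w₂, c.h₂ + X (l 1) * c.w₂, c.h₃ + X (l 2) * c.w₂])
    (neg_mem (hM hw₁)) (by
      intro j
      fin_cases j
      exacts [add_mem (hM hh₁) (mul_mem (hXl 0) (hM hw₂)),
        add_mem (hM hh₂) (mul_mem (hXl 1) (hM hw₂)), add_mem (hM hh₃) (mul_mem (hXl 2) (hM hw₂))])
  obtain ⟨hx₁, hx₂, hx₃⟩ := c.mem_idealX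
  have e₁ : q * c.x₁ = c.l₁ * c.w₂ - c.m₁ * c.w₁ + c.h₁ := by
    rw [x₁]
    linear_combination (c.l₁ * c.w₂ - c.m₁ * c.w₁ + c.h₁) * hq
  have e₂ : q * c.x₂ = c.l₂ * c.w₂ - c.m₂ * c.w₁ + c.h₂ := by
    rw [x₂]
    linear_combination (c.l₂ * c.w₂ - c.m₂ * c.w₁ + c.h₂) * hq
  have e₃ : q * c.x₃ = c.l₃ * c.w₂ - c.m₃ * c.w₁ + c.h₃ := by
    rw [x₃]
    linear_combination (c.l₃ * c.w₂ - c.m₃ * c.w₁ + c.h₃) * hq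
  have hv : ∀ j, ![q * c.x₁, q * c.x₂, q * c.x₃] j ∈ c.idealX := by
    intro j
    fin_cases j
    exacts [Ideal.mul_mem_left _ _ hx₁, Ideal.mul_mem_left _ _ hx₂, Ideal.mul_mem_left _ _ hx₃]
  have g : LocalGrade c.idealX ![c.w₂, -c.w₁]
      (fun _ => ![q * c.x₁, q * c.x₂, q * c.x₃]) ![y₁, y₂, y₃] (MvPolynomial σ R) 3 := by
    refine ⟨fun _ => hv, Fin.forall_fin_two.mpr ⟨?_, ?_⟩, ?_, KoszulTorsion.of_isWeaklyRegular hy⟩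
    · change KoszulTorsion c.w₂ (q * c.x₁) (q * c.x₂) (q * c.x₃) _ 3
      rw [e₁, e₂, e₃, hl₁, hl₂, hl₃, hm₁, hm₂, hm₃]
      convert kl using 1 <;> simp only [Matrix.cons_val] <;> ring
    · change KoszulTorsion (-c.w₁) (q * c.x₁) (q * c.x₂) (q * c.x₃) _ 3
      rw [e₁, e₂, e₃, hl₁, hl₂, hl₃, hm₁, hm₂, hm₃]
      convert km using 1 <;> simp only [Matrix.cons_val] <;> ring
    -- Modulo `w₁` and `w₂` the element `xⱼ/p` is `hⱼ`. So `K + (w₁, w₂)` contains `I`, and with it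
    -- the given regular sequence.
    · have t₂ : c.w₂ ∈ c.idealX ⊔ Ideal.span (Set.range ![c.w₂, -c.w₁]) :=
        Ideal.mem_sup_right (Ideal.subset_span ⟨0, rfl⟩)
      have t₁ : c.w₁ ∈ c.idealX ⊔ Ideal.span (Set.range ![c.w₂, -c.w₁]) :=
        Ideal.mem_sup_right (neg_mem_iff.mp (Ideal.subset_span ⟨1, rfl⟩))
      have key : ∀ {h x l' m' : MvPolynomial σ R}, x ∈ c.idealX →
          q * x = l' * c.w₂ - m' * c.w₁ + h →
          h ∈ c.idealX ⊔ Ideal.span (Set.range ![c.w₂, -c.w₁]) := fun {h x l' m'} hx e => by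
        rw [show h = q * x - l' * c.w₂ + m' * c.w₁ by linear_combination -e]
        exact add_mem (sub_mem (Ideal.mem_sup_left (Ideal.mul_mem_left _ _ hx))
          (Ideal.mul_mem_left _ _ t₂)) (Ideal.mul_mem_left _ _ t₁)
      have hle : c.idealI ≤ c.idealX ⊔ Ideal.span (Set.range ![c.w₂, -c.w₁]) :=
        c.idealI_le_iff.mpr ⟨t₁, t₂, key hx₁ e₁, key hx₂ e₂, key hx₃ e₃⟩
      intro k
      fin_cases k
      exacts [hle h₁, hle h₂, hle h₃]
  obtain ⟨f₁, m₁, f₂, m₂, f₃, m₃, hf⟩ := g.exists_isWeaklyRegular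
  exact isCompleteIntersection_of_span (fun h => hI (top_le_iff.mp (h ▸ c.idealX_le_idealI)))
    c.idealX_eq_span m₁ m₂ m₃ hf

end Generic

end LinkCoef

namespace BrownData

open ExteriorContraction

variable {R : Type u} [CommRing R] {F : Type v} {G : Type w}
  [AddCommGroup F] [Module R F] [AddCommGroup G] [Module R G] {D : BrownData R F G}
  {ℓ : Dual R F →ₗ[R] G}

theorem HasCoordinates.coef_eq {a : Matrix (Fin 2) (Fin 3) R} {s : Fin 3 → R} {z₁ z₂ : R}
    (h : D.HasCoordinates a s z₁ z₂) {L : Matrix (Fin 2) (Fin 3) R} (hL : D.HasMatrix ℓ L) :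
    D.coef ℓ = ⟨a 0 0, a 0 1, a 0 2, a 1 0, a 1 1, a 1 2, L 0 0, L 0 1, L 0 2, L 1 0, L 1 1, L 1 2,
      s 0, s 1, s 2, z₁, z₂, D.p (D.χG ⊗ₜ D.χF')⟩ := by
  have hφ : ∀ i j, D.β.repr (D.φ (D.e j)) i = a i j := fun i j => by
    rw [← h.φ_eq, LinearMap.toMatrix_apply]
  have hℓ : ∀ i j, D.β.repr (ℓ (D.e.coord j)) i = L i j := fun i j => by
    rw [hL j, map_sum, Finsupp.finsetSum_apply]
    simp [Finsupp.single_apply]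
  simp only [coef, hφ, hℓ, h.ψ_eq, h.ζ_eq, h.z₂_eq, map_add, map_smul, minor_ιMulti]
  simp

end BrownData

open MvPolynomial in
theorem isWeaklyRegular_map_C {R σ : Type*} [CommRing R] {y₁ y₂ y₃ : R}
    (h : IsWeaklyRegular R [y₁, y₂, y₃]) :
    IsWeaklyRegular (MvPolynomial σ R) [(C y₁ : MvPolynomial σ R), C y₂, C y₃] :=
  h.of_flat (S := MvPolynomial σ R)

namespace BrownData

open MvPolynomial

theorem exists_coef_p_mul {R : Type u} [CommRing R] {F : Type v} {G : Type w}
    [AddCommGroup F] [Module R F] [AddCommGroup G] [Module R G] (D : BrownData R F G)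
    (ℓ : Dual R F →ₗ[R] G) : ∃ q, (D.coef ℓ).p * q = 1 :=
  ⟨_, D.coef_p_mul ℓ⟩

section NewVariables

variable {R : Type u} [CommRing R] [IsNoetherianRing R] {F : Type v} {G : Type w}
  [AddCommGroup F] [Module R F] [AddCommGroup G] [Module R G] {D : BrownData R F G}
  {a : Matrix (Fin 2) (Fin 3) R} {s : Fin 3 → R} {z₁ z₂ : R}
  {D' : BrownData (MvPolynomial (Fin 2 × Fin 3) R)
    (Fin 3 → MvPolynomial (Fin 2 × Fin 3) R) (Fin 2 → MvPolynomial (Fin 2 × Fin 3) R)}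
  {ℓ : Dual (MvPolynomial (Fin 2 × Fin 3) R) (Fin 3 → MvPolynomial (Fin 2 × Fin 3) R)
    →ₗ[MvPolynomial (Fin 2 × Fin 3) R] (Fin 2 → MvPolynomial (Fin 2 × Fin 3) R)}

/-- The generators of `im b₁` are constants of the polynomial ring. Taking constant coefficients
shows that the extended ideal stays proper, and flatness preserves a regular sequence of length
three. -/
theorem generic_ℓ (h : D.HasCoordinates a s z₁ z₂) (hD : D.idealB ≠ ⊤) (hg : 3 ≤ idealGrade D.idealB)
    (h' : D'.HasCoordinates (a.map C) (fun i => C (s i)) (C z₁) (C z₂))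
    (hℓ : D'.HasMatrix ℓ (Matrix.of fun i j => X (i, j))) :
    D'.idealB ≠ ⊤ ∧ IsCompleteIntersection (D'.idealK ℓ) 3 := by
  -- The ideal `im b₁` does not depend on `ℓ`, so over `R` its coordinates may be taken with `ℓ =
  -- 0`.
  have e := h.coef_eq (ℓ := 0) (L := 0) (fun j => by simp)
  have e' := h'.coef_eq hℓ
  obtain ⟨q, hq⟩ := D'.exists_coef_p_mul ℓ
  rw [D.idealB_eq 0] at hD hg
  rw [D'.idealB_eq ℓ, D'.idealK_eq ℓ]
  set c := D.coef 0
  set c' := D'.coef ℓ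
  have hw₁ : c'.w₁ = C c.w₁ := by simp [e, e', LinkCoef.w₁]
  have hw₂ : c'.w₂ = C c.w₂ := by simp [e, e', LinkCoef.w₂]
  have hh₁ : c'.h₁ = C c.h₁ := by simp [e, e', LinkCoef.h₁, LinkCoef.d₁]
  have hh₂ : c'.h₂ = C c.h₂ := by simp [e, e', LinkCoef.h₂, LinkCoef.d₂]
  have hh₃ : c'.h₃ = C c.h₃ := by simp [e, e', LinkCoef.h₃, LinkCoef.d₃]
  obtain ⟨g₁, g₂, g₃, g₄, g₅⟩ := c.idealI_le_iff.mp le_rfl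
  have hI : c'.idealI ≠ ⊤ := by
    intro htop
    have : c'.idealI ≤ c.idealI.comap constantCoeff := c'.idealI_le_iff.mpr (by
      simp only [Ideal.mem_comap, hw₁, hw₂, hh₁, hh₂, hh₃, constantCoeff_C]
      exact ⟨g₁, g₂, g₃, g₄, g₅⟩)
    rw [htop, top_le_iff, Ideal.comap_eq_top_iff] at this
    exact hD this
  have hle : c.idealI ≤ c'.idealI.comap C := by
    obtain ⟨g₁, g₂, g₃, g₄, g₅⟩ := c'.idealI_le_iff.mp le_rfl
    rw [hw₁] at g₁
    rw [hw₂] at g₂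
    rw [hh₁] at g₃
    rw [hh₂] at g₄
    rw [hh₃] at g₅
    exact c.idealI_le_iff.mpr ⟨g₁, g₂, g₃, g₄, g₅⟩
  obtain ⟨y₁, m₁, y₂, m₂, y₃, m₃, hy⟩ := exists_isWeaklyRegular_three hg
  have hC : ∀ r : R, (C r : MvPolynomial (Fin 2 × Fin 3) R) ∈
      supported R (Set.range (fun j : Fin 3 => ((0 : Fin 2), j)) ∪
        Set.range (fun j : Fin 3 => ((1 : Fin 2), j)))ᶜ := fun r => Subalgebra.algebraMap_mem _ r
  refine ⟨hI, LinkCoef.isCompleteIntersection_idealX hq (l := fun j => (0, j)) (m := fun j => (1, j))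
    (fun i j hij => by simpa using hij) (fun i j hij => by simpa using hij) (fun i j => by simp)
    ?_ ?_ ?_ ?_ ?_ ?_ (hw₁ ▸ hC _) (hw₂ ▸ hC _) (hh₁ ▸ hC _) (hh₂ ▸ hC _) (hh₃ ▸ hC _) hI
    (hle m₁) (hle m₂) (hle m₃) (isWeaklyRegular_map_C hy)⟩ <;> rw [e'] <;> rfl

end NewVariables

end BrownData

instance : Finite QVar := by
  let f : (Fin 2 × Fin 3) ⊕ (Fin 2 × Fin 3) ⊕ Fin 3 ⊕ Bool → QVar := fun
    | .inl x => .a x.1 x.2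
    | .inr (.inl x) => .l x.1 x.2
    | .inr (.inr (.inl i)) => .s i
    | .inr (.inr (.inr b)) => bif b then .z₁ else .z₂
  refine Finite.of_surjective f fun x => ?_
  cases x with
  | a i j => exact ⟨.inl (i, j), rfl⟩
  | l i j => exact ⟨.inr (.inl (i, j)), rfl⟩
  | s i => exact ⟨.inr (.inr (.inl i)), rfl⟩
  | z₁ => exact ⟨.inr (.inr (.inr true)), rfl⟩
  | z₂ => exact ⟨.inr (.inr (.inr false)), rfl⟩

/-! ### Data consisting of seventeen variables. -/

namespace LinkCoef

open MvPolynomial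

variable {R : Type*} [CommRing R]

/-- The data built from variables, with `p` arbitrary. -/
noncomputable def generic (R : Type*) [CommRing R] (p : MvPolynomial QVar R) :
    LinkCoef (MvPolynomial QVar R) :=
  ⟨X (.a 0 0), X (.a 0 1), X (.a 0 2), X (.a 1 0), X (.a 1 1), X (.a 1 2),
    X (.l 0 0), X (.l 0 1), X (.l 0 2), X (.l 1 0), X (.l 1 1), X (.l 1 2),
    X (.s 0), X (.s 1), X (.s 2), X .z₁, X .z₂, p⟩

variable (p : MvPolynomial QVar R)

theorem generic_idealI_le : (generic R p).idealI ≤ RingHom.ker (constantCoeff (R := R)) := by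
  rw [idealI_le_iff]
  simp [generic, RingHom.mem_ker, w₁, w₂, h₁, h₂, h₃]

/-- The generators vanish when all variables are set to zero, whatever the value of `p`. This is why
the linked ideal is proper. -/
theorem generic_idealJ_le : (generic R p).idealJ ≤ RingHom.ker (constantCoeff (R := R)) := by
  rw [idealJ_le_iff]
  refine ⟨fun k => ?_, (idealX_le_idealI _).trans (generic_idealI_le p)⟩
  fin_cases k <;> simp [generic, RingHom.mem_ker, C₃, j₁, j₂, sg, dt]

theorem X_mem_supported_compl {σ : Type*} {i : Fin 3 → σ} {x : σ} (h : ∀ j, x ≠ i j) :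
    (X x : MvPolynomial σ R) ∈ supported R (Set.range i)ᶜ :=
  Algebra.subset_adjoin ⟨x, by rintro ⟨j, hj⟩; exact h j hj.symm, rfl⟩

theorem forall_fin_three {P : Fin 3 → Prop} : (∀ i, P i) ↔ P 0 ∧ P 1 ∧ P 2 := by
  simp [Fin.forall_fin_succ]

variable [IsNoetherianRing R]

/-- Each coordinate of `ψ` is, up to sign, the coefficient of one variable of each row of `φ` in
`w₁` and `w₂`, and of `z₁` in one of the `hᵢ`; these three variables do not occur otherwise in the
three elements. So the elements form a regular sequence once that coordinate is inverted, and the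
coordinates of `ψ` are themselves a regular sequence of length three. -/
theorem generic_exists_isWeaklyRegular : ∃ y₁ ∈ (generic R p).idealI, ∃ y₂ ∈ (generic R p).idealI,
    ∃ y₃ ∈ (generic R p).idealI, IsWeaklyRegular (MvPolynomial QVar R) [y₁, y₂, y₃] := by
  obtain ⟨g₁, g₂, g₃, g₄, g₅⟩ := (generic R p).idealI_le_iff.mp le_rfl
  let A (i : Fin 3 → QVar) := supported R (Set.range i)ᶜ
  have mem : ∀ {i : Fin 3 → QVar} {x : QVar}, (∀ j, x ≠ i j) → (X x : MvPolynomial QVar R) ∈ A i :=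
    fun h => X_mem_supported_compl h
  have k₃ := koszulTorsion_add_mul_X (R := R) (i := ![.a 0 0, .a 1 0, .z₁]) (u := X (.s 2))
    (c := ![-(X (.a 0 1) * X (.s 1)) + X (.a 0 2) * X (.s 0),
      -(X (.a 1 1) * X (.s 1)) + X (.a 1 2) * X (.s 0),
      -(X .z₂ * (X (.a 0 1) * X (.a 1 2) - X (.a 0 2) * X (.a 1 1)))])
    (by intro i j; fin_cases i <;> fin_cases j <;> simp)
    (mem (by simp [forall_fin_three]))
    (forall_fin_three.mpr ⟨
      add_mem (neg_mem (mul_mem (mem (by simp [forall_fin_three])) (mem (by simp [forall_fin_three]))))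
        (mul_mem (mem (by simp [forall_fin_three])) (mem (by simp [forall_fin_three]))),
      add_mem (neg_mem (mul_mem (mem (by simp [forall_fin_three])) (mem (by simp [forall_fin_three]))))
        (mul_mem (mem (by simp [forall_fin_three])) (mem (by simp [forall_fin_three]))),
      neg_mem (mul_mem (mem (by simp [forall_fin_three])) (sub_mem
        (mul_mem (mem (by simp [forall_fin_three])) (mem (by simp [forall_fin_three])))
        (mul_mem (mem (by simp [forall_fin_three])) (mem (by simp [forall_fin_three])))))⟩)
  have k₂ := koszulTorsion_add_mul_X (R := R) (i := ![.a 0 1, .a 1 1, .z₁]) (u := X (.s 1))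
    (c := ![-(X (.a 0 0) * X (.s 2)) - X (.a 0 2) * X (.s 0),
      -(X (.a 1 0) * X (.s 2)) - X (.a 1 2) * X (.s 0),
      X .z₂ * (X (.a 0 2) * X (.a 1 0) - X (.a 0 0) * X (.a 1 2))])
    (by intro i j; fin_cases i <;> fin_cases j <;> simp)
    (mem (by simp [forall_fin_three]))
    (forall_fin_three.mpr ⟨
      sub_mem (neg_mem (mul_mem (mem (by simp [forall_fin_three])) (mem (by simp [forall_fin_three]))))
        (mul_mem (mem (by simp [forall_fin_three])) (mem (by simp [forall_fin_three]))),
      sub_mem (neg_mem (mul_mem (mem (by simp [forall_fin_three])) (mem (by simp [forall_fin_three]))))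
        (mul_mem (mem (by simp [forall_fin_three])) (mem (by simp [forall_fin_three]))),
      mul_mem (mem (by simp [forall_fin_three])) (sub_mem
        (mul_mem (mem (by simp [forall_fin_three])) (mem (by simp [forall_fin_three])))
        (mul_mem (mem (by simp [forall_fin_three])) (mem (by simp [forall_fin_three]))))⟩)
  have k₁ := koszulTorsion_add_mul_X (R := R) (i := ![.a 0 2, .a 1 2, .z₁]) (u := X (.s 0))
    (c := ![X (.a 0 0) * X (.s 2) - X (.a 0 1) * X (.s 1),
      X (.a 1 0) * X (.s 2) - X (.a 1 1) * X (.s 1),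
      -(X .z₂ * (X (.a 0 0) * X (.a 1 1) - X (.a 0 1) * X (.a 1 0)))])
    (by intro i j; fin_cases i <;> fin_cases j <;> simp)
    (mem (by simp [forall_fin_three]))
    (forall_fin_three.mpr ⟨
      sub_mem (mul_mem (mem (by simp [forall_fin_three])) (mem (by simp [forall_fin_three])))
        (mul_mem (mem (by simp [forall_fin_three])) (mem (by simp [forall_fin_three]))),
      sub_mem (mul_mem (mem (by simp [forall_fin_three])) (mem (by simp [forall_fin_three])))
        (mul_mem (mem (by simp [forall_fin_three])) (mem (by simp [forall_fin_three]))),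
      neg_mem (mul_mem (mem (by simp [forall_fin_three])) (sub_mem
        (mul_mem (mem (by simp [forall_fin_three])) (mem (by simp [forall_fin_three])))
        (mul_mem (mem (by simp [forall_fin_three])) (mem (by simp [forall_fin_three])))))⟩)
  -- With `u = 1` and `c = 0` the three elements are the variables `X (.s j)`, and torsion means
  -- vanishing.
  have k₀ := koszulTorsion_add_mul_X (R := R) (i := QVar.s) (u := 1) (c := 0)
    (fun i j h => by simpa using h) (one_mem _) (fun _ => zero_mem _)
  have g : LocalGrade (generic R p).idealI ![X (.s 0), X (.s 1), X (.s 2)]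
      ![![(generic R p).w₁, (generic R p).w₂, -(generic R p).h₃],
        ![-(generic R p).w₁, -(generic R p).w₂, (generic R p).h₂],
        ![(generic R p).w₁, (generic R p).w₂, -(generic R p).h₁]]
      ![X (QVar.s 0), X (QVar.s 1), X (QVar.s 2)] (MvPolynomial QVar R) 3 := by
    refine ⟨forall_fin_three.mpr ⟨forall_fin_three.mpr ⟨g₁, g₂, neg_mem g₅⟩,
      forall_fin_three.mpr ⟨neg_mem g₁, neg_mem g₂, g₄⟩,
      forall_fin_three.mpr ⟨g₁, g₂, neg_mem g₃⟩⟩, forall_fin_three.mpr ⟨?_, ?_, ?_⟩,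
      fun k => Ideal.mem_sup_right (Ideal.subset_span ⟨k, rfl⟩), ?_⟩
    · change KoszulTorsion (X (QVar.s 0)) (generic R p).w₁ (generic R p).w₂ (-(generic R p).h₃) _ 3
      convert k₁ using 1 <;> simp only [Matrix.cons_val, generic, w₁, w₂, h₃, d₃] <;> ring
    · change KoszulTorsion (X (QVar.s 1)) (-(generic R p).w₁) (-(generic R p).w₂) (generic R p).h₂ _ 3
      convert k₂ using 1 <;> simp only [Matrix.cons_val, generic, w₁, w₂, h₂, d₂] <;> ring
    · change KoszulTorsion (X (QVar.s 2)) (generic R p).w₁ (generic R p).w₂ (-(generic R p).h₁) _ 3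
      convert k₃ using 1 <;> simp only [Matrix.cons_val, generic, w₁, w₂, h₁, d₁] <;> ring
    · change KoszulTorsion 1 (X (QVar.s 0)) (X (QVar.s 1)) (X (QVar.s 2)) _ 3
      convert k₀ using 1 <;> simp
  exact g.exists_isWeaklyRegular

theorem generic_isCompleteIntersection [Nontrivial R] {q : MvPolynomial QVar R} (hq : p * q = 1) :
    (generic R p).idealI ≠ ⊤ ∧ IsCompleteIntersection (generic R p).idealX 3 := by
  have hI : (generic R p).idealI ≠ ⊤ := fun h =>
    RingHom.ker_ne_top (constantCoeff (R := R) (σ := QVar)) (top_le_iff.mp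
      (h ▸ generic_idealI_le p))
  have mem : ∀ x : QVar, (∀ i j, x ≠ .l i j) → (X x : MvPolynomial QVar R) ∈
      (supported R (Set.range (QVar.l 0) ∪ Set.range (QVar.l 1))ᶜ).toSubring := fun x h =>
    Algebra.subset_adjoin ⟨x, by rintro (⟨j, hj⟩ | ⟨j, hj⟩) <;> exact h _ j hj.symm, rfl⟩
  obtain ⟨m₁, m₂, m₃, m₄, m₅⟩ := (generic R p).mem_subring
    (mem (.a 0 0) (by simp)) (mem (.a 0 1) (by simp)) (mem (.a 0 2) (by simp))
    (mem (.a 1 0) (by simp)) (mem (.a 1 1) (by simp)) (mem (.a 1 2) (by simp))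
    (mem (.s 0) (by simp)) (mem (.s 1) (by simp)) (mem (.s 2) (by simp)) (mem .z₁ (by simp))
    (mem .z₂ (by simp))
  obtain ⟨y₁, i₁, y₂, i₂, y₃, i₃, hy⟩ := generic_exists_isWeaklyRegular p
  exact ⟨hI, isCompleteIntersection_idealX (c := generic R p) hq (fun i j h => by simpa using h)
    (fun i j h => by simpa using h) (by simp) rfl rfl rfl rfl rfl rfl m₁ m₂ m₃ m₄ m₅ hI i₁ i₂ i₃ hy⟩

end LinkCoef

theorem theorem6p1 {R : Type u} [CommRing R] [IsNoetherianRing R] :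
    -- for all data, `c` is a map of complexes and `Tot(c*)` is `Q` plus a split exact summand
    (∀ {F : Type v} {G : Type w} [AddCommGroup F] [Module R F] [AddCommGroup G] [Module R G]
      (D : BrownData R F G) (ℓ : Dual R F →ₗ[R] G), D.DualConeIsQ ℓ) ∧
    -- linkage, whenever `im (p ∘ b₁ ∘ c₁)` is a complete intersection of grade three
    (∀ {F : Type v} {G : Type w} [AddCommGroup F] [Module R F] [AddCommGroup G] [Module R G]
      (D : BrownData R F G) (ℓ : Dual R F →ₗ[R] G), D.idealB ≠ ⊤ →
      IsCompleteIntersection (D.idealK ℓ) 3 → D.ObtainedByOneLink ℓ) ∧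
    -- if `im b₁` is proper of grade at least three, then this is so for the general `ℓ`, whose
    -- matrix consists of six new variables
    (∀ {F : Type v} {G : Type w} [AddCommGroup F] [Module R F] [AddCommGroup G] [Module R G]
      (D : BrownData R F G) (a : Matrix (Fin 2) (Fin 3) R) (s : Fin 3 → R) (z₁ z₂ : R),
      D.HasCoordinates a s z₁ z₂ → D.idealB ≠ ⊤ → 3 ≤ idealGrade D.idealB →
      ∀ (D' : BrownData (MvPolynomial (Fin 2 × Fin 3) R)
          (Fin 3 → MvPolynomial (Fin 2 × Fin 3) R) (Fin 2 → MvPolynomial (Fin 2 × Fin 3) R))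
        (ℓ : Dual (MvPolynomial (Fin 2 × Fin 3) R) (Fin 3 → MvPolynomial (Fin 2 × Fin 3) R)
          →ₗ[MvPolynomial (Fin 2 × Fin 3) R] (Fin 2 → MvPolynomial (Fin 2 × Fin 3) R)),
        D'.HasCoordinates (a.map MvPolynomial.C) (fun i => MvPolynomial.C (s i))
          (MvPolynomial.C z₁) (MvPolynomial.C z₂) →
        D'.HasMatrix ℓ (Matrix.of fun i j => MvPolynomial.X (i, j)) →
        D'.idealB ≠ ⊤ ∧ IsCompleteIntersection (D'.idealK ℓ) 3 ∧ D'.ObtainedByOneLink ℓ) ∧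
    -- this is so if `Q` is built using variables over `R`
    (Nontrivial R →
      ∀ (D : BrownData (MvPolynomial QVar R)
          (Fin 3 → MvPolynomial QVar R) (Fin 2 → MvPolynomial QVar R))
        (ℓ : Dual (MvPolynomial QVar R) (Fin 3 → MvPolynomial QVar R)
          →ₗ[MvPolynomial QVar R] (Fin 2 → MvPolynomial QVar R)),
        D.HasCoordinates (Matrix.of fun i j => MvPolynomial.X (QVar.a i j))
          (fun i => MvPolynomial.X (QVar.s i))
          (MvPolynomial.X QVar.z₁) (MvPolynomial.X QVar.z₂) →
        D.HasMatrix ℓ (Matrix.of fun i j => MvPolynomial.X (QVar.l i j)) →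
        D.idealB ≠ ⊤ ∧ IsCompleteIntersection (D.idealK ℓ) 3 ∧ D.ObtainedByOneLink ℓ ∧
          D.idealQ ℓ ≠ ⊤) := by
  refine ⟨fun D ℓ => D.dualConeIsQ ℓ, fun D ℓ hI hK => BrownData.obtainedByOneLink hI hK,
    fun D a s z₁ z₂ h hD hg D' ℓ h' hℓ => ?_, fun hR D ℓ h hℓ => ?_⟩
  · obtain ⟨hI, hK⟩ := BrownData.generic_ℓ h hD hg h' hℓ
    exact ⟨hI, hK, BrownData.obtainedByOneLink hI hK⟩
  -- All scalars except `p` are prescribed variables; `p` stays arbitrary, and only its being a unit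
  -- is used.
  · have e : D.coef ℓ = LinkCoef.generic R (D.coef ℓ).p := h.coef_eq hℓ
    obtain ⟨q, hq⟩ := D.exists_coef_p_mul ℓ
    obtain ⟨hI, hK⟩ := LinkCoef.generic_isCompleteIntersection _ hq
    rw [← e, ← D.idealB_eq ℓ] at hI
    rw [← e, ← D.idealK_eq ℓ] at hK
    refine ⟨hI, hK, BrownData.obtainedByOneLink hI hK, fun htop => ?_⟩
    rw [D.idealQ_eq ℓ, e] at htop
    exact RingHom.ker_ne_top (MvPolynomial.constantCoeff (R := R) (σ := QVar))
      (top_le_iff.mp (htop ▸ LinkCoef.generic_idealJ_le _))
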